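/- **Setting.** Let $\alpha\in\mathbb Z$ and let $Q\subset\mathbb C$ be a finite set, $Q^\times=Q\setminus\{0\}$, such that (1) $\{0,1\}\subseteq Q$; (2) $Q\cap(0,1)=\varnothing$; (3) $\Re(u)>0$ and $|u-1/4|>1/4$ for all $u\in Q^\times$; (4) $2\Re(u/v)<\Re(v)$ for all $u\in Q$, $v\in Q^\times$ with $u\ne v$. **Iterated integrals.** For a path $\gamma$ on $(0,1)$ and $1$-forms $\omega_1,\dots,\omega_k$ along $\gamma$, there is a unique polynomial $P$ such that the iterated integral $\int_{z<t_1<\cdots<t_k<1-z}\gamma^*\omega_1(t_1)\cdots\gamma^*\omega_k(t_k)$ equals $P(\log z)+O(z(\log z)^J)$ for some $J$ as $z\to+0$ (for all the words below such a $P$ exists), and $I_\gamma(\omega_1\cdots\omega_k):=P(0)$. Write $e_a=dx/(x-a)$ and $e_\infty=0$. Let $\beta$ be the (homotopy class of the) loop based at $0$ which runs from $0$ along $(0,1)$ to near $1$, once counterclockwise around $1$ inside $|y-1|<1$ (this punctured disc contains no $a/b$ with $a\in Q$, $b\in Q^\times$), and back to $0$ along $(0,1)$, with $\beta'(0)=1$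 and $\beta'(1)=-1$. **Refined symmetric multiple polylogarithms.** For $z_1,\dots,z_r\in Q$ and positive integers $k_1,\dots,k_r$ put, in $\mathbb C[[t]]$, $$\mathcal L_{RS,\alpha}\binom{z_1,\dots,z_r}{k_1,\dots,k_r}=\frac{(-1)^r}{2\pi i}\sum_{u\in Q^\times}u^\alpha\sum_{n\ge0}I_\beta\bigl(e_{u/z_1}e_0^{k_1-1}\cdots e_{u/z_r}e_0^{k_r-1}e_ue_0^n\bigr)t^n,$$ and, for $r\ge1$, $$\mathcal L^\star_{RS,\alpha}\binom{z_1,\dots,z_r}{k_1,\dots,k_r}=\sum_{d=0}^{r-1}\ \sum_{0=i_0<i_1<\cdots<i_{d+1}=r}\mathcal L_{RS,\alpha}\binom{z_{i_0+1},\dots,z_{i_d+1}}{k_{i_0+1}+\cdots+k_{i_1},\dots,k_{i_d+1}+\cdots+k_{i_{d+1}}}.$$ **Forms along $\eta_u$.** For $u\in Q^\times$ let $\eta_u$ be the path $s\mapsto \frac u2+i\bigl(\frac1s-\frac1{1-s}\bigr)$, $0<s<1$, and let $f_{a,b,t}=(x-a)^{-1}\exp(t\log(x-b))\,dx$, expanded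 as a power series in $t$. Here $\log\eta_u(s)$ is the principal branch, and $\log(\eta_u(s)-u^{-1})$ is the continuous branch on $0<s<1$ with $\lim_{s\to1}\bigl(\log(\eta_u(s)-u^{-1})-\log\eta_u(s)\bigr)=0$. Integrals are taken coefficientwise in $t$. **Statement.** For $r\ge1$, $z_1,\dots,z_r\in Q$ and positive integers $k_1,\dots,k_r$ the regularized integrals above and below exist, and in $\mathbb C[[t]]$ $$\sum_{n=0}^\infty\mathcal L^\star_{RS,\alpha}\binom{z_1,\dots,z_r,\{1\}^n}{k_1,\dots,k_r,\{1\}^n}t^n=\frac{(-1)^{k_1+\cdots+k_r}}{2\pi i}\sum_{u\in Q^\times}u^\alpha I_{\eta_u}\Bigl((e_{z_1/u}-e_0)e_0^{k_1-1}e_{z_2/u}e_0^{k_2-1}\cdots e_{z_r/u}e_0^{k_r-1}(f_{1/u,1/u,t}-f_{0,0,t})\Bigr).$$ -/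

import Mathlib

open Filter Topology Asymptotics
open scoped PowerSeries.WithPiTopology

noncomputable section

namespace SymMPL

/-! ### Iterated integrals and their regularization

A `1`-form along a path `γ : (0,1) → ℂ` is represented by its pull-back `φ(t) dt` to the parameter
interval, i.e. by a function `φ : ℝ → ℂ`; a word in `1`-forms is a list of such functions. -/

/-- The iterated integral `∫_{a < t₁ < ⋯ < tₖ < b} φ₁(t₁) ⋯ φₖ(tₖ) dt₁ ⋯ dtₖ` of the word
`[φ₁, …, φₖ]`, written as an iteration of one-dimensional integrals; it is `1` for the empty
word. -/
def iterInt : List (ℝ → ℂ) → ℝ → ℝ → ℂ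
  | [], _, _ => 1
  | φ :: w, a, b => ∫ s in a..b, φ s * iterInt w s b

/-- `v` is the regularized value as `z → +0` of `F`: there is a polynomial `P` with
`F(z) = P(log z) + O(z (log z)^J)` for some `J`, and `v = P(0)`.
(Such a `P` is unique, hence so is `v`.) -/
def IsRegValue (F : ℝ → ℂ) (v : ℂ) : Prop :=
  ∃ (P : Polynomial ℂ) (J : ℕ),
    ((fun z : ℝ => F z - P.eval (Real.log z : ℂ)) =O[𝓝[>] (0 : ℝ)]
      fun z : ℝ => z * |Real.log z| ^ J) ∧
    P.eval 0 = v

/-- The regularized iterated integral of the word `w` exists. -/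
def RegExists (w : List (ℝ → ℂ)) : Prop :=
  ∃ v : ℂ, IsRegValue (fun z => iterInt w z (1 - z)) v

open Classical in
/-- The regularized iterated integral of the word `w`: the constant term of the asymptotic
expansion in `log z` of the iterated integral over the shortened parameter interval `[z, 1 - z]`
(and `0` if there is no such expansion). -/
def regInt (w : List (ℝ → ℂ)) : ℂ :=
  if h : RegExists w then h.choose else 0

/-- The form `e_a = dx / (x - a)`, pulled back along `γ`. -/
def eForm (γ : ℝ → ℂ) (a : ℂ) : ℝ → ℂ := fun t => deriv γ t / (γ t - a)

/-- The form `e_{u/z}` pulled back along `γ`, where `e_∞ = 0`, that is, it vanishes for `z = 0`. -/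
def eQuot (γ : ℝ → ℂ) (u z : ℂ) : ℝ → ℂ := if z = 0 then 0 else eForm γ (u / z)

/-- The coefficient of `tⁿ` (with `t` the formal variable) in the form
`f_{a,b,t} = (x - a)⁻¹ exp(t log(x - b)) dx`, pulled back along `γ`. The argument `L` is the branch
of `log(x - b)` along `γ`, i.e. `s ↦ log(γ(s) - b)`. -/
def fForm (γ : ℝ → ℂ) (a : ℂ) (L : ℝ → ℂ) (n : ℕ) : ℝ → ℂ :=
  fun s => deriv γ s / (γ s - a) * (L s ^ n / (n.factorial : ℂ))

/-! ### The set `Q` and the loop `β` -/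

/-- The standing assumptions on the finite set `Q` of complex numbers. -/
structure IsAdmissible (Q : Finset ℂ) : Prop where
  zero_mem : (0 : ℂ) ∈ Q
  one_mem : (1 : ℂ) ∈ Q
  not_mem_Ioo : ∀ x : ℝ, 0 < x → x < 1 → (x : ℂ) ∉ Q
  re_pos : ∀ u ∈ Q, u ≠ 0 → 0 < u.re
  norm_sub : ∀ u ∈ Q, u ≠ 0 → 1 / 4 < ‖u - 1 / 4‖
  re_div_lt : ∀ u ∈ Q, ∀ v ∈ Q, v ≠ 0 → u ≠ v → 2 * (u / v).re < v.re

/-- The loop `β = dch · c · dch⁻¹` that goes from `0` to (near) `1` on the real axis, once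
counterclockwise around `1`, and back to `0`. Iterated integrals along `β` only depend on its
homotopy class (with its unit tangent vectors at the end points), and
`β(t) = 1 - (1 - t + t²) exp(2πi (3t² - 2t³))` is a smooth representative of the class:
`β(0) = β(1) = 0`, `β'(0) = 1`, `β'(1) = -1`, and for `0 < t < 1` it runs in the punctured disc
`0 < |y - 1| < 1`, winding once counterclockwise around `1`. For admissible `Q` that punctured disc
contains no quotient `a / b` with `a, b ∈ Q`, `b ≠ 0`. -/
def β (t : ℝ) : ℂ :=
  1 - (1 - t + t ^ 2 : ℂ) * Complex.exp (2 * Real.pi * Complex.I * (3 * t ^ 2 - 2 * t ^ 3))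

/-! ### Refined symmetric multiple polylogarithms

An array `(z₁, …, z_r; k₁, …, k_r)` is represented by the list of its columns `(zᵢ, kᵢ)`. -/

/-- The word `e_{u/z₁} e₀^{k₁-1} ⋯ e_{u/z_r} e₀^{k_r-1} e_u e₀ⁿ` along `β`. -/
def rsWord (u : ℂ) (w : List (ℂ × ℕ)) (n : ℕ) : List (ℝ → ℂ) :=
  w.flatMap (fun p => eQuot β u p.1 :: List.replicate (p.2 - 1) (eForm β 0)) ++
    eForm β u :: List.replicate n (eForm β 0)

/-- The refined symmetric multiple polylogarithm
`(-1)^r / (2πi) ∑_{u ∈ Q, u ≠ 0} u^α ∑_n I_β(e_{u/z₁} e₀^{k₁-1} ⋯ e_{u/z_r} e₀^{k_r-1} e_u e₀ⁿ) tⁿ`,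
a formal power series in `t`. -/
def rs (Q : Finset ℂ) (α : ℤ) (w : List (ℂ × ℕ)) : PowerSeries ℂ :=
  PowerSeries.mk fun n =>
    (-1) ^ w.length / (2 * Real.pi * Complex.I) *
      ∑ u ∈ Q.erase 0, u ^ α * regInt (rsWord u w n)

/-- Merge consecutive columns into one: keep the first `z` and add up the `k`s. -/
def merge (b : List (ℂ × ℕ)) : ℂ × ℕ :=
  ((b.map Prod.fst).headD 0, (b.map Prod.snd).sum)

/-- The star version: the sum of `rs` over all ways to cut a nonempty array into consecutive
nonempty blocks, each block being merged into one column. -/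
def rsStar (Q : Finset ℂ) (α : ℤ) (w : List (ℂ × ℕ)) : PowerSeries ℂ :=
  ∑ c : Composition w.length, rs Q α ((w.splitWrtComposition c).map merge)

/-! ### The integrals along `η_u` -/

/-- The path `η_u(t) = u/2 + i (1/t - 1/(1-t))`, `0 < t < 1`, from `∞` to `∞`: it runs down the
vertical line through `u/2`. -/
def eta (u : ℂ) (t : ℝ) : ℂ := u / 2 + Complex.I * ((t : ℂ)⁻¹ - (1 - (t : ℂ))⁻¹)

/-- `L` is the branch of `t ↦ log(η_u(t) - u⁻¹)` on `(0,1)` such that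
`log(η_u(t) - u⁻¹) - log(η_u(t)) → 0` as `t → 1`. Here `log(η_u(t))` is the principal logarithm,
`η_u` lying in the right half-plane. There is exactly one such branch on `(0,1)`. -/
structure IsLogBranch (u : ℂ) (L : ℝ → ℂ) : Prop where
  continuousOn : ContinuousOn L (Set.Ioo 0 1)
  exp_eq : ∀ t ∈ Set.Ioo (0 : ℝ) 1, Complex.exp (L t) = eta u t - u⁻¹
  tendsto : Tendsto (fun t => L t - Complex.log (eta u t)) (𝓝[<] (1 : ℝ)) (𝓝 0)

/-- The word `(e_{z₁/u} - e₀) e₀^{k₁-1} e_{z₂/u} e₀^{k₂-1} ⋯ e_{z_r/u} e₀^{k_r-1}` along `η_u`. -/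
def etaPrefix (u : ℂ) : List (ℂ × ℕ) → List (ℝ → ℂ)
  | [] => []
  | (z, k) :: w =>
    (eForm (eta u) (z / u) - eForm (eta u) 0) :: List.replicate (k - 1) (eForm (eta u) 0) ++
      w.flatMap (fun p => eForm (eta u) (p.1 / u) :: List.replicate (p.2 - 1) (eForm (eta u) 0))

/-- The coefficient of `tᵐ` in the word
`(e_{z₁/u} - e₀) e₀^{k₁-1} ⋯ e_{z_r/u} e₀^{k_r-1} (f_{1/u,1/u,t} - f_{0,0,t})` along `η_u`, where `L`
is the branch of `log(η_u - u⁻¹)`. -/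
def etaWord (u : ℂ) (L : ℝ → ℂ) (w : List (ℂ × ℕ)) (m : ℕ) : List (ℝ → ℂ) :=
  etaPrefix u w ++
    [fForm (eta u) u⁻¹ L m - fForm (eta u) 0 (fun t => Complex.log (eta u t)) m]

/-- The power series
`I_{η_u}((e_{z₁/u} - e₀) e₀^{k₁-1} ⋯ e_{z_r/u} e₀^{k_r-1} (f_{1/u,1/u,t} - f_{0,0,t}))` in `t`. -/
def etaInt (u : ℂ) (L : ℝ → ℂ) (w : List (ℂ × ℕ)) : PowerSeries ℂ :=
  PowerSeries.mk fun m => regInt (etaWord u L w m)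

end SymMPL

end

noncomputable section

namespace SymMPL

open Set MeasureTheory intervalIntegral

/-!
The substitution `x = 1 / y` turns `β` into a path from `∞` to `∞` on which `e_{u/z}` becomes
`e_{z/u} - e_0` and `e_0` becomes `-e_0`. Along this path every word ends in the convergent form
`(e_{1/u} - e_0) (log x)ⁿ / n!`: the divergent tail `e_0ⁿ` integrates to a power of the logarithm,
and what remains converges after merely cutting off the end points.

Reading a convergent iterated integral from its last letter, each letter `φ` acts as the operator
`k ↦ (s ↦ ∫_s^1 φ k)`. The star sum merges columns, that is, it replaces a letter `e_{z/u} - e_0`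
by `-e_0` with the opposite sign; so it turns all letters but the first one into `-e_{z/u}` and
`-e_0`. On the other side, expanding the primitive of `f_{1/u,1/u,t} - f_{0,0,t}` in powers of the
logarithm gives the words `e_{1/u}ⁿ (e_{1/u} - e_0) (log x)^{m-n} / (m-n)!`, which account for the
appended columns `(1, 1)`.

Both sides are now the same iterated integral, over `1 / β` and over `η_u`. For some
`0 < c < Re u / 2` all poles lie in `Re x < c` or at `1`, and both paths run in the half-plane
`c < Re x` slit along `[1, ∞)`, where the primitives are holomorphic and decay like `1 / x` up to
logarithms. So the two integrals agree.
-/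

/-! ### The logarithmic weight on the unit interval -/

/-- The weight `1 - log t - log (1 - t)`, which is at least `1` on `(0,1)` and grows
logarithmically at both ends. -/
def lam (t : ℝ) : ℝ := 1 - Real.log t - Real.log (1 - t)

lemma one_sub_mem_Ioo {t : ℝ} (ht : t ∈ Ioo (0 : ℝ) 1) : 1 - t ∈ Ioo (0 : ℝ) 1 :=
  ⟨by linarith [ht.2], by linarith [ht.1]⟩

lemma mul_one_sub_pos {t : ℝ} (ht : t ∈ Ioo (0 : ℝ) 1) : 0 < t * (1 - t) :=
  mul_pos ht.1 (sub_pos.2 ht.2)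

lemma lam_one_sub (t : ℝ) : lam (1 - t) = lam t := by
  simp only [lam, sub_sub_cancel]; ring

lemma one_le_lam {t : ℝ} (ht : t ∈ Ioo (0 : ℝ) 1) : 1 ≤ lam t := by
  have h1 := Real.log_nonpos ht.1.le ht.2.le
  have h2 := Real.log_nonpos (sub_pos.2 ht.2).le (one_sub_mem_Ioo ht).2.le
  simp only [lam]; linarith

lemma lam_pos {t : ℝ} (ht : t ∈ Ioo (0 : ℝ) 1) : 0 < lam t :=
  one_pos.trans_le (one_le_lam ht)

lemma lam_eq {t : ℝ} (ht : t ∈ Ioo (0 : ℝ) 1) : lam t = 1 - Real.log (t * (1 - t)) := by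
  rw [Real.log_mul ht.1.ne' (sub_pos.2 ht.2).ne', lam]; ring

lemma lam_le_lam {z s : ℝ} (hz : 0 < z) (hs : s ∈ Icc z (1 - z)) : lam s ≤ lam z := by
  obtain ⟨hzs, hsz⟩ := hs
  have hz1 : z ∈ Ioo (0 : ℝ) 1 := ⟨hz, by linarith⟩
  rw [lam_eq hz1, lam_eq ⟨hz.trans_le hzs, by linarith⟩]
  have := Real.log_le_log (mul_one_sub_pos hz1) (by nlinarith : z * (1 - z) ≤ s * (1 - s))
  linarith

lemma pow_lam_le {t : ℝ} (ht : t ∈ Ioo (0 : ℝ) 1) {m n : ℕ} (h : m ≤ n) :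
    lam t ^ m ≤ lam t ^ n := pow_le_pow_right₀ (one_le_lam ht) h

lemma hasDerivAt_lam {t : ℝ} (ht : t ∈ Ioo (0 : ℝ) 1) :
    HasDerivAt lam (-t⁻¹ + (1 - t)⁻¹) t := by
  have h := ((hasDerivAt_const t (1 : ℝ)).sub (Real.hasDerivAt_log ht.1.ne')).sub
    (((hasDerivAt_id t).const_sub 1).log (sub_pos.2 ht.2).ne')
  refine h.congr_deriv ?_
  simp only [id]; ring

lemma continuousOn_lam : ContinuousOn lam (Ioo 0 1) := fun _ ht =>
  (hasDerivAt_lam ht).continuousAt.continuousWithinAt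

lemma isBigO_lam_log : lam =O[𝓝[>] 0] Real.log := by
  have hz : Ioo (0 : ℝ) (Real.exp (-1)) ∈ 𝓝[>] (0 : ℝ) := Ioo_mem_nhdsGT (Real.exp_pos _)
  have hz' : Ioo (0 : ℝ) 2⁻¹ ∈ 𝓝[>] (0 : ℝ) := Ioo_mem_nhdsGT (by norm_num)
  refine IsBigO.of_bound 3 ?_
  filter_upwards [hz, hz'] with z hze hz2
  have hz1 : z ∈ Ioo (0 : ℝ) 1 := ⟨hz2.1, by linarith [hz2.2]⟩
  have hlog : Real.log z < -1 := (Real.log_lt_iff_lt_exp hz1.1).2 hze.2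
  have hle : Real.log z ≤ Real.log (1 - z) := Real.log_le_log hz1.1 (by linarith [hz2.2])
  rw [Real.norm_of_nonneg (lam_pos hz1).le, Real.norm_of_nonpos (by linarith), lam]
  linarith

lemma tendsto_mul_abs_log_pow (J : ℕ) :
    Tendsto (fun z : ℝ => z * |Real.log z| ^ J) (𝓝[>] 0) (𝓝 0) := by
  have h := (isLittleO_abs_log_rpow_rpow_nhdsGT_zero (J : ℝ) neg_one_lt_zero).tendsto_div_nhds_zero
  refine h.congr' ?_
  filter_upwards [self_mem_nhdsWithin] with z _
  rw [Real.rpow_natCast, Real.rpow_neg_one, div_inv_eq_mul, mul_comm]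

/-- The weights `tⁱ (1 - t)ʲ` up to powers of the logarithm, in which growth at the end points of
the unit interval is measured. -/
def weight (i j : ℤ) (J : ℕ) (t : ℝ) : ℝ := t ^ i * (1 - t) ^ j * lam t ^ J

lemma weight_neg_one_zero (J : ℕ) (t : ℝ) : weight (-1) 0 J t = lam t ^ J / t := by
  simp [weight, div_eq_inv_mul]

lemma weight_one_zero (J : ℕ) (t : ℝ) : weight 1 0 J t = t * lam t ^ J := by simp [weight]

lemma weight_zero_one (J : ℕ) (t : ℝ) : weight 0 1 J t = (1 - t) * lam t ^ J := by simp [weight]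

lemma weight_one_sub (i j : ℤ) (J : ℕ) (t : ℝ) : weight i j J (1 - t) = weight j i J t := by
  simp only [weight, lam_one_sub, sub_sub_cancel]; ring

lemma weight_pos {t : ℝ} (ht : t ∈ Ioo (0 : ℝ) 1) (i j : ℤ) (J : ℕ) : 0 < weight i j J t :=
  mul_pos (mul_pos (zpow_pos ht.1 i) (zpow_pos (sub_pos.2 ht.2) j)) (pow_pos (lam_pos ht) J)

lemma weight_mul_weight {t : ℝ} (ht : t ∈ Ioo (0 : ℝ) 1) (i j i' j' : ℤ) (J J' : ℕ) :
    weight i j J t * weight i' j' J' t = weight (i + i') (j + j') (J + J') t := by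
  simp only [weight, zpow_add₀ ht.1.ne', zpow_add₀ (sub_pos.2 ht.2).ne', pow_add]; ring

lemma weight_le_weight {t : ℝ} (ht : t ∈ Ioo (0 : ℝ) 1) {i j i' j' : ℤ} {J J' : ℕ} (hi : i' ≤ i)
    (hj : j' ≤ j) (hJ : J ≤ J') : weight i j J t ≤ weight i' j' J' t := by
  have h0 := (zpow_pos (sub_pos.2 ht.2) j).le
  have h1 := (zpow_pos ht.1 i').le
  refine mul_le_mul (mul_le_mul ?_ ?_ h0 h1) (pow_lam_le ht hJ) (pow_nonneg (lam_pos ht).le J)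
    (mul_nonneg h1 (zpow_pos (sub_pos.2 ht.2) j').le)
  · exact zpow_le_zpow_right_of_le_one₀ ht.1 ht.2.le hi
  · exact zpow_le_zpow_right_of_le_one₀ (sub_pos.2 ht.2) (one_sub_mem_Ioo ht).2.le hj

lemma continuousOn_weight (i j : ℤ) (J : ℕ) : ContinuousOn (weight i j J) (Ioo 0 1) := by
  refine ContinuousOn.mul (ContinuousOn.mul ?_ ?_) (continuousOn_lam.pow J)
  · exact continuousOn_id.zpow₀ i fun t ht => Or.inl ht.1.ne'
  · exact (continuousOn_const.sub continuousOn_id).zpow₀ j fun t ht => Or.inl (sub_pos.2 ht.2).ne'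

lemma isBigO_weight_one_zero (J : ℕ) :
    weight 1 0 J =O[𝓝[>] 0] fun z => z * |Real.log z| ^ J :=
  ((isBigO_refl (fun z : ℝ => z) _).mul (isBigO_lam_log.norm_right.pow J)).congr_left fun z =>
    (weight_one_zero J z).symm

lemma tendsto_weight_one_zero (J : ℕ) : Tendsto (weight 1 0 J) (𝓝[>] 0) (𝓝 0) :=
  (isBigO_weight_one_zero J).trans_tendsto (tendsto_mul_abs_log_pow J)

lemma tendsto_one_sub_nhdsLT_one : Tendsto (fun s : ℝ => 1 - s) (𝓝[<] 1) (𝓝[>] 0) := by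
  refine tendsto_nhdsWithin_iff.2 ⟨?_, ?_⟩
  · exact ((by fun_prop : Continuous fun s : ℝ => 1 - s).tendsto' 1 0 (sub_self 1)).mono_left
      nhdsWithin_le_nhds
  · filter_upwards [self_mem_nhdsWithin] with s (hs : s < 1) using sub_pos.2 hs

lemma tendsto_weight_zero_one (J : ℕ) : Tendsto (weight 0 1 J) (𝓝[<] 1) (𝓝 0) := by
  simpa only [Function.comp_def, weight_one_sub] using
    (tendsto_weight_one_zero J).comp tendsto_one_sub_nhdsLT_one

/-- A decreasing function on `(0,1)`, tending to `0` at `1`, whose derivative dominates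
`lam ^ J / t` in absolute value. -/
def lamMajorant (J : ℕ) (t : ℝ) : ℝ := (1 - t) * (4 * (J + 1) + lam t) ^ (J + 1)

lemma lamMajorant_le (J : ℕ) {s : ℝ} (hs : s ∈ Ioo (0 : ℝ) 1) :
    lamMajorant J s ≤ (4 * (J + 1) + 1) ^ (J + 1) * weight 0 1 (J + 1) s := by
  have h1 := one_le_lam hs
  have h2 : 0 ≤ 1 - s := sub_nonneg.2 hs.2.le
  rw [weight_zero_one, lamMajorant, mul_left_comm, ← mul_pow]
  gcongr
  nlinarith [(J.cast_nonneg : (0 : ℝ) ≤ J)]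

lemma hasDerivAt_neg_lamMajorant (J : ℕ) {t : ℝ} (ht : t ∈ Ioo (0 : ℝ) 1) :
    HasDerivAt (fun t => -lamMajorant J t)
      ((4 * (J + 1) + lam t) ^ J * ((4 * (J + 1) + lam t) + (J + 1) / t - 2 * (J + 1))) t := by
  have h := (((hasDerivAt_id t).const_sub 1).mul
    (((hasDerivAt_lam ht).const_add (4 * (J + 1 : ℝ))).pow (J + 1))).neg
  refine h.congr_deriv ?_
  have ht0 := ht.1.ne'
  have ht1 := (sub_pos.2 ht.2).ne'
  simp only [Nat.cast_add, Nat.cast_one, Nat.add_sub_cancel, id, Pi.pow_apply]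
  generalize lam t = x
  field_simp
  ring

lemma weight_neg_one_zero_le (J : ℕ) {t : ℝ} (ht : t ∈ Ioo (0 : ℝ) 1) :
    weight (-1) 0 J t ≤
      (4 * (J + 1) + lam t) ^ J * ((4 * (J + 1) + lam t) + (J + 1) / t - 2 * (J + 1)) := by
  have hl := lam_pos ht
  have ht0 := ht.1
  have hinv : t⁻¹ ≤ (J + 1) / t := by
    rw [inv_eq_one_div]; gcongr; linarith
  rw [weight_neg_one_zero, div_eq_mul_inv]
  gcongr
  · linarith
  · linarith

lemma tendsto_lamMajorant (J : ℕ) : Tendsto (lamMajorant J) (𝓝[<] 1) (𝓝 0) := by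
  have hlim := (tendsto_weight_zero_one (J + 1)).const_mul ((4 * (J + 1 : ℝ) + 1) ^ (J + 1))
  rw [mul_zero] at hlim
  refine squeeze_zero' ?_ ?_ hlim <;>
    filter_upwards [Ioo_mem_nhdsLT (zero_lt_one' ℝ)] with s hs
  · exact mul_nonneg (sub_pos.2 hs.2).le (pow_nonneg (by linarith [lam_pos hs]) _)
  · exact lamMajorant_le J hs

lemma continuousOn_lamMajorant (J : ℕ) : ContinuousOn (lamMajorant J) (Ioc 0 1) := by
  intro t ht
  rcases ht.2.lt_or_eq with ht1 | rfl
  · simpa using (hasDerivAt_neg_lamMajorant J ⟨ht.1, ht1⟩).continuousAt.fun_neg.continuousWithinAt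
  · have h1 : lamMajorant J 1 = 0 := by simp [lamMajorant]
    rw [← Ioo_insert_right zero_lt_one, continuousWithinAt_insert_self, ContinuousWithinAt, h1]
    exact (tendsto_lamMajorant J).mono_left (nhdsWithin_mono _ Ioo_subset_Iio_self)

lemma intervalIntegrable_weight_neg_one_zero (J : ℕ) {s : ℝ} (hs : s ∈ Ioo (0 : ℝ) 1) :
    IntervalIntegrable (weight (-1) 0 J) volume s 1 := by
  have hsub : Ioo s 1 ⊆ Ioo 0 1 := Ioo_subset_Ioo_left hs.1.le
  have hInt := integrableOn_deriv_of_nonneg (a := s) (b := 1)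
    ((continuousOn_lamMajorant J).neg.mono fun t ht => ⟨hs.1.trans_le ht.1, ht.2⟩)
    (fun t ht => hasDerivAt_neg_lamMajorant J (hsub ht))
    fun t ht => (weight_pos (hsub ht) _ _ J).le.trans (weight_neg_one_zero_le J (hsub ht))
  rw [integrableOn_Ioc_iff_integrableOn_Ioo] at hInt
  rw [intervalIntegrable_iff_integrableOn_Ioo_of_le hs.2.le]
  refine Integrable.mono' hInt
    (((continuousOn_weight _ _ J).mono hsub).aestronglyMeasurable measurableSet_Ioo) ?_
  filter_upwards [ae_restrict_mem measurableSet_Ioo] with t ht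
  rw [Real.norm_of_nonneg (weight_pos (hsub ht) _ _ J).le]
  exact weight_neg_one_zero_le J (hsub ht)

lemma integral_weight_neg_one_zero_le (J : ℕ) {s : ℝ} (hs : s ∈ Ioo (0 : ℝ) 1) :
    ∫ t in s..1, weight (-1) 0 J t ≤ (4 * (J + 1) + 1) ^ (J + 1) * weight 0 1 (J + 1) s := by
  have hsub : Ioo s 1 ⊆ Ioo 0 1 := Ioo_subset_Ioo_left hs.1.le
  refine le_trans ?_ (lamMajorant_le J hs)
  have h := integral_le_sub_of_hasDeriv_right_of_le hs.2.le
    ((continuousOn_lamMajorant J).neg.mono fun t ht => ⟨hs.1.trans_le ht.1, ht.2⟩)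
    (fun t ht => (hasDerivAt_neg_lamMajorant J (hsub ht)).hasDerivWithinAt)
    ((intervalIntegrable_iff_integrableOn_Icc_of_le hs.2.le).1
      (intervalIntegrable_weight_neg_one_zero J hs))
    fun t ht => weight_neg_one_zero_le J (hsub ht)
  simpa [lamMajorant] using h

/-! ### Functions with controlled growth on the unit interval -/

section HasGrowth

variable {X Y : Type*} {l : Filter X} {m : Filter Y} {τ : X → ℝ} {f g : X → ℂ} {i j i' j' : ℤ}

lemma isBigO_weight (hτ : ∀ᶠ x in l, τ x ∈ Ioo (0 : ℝ) 1) {J J' : ℕ} (hi : i' ≤ i) (hj : j' ≤ j)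
    (hJ : J ≤ J') : (fun x => weight i j J (τ x)) =O[l] fun x => weight i' j' J' (τ x) := by
  refine .of_bound' (hτ.mono fun x hx => ?_)
  rw [Real.norm_of_nonneg (weight_pos hx _ _ _).le, Real.norm_of_nonneg (weight_pos hx _ _ _).le]
  exact weight_le_weight hx hi hj hJ

/-- `f = O(τⁱ (1 - τ)ʲ)` along `l`, up to powers of the logarithm of `τ (1 - τ)`. -/
def HasGrowth (l : Filter X) (τ : X → ℝ) (i j : ℤ) (f : X → ℂ) : Prop :=
  ∃ J, f =O[l] fun x => weight i j J (τ x)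

namespace HasGrowth

lemma of_isBigO (h : f =O[l] fun x => weight i j 0 (τ x)) : HasGrowth l τ i j f := ⟨0, h⟩

lemma comp {φ : Y → X} (h : HasGrowth l τ i j f) (hφ : Tendsto φ m l) :
    HasGrowth m (τ ∘ φ) i j (f ∘ φ) := h.imp fun _ hJ => hJ.comp_tendsto hφ

lemma congr (h : HasGrowth l τ i j f) (hfg : f =ᶠ[l] g) : HasGrowth l τ i j g :=
  h.imp fun _ hJ => hJ.congr' hfg EventuallyEq.rfl

lemma trans (h : HasGrowth l τ i j f) (hgf : g =O[l] f) : HasGrowth l τ i j g :=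
  h.imp fun _ hJ => hgf.trans hJ

lemma const_smul (h : HasGrowth l τ i j f) (c : ℂ) : HasGrowth l τ i j (c • f) :=
  h.imp fun _ hJ => hJ.const_smul_left c

lemma mono (hτ : ∀ᶠ x in l, τ x ∈ Ioo (0 : ℝ) 1) (hi : i' ≤ i) (hj : j' ≤ j)
    (h : HasGrowth l τ i j f) : HasGrowth l τ i' j' f :=
  h.imp fun _ hJ => hJ.trans (isBigO_weight hτ hi hj le_rfl)

lemma of_norm_le_add (hτ : ∀ᶠ x in l, τ x ∈ Ioo (0 : ℝ) 1) (hf : HasGrowth l τ i j f)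
    (hg : HasGrowth l τ i j g) {k : X → ℂ} {C : ℝ} (hk : ∀ᶠ x in l, ‖k x‖ ≤ C * (‖f x‖ + ‖g x‖)) :
    HasGrowth l τ i j k := by
  obtain ⟨J, hJ⟩ := hf
  obtain ⟨J', hJ'⟩ := hg
  have hsum := (hJ.trans (isBigO_weight hτ le_rfl le_rfl (le_max_left J J'))).norm_left.add
    (hJ'.trans (isBigO_weight hτ le_rfl le_rfl (le_max_right J J'))).norm_left
  refine ⟨max J J', (IsBigO.of_bound C ?_).trans hsum⟩
  simpa only [Real.norm_of_nonneg (add_nonneg (norm_nonneg _) (norm_nonneg _))] using hk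

lemma add (hτ : ∀ᶠ x in l, τ x ∈ Ioo (0 : ℝ) 1) (hf : HasGrowth l τ i j f)
    (hg : HasGrowth l τ i j g) : HasGrowth l τ i j (f + g) :=
  of_norm_le_add hτ hf hg (C := 1) (.of_forall fun x => by simpa using norm_add_le (f x) (g x))

lemma mul (hτ : ∀ᶠ x in l, τ x ∈ Ioo (0 : ℝ) 1) (hf : HasGrowth l τ i j f)
    (hg : HasGrowth l τ i' j' g) : HasGrowth l τ (i + i') (j + j') (f * g) := by
  obtain ⟨J, hJ⟩ := hf
  obtain ⟨J', hJ'⟩ := hg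
  exact ⟨J + J', (hJ.mul hJ').congr' EventuallyEq.rfl
    (hτ.mono fun _ hx => weight_mul_weight hx _ _ _ _ _ _)⟩

lemma pow (hτ : ∀ᶠ x in l, τ x ∈ Ioo (0 : ℝ) 1) (hf : HasGrowth l τ 0 0 f) (n : ℕ) :
    HasGrowth l τ 0 0 (f ^ n) := by
  induction n with
  | zero => exact of_isBigO (isBigO_of_le _ fun _ => by simp [weight])
  | succ n ih => simpa [pow_succ] using mul hτ ih hf

lemma exists_eventually_le (hτ : ∀ᶠ x in l, τ x ∈ Ioo (0 : ℝ) 1) (hf : HasGrowth l τ i j f) :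
    ∃ (C : ℝ) (J : ℕ), 0 < C ∧ ∀ᶠ x in l, ‖f x‖ ≤ C * weight i j J (τ x) := by
  obtain ⟨J, hJ⟩ := hf
  obtain ⟨C, hC0, hC⟩ := hJ.exists_pos
  refine ⟨C, J, hC0, ?_⟩
  filter_upwards [hτ, hC.bound] with x hx h
  rwa [Real.norm_of_nonneg (weight_pos hx _ _ _).le] at h

lemma of_eventually_le {C : ℝ} {J : ℕ} (h : ∀ᶠ x in l, ‖f x‖ ≤ C * weight i j J (τ x)) :
    HasGrowth l τ i j f :=
  ⟨J, .of_bound |C| <| h.mono fun _ hx => (hx.trans (le_abs_self _)).trans (abs_mul _ _).le⟩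

end HasGrowth

end HasGrowth

section Growth

/-- The continuous functions on `(0,1)` that are `O(tⁱ (1 - t)ʲ)` up to powers of the logarithm at
both ends. Only the values on `(0,1)` matter. -/
def growth (i j : ℤ) : Submodule ℂ (ℝ → ℂ) where
  carrier := {f | ContinuousOn f (Ioo 0 1) ∧ HasGrowth (𝓟 (Ioo 0 1)) id i j f}
  add_mem' := fun hf hg => ⟨hf.1.add hg.1, hf.2.add (mem_principal_self _) hg.2⟩
  zero_mem' := ⟨continuousOn_const, .of_isBigO (isBigO_zero _ _)⟩
  smul_mem' := fun c _ hf => ⟨hf.1.const_smul c, hf.2.const_smul c⟩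

variable {f g : ℝ → ℂ} {i j i' j' : ℤ}

lemma continuousOn_of_mem_growth (hf : f ∈ growth i j) : ContinuousOn f (Ioo 0 1) := hf.1

lemma hasGrowth_of_mem_growth (hf : f ∈ growth i j) : HasGrowth (𝓟 (Ioo 0 1)) id i j f := hf.2

lemma exists_norm_le_weight (hf : f ∈ growth i j) :
    ∃ (C : ℝ) (J : ℕ), 0 ≤ C ∧ ∀ t ∈ Ioo (0 : ℝ) 1, ‖f t‖ ≤ C * weight i j J t := by
  obtain ⟨C, J, hC, h⟩ := hf.2.exists_eventually_le (mem_principal_self _)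
  exact ⟨C, J, hC.le, h⟩

lemma mem_growth_of_norm_le {C : ℝ} {J : ℕ} (hf : ContinuousOn f (Ioo 0 1))
    (h : ∀ t ∈ Ioo (0 : ℝ) 1, ‖f t‖ ≤ C * weight i j J t) : f ∈ growth i j :=
  ⟨hf, .of_eventually_le (eventually_principal.2 h)⟩

lemma mem_growth_zero_of_norm_le {C : ℝ} (hf : ContinuousOn f (Ioo 0 1))
    (h : ∀ t ∈ Ioo (0 : ℝ) 1, ‖f t‖ ≤ C) : f ∈ growth 0 0 :=
  mem_growth_of_norm_le (C := C) (J := 0) hf fun t ht => by simpa [weight] using h t ht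

lemma growth_anti (hi : i' ≤ i) (hj : j' ≤ j) : growth i j ≤ growth i' j' := fun _ hf =>
  ⟨hf.1, hf.2.mono (mem_principal_self _) hi hj⟩

lemma mem_growth_congr (h : EqOn f g (Ioo 0 1)) (hf : f ∈ growth i j) : g ∈ growth i j :=
  ⟨hf.1.congr h.symm, hf.2.congr (eventuallyEq_principal.2 h)⟩

lemma mul_mem_growth (hf : f ∈ growth i j) (hg : g ∈ growth i' j') :
    f * g ∈ growth (i + i') (j + j') :=
  ⟨hf.1.mul hg.1, hf.2.mul (mem_principal_self _) hg.2⟩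

lemma pow_mem_growth_zero (hf : f ∈ growth 0 0) (n : ℕ) : f ^ n ∈ growth 0 0 :=
  ⟨hf.1.pow n, hf.2.pow (mem_principal_self _) n⟩

lemma comp_one_sub_mem_growth (hf : f ∈ growth i j) : (fun t => f (1 - t)) ∈ growth j i := by
  obtain ⟨C, J, -, h⟩ := exists_norm_le_weight hf
  refine mem_growth_of_norm_le (C := C) (J := J)
    (hf.1.comp (by fun_prop) fun t ht => one_sub_mem_Ioo ht) fun t ht => ?_
  simpa only [weight_one_sub] using h _ (one_sub_mem_Ioo ht)

lemma intervalIntegrable_one_of_mem_growth (hf : f ∈ growth (-1) 0) {s : ℝ}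
    (hs : s ∈ Ioo (0 : ℝ) 1) : IntervalIntegrable f volume s 1 := by
  obtain ⟨C, J, -, h⟩ := exists_norm_le_weight hf
  have hsub : Ioo s 1 ⊆ Ioo 0 1 := Ioo_subset_Ioo_left hs.1.le
  have hInt := (intervalIntegrable_weight_neg_one_zero J hs).const_mul C
  rw [intervalIntegrable_iff_integrableOn_Ioo_of_le hs.2.le] at hInt ⊢
  refine Integrable.mono' hInt ((hf.1.mono hsub).aestronglyMeasurable measurableSet_Ioo) ?_
  filter_upwards [ae_restrict_mem measurableSet_Ioo] with t ht using h t (hsub ht)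

lemma intervalIntegrable_of_continuousOn_Ioo (hf : ContinuousOn f (Ioo 0 1)) {a b : ℝ}
    (ha : a ∈ Ioo (0 : ℝ) 1) (hb : b ∈ Ioo (0 : ℝ) 1) : IntervalIntegrable f volume a b :=
  (hf.mono (ordConnected_Ioo.uIcc_subset ha hb)).intervalIntegrable

lemma hasDerivAt_integral_one (hf : f ∈ growth (-1) 0) {s : ℝ} (hs : s ∈ Ioo (0 : ℝ) 1) :
    HasDerivAt (fun s => ∫ t in s..1, f t) (-f s) s :=
  integral_hasDerivAt_left (intervalIntegrable_one_of_mem_growth hf hs)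
    (hf.1.stronglyMeasurableAtFilter isOpen_Ioo s hs) (hf.1.continuousAt (Ioo_mem_nhds hs.1 hs.2))

lemma integral_one_mem_growth (hf : f ∈ growth (-1) 0) :
    (fun s => ∫ t in s..1, f t) ∈ growth 0 1 := by
  obtain ⟨C, J, hC, h⟩ := exists_norm_le_weight hf
  refine mem_growth_of_norm_le (C := C * (4 * (J + 1) + 1) ^ (J + 1)) (J := J + 1)
    (fun s hs => (hasDerivAt_integral_one hf hs).continuousAt.continuousWithinAt) fun s hs => ?_
  have hle : ‖∫ t in s..1, f t‖ ≤ ∫ t in s..1, C * weight (-1) 0 J t := by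
    refine norm_integral_le_of_norm_le hs.2.le ?_
      ((intervalIntegrable_weight_neg_one_zero J hs).const_mul _)
    filter_upwards [compl_mem_ae_iff.2 (measure_singleton (1 : ℝ))] with t ht1 ht
    exact h t ⟨hs.1.trans ht.1, lt_of_le_of_ne ht.2 ht1⟩
  rw [intervalIntegral.integral_const_mul] at hle
  rw [mul_assoc]
  exact hle.trans (mul_le_mul_of_nonneg_left (integral_weight_neg_one_zero_le J hs) hC)

lemma integral_zero_mem_growth (hf : f ∈ growth 0 (-1)) :
    (fun s => ∫ t in (0 : ℝ)..s, f t) ∈ growth 1 0 := by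
  have h := comp_one_sub_mem_growth (integral_one_mem_growth (comp_one_sub_mem_growth hf))
  simpa [integral_comp_sub_left (fun t => f t) 1] using h

lemma intervalIntegrable_zero_one_of_mem_growth (hf : f ∈ growth 0 0) :
    IntervalIntegrable f volume 0 1 := by
  have hhalf : (1 / 2 : ℝ) ∈ Ioo (0 : ℝ) 1 := by norm_num
  have h1 := intervalIntegrable_one_of_mem_growth (growth_anti (by simp) le_rfl hf) hhalf
  have h0 := (intervalIntegrable_one_of_mem_growth
    (growth_anti (by simp) le_rfl (comp_one_sub_mem_growth hf)) hhalf).comp_sub_left 1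
  norm_num at h0 h1
  exact h0.symm.trans h1

lemma integral_one_eq_of_hasDerivAt (hf : f ∈ growth (-1) 0) {F : ℝ → ℂ}
    (hF : ∀ t ∈ Ioo (0 : ℝ) 1, HasDerivAt F (-f t) t) (h1 : Tendsto F (𝓝[<] 1) (𝓝 0))
    {s : ℝ} (hs : s ∈ Ioo (0 : ℝ) 1) : ∫ t in s..1, f t = F s := by
  have h := integral_eq_sub_of_hasDerivAt_of_tendsto (f := fun t => -F t) (f' := f) hs.2
    (fun t ht => by simpa using (hF t ⟨hs.1.trans ht.1, ht.2⟩).fun_neg)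
    (intervalIntegrable_one_of_mem_growth hf hs)
    ((hF s hs).continuousAt.neg.tendsto.mono_left nhdsWithin_le_nhds) h1.neg
  rw [h]; simp

lemma integral_zero_one_congr (h : EqOn f g (Ioo 0 1)) :
    ∫ t in (0 : ℝ)..1, f t = ∫ t in (0 : ℝ)..1, g t := by
  rw [integral_of_le zero_le_one, integral_of_le zero_le_one,
    integral_Ioc_eq_integral_Ioo, integral_Ioc_eq_integral_Ioo]
  exact setIntegral_congr_fun measurableSet_Ioo h

lemma integral_one_congr (h : EqOn f g (Ioo 0 1)) {s : ℝ} (hs : s ∈ Ioo (0 : ℝ) 1) :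
    ∫ t in s..1, f t = ∫ t in s..1, g t := by
  rw [integral_of_le hs.2.le, integral_of_le hs.2.le,
    integral_Ioc_eq_integral_Ioo, integral_Ioc_eq_integral_Ioo]
  exact setIntegral_congr_fun measurableSet_Ioo fun t ht => h ⟨hs.1.trans ht.1, ht.2⟩

end Growth

/-! ### Integration operators -/

section Operators

variable {φ ψ f g : ℝ → ℂ}

/-- The functions in `growth 0 1`, normalised to vanish outside `(0,1)`, so that they are determined
by their values on `(0,1)`. -/
def Decay : Submodule ℂ (ℝ → ℂ) where
  carrier := {k | k ∈ growth 0 1 ∧ ∀ s ∉ Ioo (0 : ℝ) 1, k s = 0}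
  add_mem' := fun hk hl => ⟨add_mem hk.1 hl.1, fun s hs => by simp [hk.2 s hs, hl.2 s hs]⟩
  zero_mem' := ⟨zero_mem _, fun _ _ => rfl⟩
  smul_mem' := fun c _ hk => ⟨Submodule.smul_mem _ c hk.1, fun s hs => by simp [hk.2 s hs]⟩

lemma decay_mem_growth (k : Decay) : k.1 ∈ growth 0 1 := k.2.1

lemma decay_ext {k l : Decay} (h : EqOn k.1 l.1 (Ioo 0 1)) : k = l := by
  ext s
  by_cases hs : s ∈ Ioo (0 : ℝ) 1
  · exact h hs
  · rw [k.2.2 s hs, l.2.2 s hs]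

open Classical in
/-- The primitive `s ↦ ∫_s^1 f` that vanishes at `1`, for `f` in `growth (-1) 0` (and `0` for other
functions `f`). -/
def tail (f : ℝ → ℂ) : Decay :=
  if h : f ∈ growth (-1) 0 then
    ⟨(Ioo (0 : ℝ) 1).indicator fun s => ∫ t in s..1, f t,
      mem_growth_congr (fun _ hs => (indicator_of_mem hs _).symm) (integral_one_mem_growth h),
      fun _ hs => indicator_of_notMem hs _⟩
  else 0

lemma tail_apply (hf : f ∈ growth (-1) 0) {s : ℝ} (hs : s ∈ Ioo (0 : ℝ) 1) :
    (tail f).1 s = ∫ t in s..1, f t := by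
  rw [tail, dif_pos hf]; exact indicator_of_mem hs fun s => ∫ t in s..1, f t

lemma hasDerivAt_tail (hf : f ∈ growth (-1) 0) {s : ℝ} (hs : s ∈ Ioo (0 : ℝ) 1) :
    HasDerivAt (tail f).1 (-f s) s :=
  (hasDerivAt_integral_one hf hs).congr_of_eventuallyEq <|
    mem_of_superset (Ioo_mem_nhds hs.1 hs.2) fun _ ht => tail_apply hf ht

lemma tail_eq_of_hasDerivAt (hf : f ∈ growth (-1) 0) {F : ℝ → ℂ}
    (hF : ∀ t ∈ Ioo (0 : ℝ) 1, HasDerivAt F (-f t) t) (h1 : Tendsto F (𝓝[<] 1) (𝓝 0)) :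
    EqOn (tail f).1 F (Ioo 0 1) := fun s hs => by
  rw [tail_apply hf hs, integral_one_eq_of_hasDerivAt hf hF h1 hs]

lemma tail_congr (h : EqOn f g (Ioo 0 1)) : tail f = tail g := by
  by_cases hf : f ∈ growth (-1) 0
  · refine decay_ext fun s hs => ?_
    rw [tail_apply hf hs, tail_apply (mem_growth_congr h hf) hs, integral_one_congr h hs]
  · rw [tail, tail, dif_neg hf, dif_neg fun hg => hf (mem_growth_congr h.symm hg)]

lemma tail_add (hf : f ∈ growth (-1) 0) (hg : g ∈ growth (-1) 0) :
    tail (f + g) = tail f + tail g := by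
  refine decay_ext fun s hs => ?_
  rw [Submodule.coe_add, Pi.add_apply, tail_apply hf hs, tail_apply hg hs,
    tail_apply (add_mem hf hg) hs]
  exact integral_add (intervalIntegrable_one_of_mem_growth hf hs)
    (intervalIntegrable_one_of_mem_growth hg hs)

lemma tail_smul (c : ℂ) (hf : f ∈ growth (-1) 0) : tail (c • f) = c • tail f := by
  refine decay_ext fun s hs => ?_
  rw [Submodule.coe_smul, Pi.smul_apply, tail_apply hf hs,
    tail_apply (Submodule.smul_mem _ c hf) hs]
  simp

lemma mul_decay_mem_growth (hφ : φ ∈ growth (-1) (-1)) (k : Decay) : φ * k.1 ∈ growth (-1) 0 := by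
  simpa using mul_mem_growth hφ (decay_mem_growth k)

open Classical in
/-- The operator `k ↦ (s ↦ ∫_s^1 φ k)`, for `φ` in `growth (-1) (-1)` (and `0` for other functions
`φ`). -/
def op (φ : ℝ → ℂ) : Module.End ℂ Decay :=
  if h : φ ∈ growth (-1) (-1) then
    { toFun := fun k => tail (φ * k.1)
      map_add' := fun k l => by
        rw [Submodule.coe_add, mul_add,
          tail_add (mul_decay_mem_growth h k) (mul_decay_mem_growth h l)]
      map_smul' := fun c k => by
        rw [Submodule.coe_smul, mul_smul_comm, tail_smul c (mul_decay_mem_growth h k),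
          RingHom.id_apply] }
  else 0

lemma op_apply (hφ : φ ∈ growth (-1) (-1)) (k : Decay) : op φ k = tail (φ * k.1) := by
  rw [op, dif_pos hφ]; rfl

lemma op_congr (h : EqOn φ ψ (Ioo 0 1)) : op φ = op ψ := by
  by_cases hφ : φ ∈ growth (-1) (-1)
  · ext1 k
    rw [op_apply hφ, op_apply (mem_growth_congr h hφ)]
    exact tail_congr fun s hs => by simp only [Pi.mul_apply, h hs]
  · rw [op, op, dif_neg hφ, dif_neg fun hψ => hφ (mem_growth_congr h.symm hψ)]

lemma op_add (hφ : φ ∈ growth (-1) (-1)) (hψ : ψ ∈ growth (-1) (-1)) :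
    op (φ + ψ) = op φ + op ψ := by
  ext1 k
  rw [LinearMap.add_apply, op_apply hφ, op_apply hψ, op_apply (add_mem hφ hψ), add_mul,
    tail_add (mul_decay_mem_growth hφ k) (mul_decay_mem_growth hψ k)]

lemma op_smul (c : ℂ) (hφ : φ ∈ growth (-1) (-1)) : op (c • φ) = c • op φ := by
  ext1 k
  rw [LinearMap.smul_apply, op_apply hφ, op_apply (Submodule.smul_mem _ c hφ), smul_mul_assoc,
    tail_smul c (mul_decay_mem_growth hφ k)]

lemma op_neg (hφ : φ ∈ growth (-1) (-1)) : op (-φ) = -op φ := by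
  rw [← neg_one_smul ℂ φ, op_smul _ hφ]
  exact neg_one_smul ℂ (op φ)

lemma op_sub (hφ : φ ∈ growth (-1) (-1)) (hψ : ψ ∈ growth (-1) (-1)) :
    op (φ - ψ) = op φ - op ψ := by
  have h := op_add (sub_mem hφ hψ) hψ
  rw [sub_add_cancel] at h
  exact h ▸ (add_sub_cancel_right (op (φ - ψ)) (op ψ)).symm

lemma mul_decay_mem_growth_zero (hφ : φ ∈ growth 0 0) (k : Decay) : φ * k.1 ∈ growth 0 0 :=
  growth_anti (by simp) (by simp) (mul_mem_growth hφ (decay_mem_growth k))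

open Classical in
/-- The functional `k ↦ ∫_0^1 φ k`, for `φ` in `growth 0 0` (and `0` for other functions `φ`). -/
def total (φ : ℝ → ℂ) : Decay →ₗ[ℂ] ℂ :=
  if h : φ ∈ growth 0 0 then
    { toFun := fun k => ∫ t in (0 : ℝ)..1, (φ * k.1) t
      map_add' := fun k l => by
        rw [Submodule.coe_add, mul_add]
        exact integral_add
          (intervalIntegrable_zero_one_of_mem_growth (mul_decay_mem_growth_zero h k))
          (intervalIntegrable_zero_one_of_mem_growth (mul_decay_mem_growth_zero h l))
      map_smul' := fun c k => by
        simp only [Submodule.coe_smul, mul_smul_comm, Pi.smul_apply, intervalIntegral.integral_smul,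
          RingHom.id_apply] }
  else 0

lemma total_apply (hφ : φ ∈ growth 0 0) (k : Decay) :
    total φ k = ∫ t in (0 : ℝ)..1, (φ * k.1) t := by
  rw [total, dif_pos hφ]; rfl

lemma total_congr (h : EqOn φ ψ (Ioo 0 1)) : total φ = total ψ := by
  by_cases hφ : φ ∈ growth 0 0
  · ext1 k
    rw [total_apply hφ, total_apply (mem_growth_congr h hφ)]
    exact integral_zero_one_congr fun s hs => by simp only [Pi.mul_apply, h hs]
  · rw [total, total, dif_neg hφ, dif_neg fun hψ => hφ (mem_growth_congr h.symm hψ)]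

end Operators

/-! ### Regularized values -/

lemma one_le_abs_log : ∀ᶠ z : ℝ in 𝓝[>] 0, 1 ≤ |Real.log z| :=
  (tendsto_abs_atBot_atTop.comp Real.tendsto_log_nhdsGT_zero).eventually_ge_atTop 1

lemma isBigO_mul_log_mono {i j : ℕ} (h : i ≤ j) :
    (fun z : ℝ => z * |Real.log z| ^ i) =O[𝓝[>] (0 : ℝ)] fun z => z * |Real.log z| ^ j := by
  refine IsBigO.of_bound 1 ?_
  filter_upwards [one_le_abs_log, self_mem_nhdsWithin] with z hz (hz0 : 0 < z)
  rw [one_mul, Real.norm_of_nonneg (by positivity), Real.norm_of_nonneg (by positivity)]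
  exact mul_le_mul_of_nonneg_left (pow_le_pow_right₀ hz h) hz0.le

lemma isBigO_eval_log (P : Polynomial ℂ) :
    (fun z : ℝ => P.eval (Real.log z : ℂ)) =O[𝓝[>] (0 : ℝ)]
      fun z => |Real.log z| ^ P.natDegree := by
  simp only [Polynomial.eval_eq_sum_range]
  refine IsBigO.fun_sum fun i hi => ?_
  refine IsBigO.of_bound ‖P.coeff i‖ ?_
  filter_upwards [one_le_abs_log] with z hz
  rw [norm_mul, norm_pow, Complex.norm_real, Real.norm_eq_abs, norm_pow, Real.norm_eq_abs,
    abs_abs]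
  exact mul_le_mul_of_nonneg_left
    (pow_le_pow_right₀ hz (Nat.lt_succ_iff.1 (Finset.mem_range.1 hi))) (norm_nonneg _)

lemma IsRegValue.unique {F : ℝ → ℂ} {v v' : ℂ} (h : IsRegValue F v) (h' : IsRegValue F v') :
    v = v' := by
  obtain ⟨P, J, hP, rfl⟩ := h
  obtain ⟨P', J', hP', rfl⟩ := h'
  have h1 : Tendsto (fun z : ℝ => (P - P').eval (Real.log z : ℂ)) (𝓝[>] 0) (𝓝 0) := by
    have h2 := (hP'.trans_tendsto (tendsto_mul_abs_log_pow J')).sub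
      (hP.trans_tendsto (tendsto_mul_abs_log_pow J))
    simpa using h2
  have h3 : Tendsto (fun z : ℝ => ‖(Real.log z : ℂ)‖) (𝓝[>] 0) atTop := by
    simp only [Complex.norm_real]
    exact tendsto_abs_atBot_atTop.comp Real.tendsto_log_nhdsGT_zero
  have h4 : (P - P').degree ≤ 0 := by
    by_contra! h
    have h5 := Polynomial.tendsto_norm_atTop (P - P') h h3
    exact not_tendsto_nhds_of_tendsto_atTop h5 _ h1.norm
  rw [Polynomial.eq_C_of_degree_le_zero h4] at h1
  simp only [Polynomial.eval_C] at h1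
  have h6 := tendsto_nhds_unique h1 tendsto_const_nhds
  rw [Polynomial.coeff_zero_eq_eval_zero, Polynomial.eval_sub, eq_comm, sub_eq_zero] at h6
  exact h6

lemma IsRegValue.regExists {w : List (ℝ → ℂ)} {v : ℂ}
    (h : IsRegValue (fun z => iterInt w z (1 - z)) v) : RegExists w := ⟨v, h⟩

lemma IsRegValue.regInt_eq {w : List (ℝ → ℂ)} {v : ℂ}
    (h : IsRegValue (fun z => iterInt w z (1 - z)) v) : regInt w = v := by
  have h1 := h.regExists
  rw [regInt, dif_pos h1]
  exact h1.choose_spec.unique h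

lemma IsRegValue.congr {F G : ℝ → ℂ} {v : ℂ} (h : IsRegValue F v)
    (hFG : ∀ᶠ z in 𝓝[>] (0 : ℝ), F z = G z) : IsRegValue G v := by
  obtain ⟨P, J, hP, hv⟩ := h
  refine ⟨P, J, hP.congr' ?_ EventuallyEq.rfl, hv⟩
  filter_upwards [hFG] with z hz
  rw [hz]

lemma isRegValue_const (v : ℂ) : IsRegValue (fun _ => v) v :=
  ⟨Polynomial.C v, 0, by simpa using isBigO_zero _ _, by simp⟩

lemma IsRegValue.add {F G : ℝ → ℂ} {v v' : ℂ} (h : IsRegValue F v) (h' : IsRegValue G v') :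
    IsRegValue (fun z => F z + G z) (v + v') := by
  obtain ⟨P, J, hP, rfl⟩ := h
  obtain ⟨P', J', hP', rfl⟩ := h'
  refine ⟨P + P', max J J', ?_, by simp⟩
  refine ((hP.trans (isBigO_mul_log_mono (le_max_left J J'))).add
    (hP'.trans (isBigO_mul_log_mono (le_max_right J J')))).congr_left fun z => ?_
  rw [Polynomial.eval_add]; ring

lemma IsRegValue.sum {ι : Type*} (s : Finset ι) {F : ι → ℝ → ℂ} {v : ι → ℂ}
    (h : ∀ i ∈ s, IsRegValue (F i) (v i)) :
    IsRegValue (fun z => ∑ i ∈ s, F i z) (∑ i ∈ s, v i) := by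
  classical
  induction s using Finset.induction_on with
  | empty => simpa using isRegValue_const 0
  | insert a s ha ih =>
    simp only [Finset.sum_insert ha]
    exact (h a (Finset.mem_insert_self a s)).add
      (ih fun i hi => h i (Finset.mem_insert_of_mem hi))

lemma IsRegValue.mul {F G : ℝ → ℂ} {v v' : ℂ} (h : IsRegValue F v) (h' : IsRegValue G v') :
    IsRegValue (fun z => F z * G z) (v * v') := by
  obtain ⟨P, J, hP, rfl⟩ := h
  obtain ⟨P', J', hP', rfl⟩ := h'
  have e1 : (fun z => (F z - P.eval (Real.log z : ℂ)) * P'.eval (Real.log z : ℂ)) =O[𝓝[>] 0]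
      fun z => z * |Real.log z| ^ (J + P'.natDegree) :=
    (hP.mul (isBigO_eval_log P')).congr_right fun z => by rw [pow_add, mul_assoc]
  have e2 : (fun z => P.eval (Real.log z : ℂ) * (G z - P'.eval (Real.log z : ℂ))) =O[𝓝[>] 0]
      fun z => z * |Real.log z| ^ (J' + P.natDegree) :=
    ((isBigO_eval_log P).mul hP').congr_right fun z => by rw [pow_add]; ring
  have e3 : (fun z => (F z - P.eval (Real.log z : ℂ)) * (G z - P'.eval (Real.log z : ℂ)))
      =O[𝓝[>] 0] fun z => z * |Real.log z| ^ J := by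
    have : (fun z => G z - P'.eval (Real.log z : ℂ)) =O[𝓝[>] 0] fun _ => (1 : ℝ) :=
      (hP'.trans_tendsto (tendsto_mul_abs_log_pow J')).isBigO_one ℝ
    exact (hP.mul this).congr_right fun z => by rw [mul_one]
  let N := (J + P'.natDegree) + (J' + P.natDegree)
  refine ⟨P * P', N, ?_, by simp⟩
  refine (((e1.trans (isBigO_mul_log_mono (by omega : _ ≤ N))).add
    (e2.trans (isBigO_mul_log_mono (by omega : _ ≤ N)))).add
    (e3.trans (isBigO_mul_log_mono (by omega : _ ≤ N)))).congr_left fun z => ?_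
  rw [Polynomial.eval_mul]; ring

lemma IsRegValue.const_mul {F : ℝ → ℂ} {v : ℂ} (c : ℂ) (h : IsRegValue F v) :
    IsRegValue (fun z => c * F z) (c * v) := (isRegValue_const c).mul h

lemma IsRegValue.pow {F : ℝ → ℂ} {v : ℂ} (h : IsRegValue F v) (n : ℕ) :
    IsRegValue (fun z => F z ^ n) (v ^ n) := by
  induction n with
  | zero => simpa using isRegValue_const 1
  | succ n ih => simpa only [pow_succ] using ih.mul h

lemma IsRegValue.sub {F G : ℝ → ℂ} {v v' : ℂ} (h : IsRegValue F v) (h' : IsRegValue G v') :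
    IsRegValue (fun z => F z - G z) (v - v') := by
  simpa [sub_eq_add_neg] using h.add (h'.const_mul (-1))

lemma isRegValue_zero_of_isBigO {F : ℝ → ℂ} {J : ℕ} (h : F =O[𝓝[>] 0] weight 1 0 J) :
    IsRegValue F 0 :=
  ⟨0, J, by simpa using h.trans (isBigO_weight_one_zero J), by simp⟩

lemma isRegValue_zero_of_mem_growth {f : ℝ → ℂ} (hf : f ∈ growth 1 0) : IsRegValue f 0 := by
  obtain ⟨J, hJ⟩ := hasGrowth_of_mem_growth hf
  exact isRegValue_zero_of_isBigO (hJ.mono (le_principal_iff.2 (Ioo_mem_nhdsGT one_pos)))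

lemma eventually_mem_Icc_one_sub : ∀ᶠ z : ℝ in 𝓝[>] 0, 0 < z ∧ z ∈ Icc z (1 - z) := by
  filter_upwards [Ioo_mem_nhdsGT (by norm_num : (0 : ℝ) < 1 / 2)] with z hz
  exact ⟨hz.1, le_rfl, by linarith [hz.2]⟩

lemma mem_Ioo_of_mem_Icc_one_sub {z s : ℝ} (hz : 0 < z) (hs : s ∈ Icc z (1 - z)) :
    s ∈ Ioo (0 : ℝ) 1 := ⟨hz.trans_le hs.1, by linarith [hs.2]⟩

lemma isRegValue_integral {f : ℝ → ℂ} (hf : f ∈ growth 0 0) :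
    IsRegValue (fun z => ∫ t in z..(1 - z), f t) (∫ t in (0 : ℝ)..1, f t) := by
  have h0 := isRegValue_zero_of_mem_growth
    (integral_zero_mem_growth (growth_anti le_rfl (by simp) hf))
  have h1 := isRegValue_zero_of_mem_growth
    (comp_one_sub_mem_growth (integral_one_mem_growth (growth_anti (by simp) le_rfl hf)))
  have h := ((isRegValue_const (∫ t in (0 : ℝ)..1, f t)).sub h0).sub h1
  rw [sub_zero, sub_zero] at h
  refine h.congr ?_
  filter_upwards [eventually_mem_Icc_one_sub] with z ⟨hz, hzb⟩
  have hInt : ∀ a ∈ Icc (0 : ℝ) 1, ∀ b ∈ Icc (0 : ℝ) 1, IntervalIntegrable f volume a b :=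
    fun a ha b hb => (intervalIntegrable_zero_one_of_mem_growth hf).mono_set <|
      uIcc_subset_uIcc (by rwa [uIcc_of_le zero_le_one]) (by rwa [uIcc_of_le zero_le_one])
  have hz1 := Ioo_subset_Icc_self (mem_Ioo_of_mem_Icc_one_sub hz hzb)
  have hb1 := Ioo_subset_Icc_self (one_sub_mem_Ioo (mem_Ioo_of_mem_Icc_one_sub hz hzb))
  have h0 : (0 : ℝ) ∈ Icc (0 : ℝ) 1 := by simp
  have h1 : (1 : ℝ) ∈ Icc (0 : ℝ) 1 := by simp
  rw [integral_interval_sub_left (hInt 0 h0 1 h1) (hInt 0 h0 z hz1),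
    integral_interval_sub_interval_comm' (hInt z hz1 1 h1) (hInt _ hb1 1 h1) (hInt z hz1 _ hb1),
    integral_same, zero_sub, ← integral_symm]

/-! ### Convergence of iterated integrals -/

lemma hasDerivAt_integral_left_Ioo {g : ℝ → ℂ} (hg : ContinuousOn g (Ioo 0 1)) {s b : ℝ}
    (hs : s ∈ Ioo (0 : ℝ) 1) (hb : b ∈ Ioo (0 : ℝ) 1) :
    HasDerivAt (fun s => ∫ t in s..b, g t) (-g s) s :=
  integral_hasDerivAt_left (intervalIntegrable_of_continuousOn_Ioo hg hs hb)
    (hg.stronglyMeasurableAtFilter isOpen_Ioo s hs) (hg.continuousAt (Ioo_mem_nhds hs.1 hs.2))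

lemma continuousOn_iterInt {w : List (ℝ → ℂ)} (hw : ∀ φ ∈ w, ContinuousOn φ (Ioo 0 1)) {b : ℝ}
    (hb : b ∈ Ioo (0 : ℝ) 1) : ContinuousOn (fun s => iterInt w s b) (Ioo 0 1) := by
  induction w with
  | nil => exact continuousOn_const
  | cons φ w ih =>
    obtain ⟨hφ, hw⟩ := List.forall_mem_cons.1 hw
    exact fun s hs =>
      (hasDerivAt_integral_left_Ioo (hφ.mul (ih hw)) hs hb).continuousAt.continuousWithinAt

lemma hasDerivAt_log_sub_log_one_sub {t : ℝ} (ht : t ∈ Ioo (0 : ℝ) 1) :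
    HasDerivAt (fun t => Real.log t - Real.log (1 - t)) (weight (-1) (-1) 0 t) t := by
  have h := (Real.hasDerivAt_log ht.1.ne').sub
    (((hasDerivAt_id t).const_sub 1).log (sub_pos.2 ht.2).ne')
  refine h.congr_deriv ?_
  have := ht.1.ne'
  have := (sub_pos.2 ht.2).ne'
  simp only [id, weight, zpow_neg_one, pow_zero]
  field_simp
  ring

lemma integral_weight_neg_one_neg_one_le {z s : ℝ} (hz : 0 < z) (hs : s ∈ Icc z (1 - z)) :
    ∫ t in s..(1 - z), weight (-1) (-1) 0 t ≤ 2 * lam z := by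
  have hs1 := mem_Ioo_of_mem_Icc_one_sub hz hs
  have hz1 := mem_Ioo_of_mem_Icc_one_sub hz ⟨le_rfl, hs.1.trans hs.2⟩
  have hsub := ordConnected_Ioo.uIcc_subset hs1 (one_sub_mem_Ioo hz1)
  rw [integral_eq_sub_of_hasDerivAt (fun t ht => hasDerivAt_log_sub_log_one_sub (hsub ht))
    ((continuousOn_weight _ _ 0).mono hsub).intervalIntegrable]
  have h1 : Real.log z ≤ Real.log s := Real.log_le_log hz hs.1
  have h2 : Real.log (1 - s) ≤ 0 := Real.log_nonpos (by linarith [hs1.2]) (by linarith [hs1.1])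
  have h3 : Real.log (1 - z) ≤ 0 := Real.log_nonpos (by linarith [hz1.2]) (by linarith)
  simp only [lam, sub_sub_cancel]
  linarith

lemma weight_le_pow_lam_mul_weight {z t : ℝ} (hz : 0 < z) (ht : t ∈ Icc z (1 - z)) (i j : ℤ)
    (J : ℕ) : weight i j J t ≤ lam z ^ J * weight i j 0 t := by
  have ht1 := mem_Ioo_of_mem_Icc_one_sub hz ht
  rw [weight, weight, pow_zero, mul_one, mul_comm]
  have h0 : 0 ≤ t ^ i * (1 - t) ^ j :=
    mul_nonneg (zpow_pos ht1.1 i).le (zpow_pos (sub_pos.2 ht1.2) j).le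
  exact mul_le_mul_of_nonneg_right (pow_le_pow_left₀ (lam_pos ht1).le (lam_le_lam hz ht) J) h0

lemma exists_norm_integral_mul_le {φ : ℝ → ℂ} (hφ : φ ∈ growth (-1) (-1)) :
    ∃ (C : ℝ) (J : ℕ), 0 ≤ C ∧ ∀ z s B : ℝ, 0 < z → s ∈ Icc z (1 - z) → 0 ≤ B →
      ∀ h : ℝ → ℂ, (∀ t ∈ Icc s (1 - z), ‖h t‖ ≤ B) →
        ‖∫ t in s..(1 - z), φ t * h t‖ ≤ C * lam z ^ J * B := by
  obtain ⟨C, J, hC, hφC⟩ := exists_norm_le_weight hφ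
  refine ⟨2 * C, J + 1, by positivity, fun z s B hz hs hB h hhB => ?_⟩
  have hs1 := mem_Ioo_of_mem_Icc_one_sub hz hs
  have hz1 := mem_Ioo_of_mem_Icc_one_sub hz ⟨le_rfl, hs.1.trans hs.2⟩
  have hl := lam_pos hz1
  have hle : ‖∫ t in s..(1 - z), φ t * h t‖ ≤
      ∫ t in s..(1 - z), C * lam z ^ J * B * weight (-1) (-1) 0 t := by
    refine norm_integral_le_of_norm_le hs.2 (Eventually.of_forall fun t ht => ?_)
      (((continuousOn_weight _ _ 0).mono
        (ordConnected_Ioo.uIcc_subset hs1 (one_sub_mem_Ioo hz1))).intervalIntegrable.const_mul _)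
    have ht' : t ∈ Icc z (1 - z) := ⟨hs.1.trans ht.1.le, ht.2⟩
    have hφt := (hφC t (mem_Ioo_of_mem_Icc_one_sub hz ht')).trans
      (mul_le_mul_of_nonneg_left (weight_le_pow_lam_mul_weight hz ht' _ _ J) hC)
    calc ‖φ t * h t‖ ≤ C * (lam z ^ J * weight (-1) (-1) 0 t) * B := by
          rw [norm_mul]
          exact mul_le_mul hφt (hhB t ⟨ht.1.le, ht.2⟩) (norm_nonneg _)
            ((norm_nonneg _).trans hφt)
      _ = C * lam z ^ J * B * weight (-1) (-1) 0 t := by ring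
  rw [intervalIntegral.integral_const_mul] at hle
  calc ‖∫ t in s..(1 - z), φ t * h t‖ ≤ C * lam z ^ J * B * (2 * lam z) :=
        hle.trans (mul_le_mul_of_nonneg_left (integral_weight_neg_one_neg_one_le hz hs)
          (by positivity))
    _ = 2 * C * lam z ^ (J + 1) * B := by ring

lemma continuousOn_of_mem_append_singleton {p : List (ℝ → ℂ)} {f : ℝ → ℂ}
    (hp : ∀ φ ∈ p, φ ∈ growth (-1) (-1)) (hf : f ∈ growth (-1) 0) :
    ∀ φ ∈ p ++ [f], ContinuousOn φ (Ioo 0 1) := by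
  intro φ hφ
  rcases List.mem_append.1 hφ with h | h
  · exact continuousOn_of_mem_growth (hp φ h)
  · exact List.mem_singleton.1 h ▸ continuousOn_of_mem_growth hf

lemma integral_mul_sub_iterInt {φ : ℝ → ℂ} (hφ : ContinuousOn φ (Ioo 0 1)) {w : List (ℝ → ℂ)}
    (hw : ∀ ψ ∈ w, ContinuousOn ψ (Ioo 0 1)) (K : Decay) {s b : ℝ} (hs : s ∈ Ioo (0 : ℝ) 1)
    (hb : b ∈ Ioo (0 : ℝ) 1) :
    ∫ t in s..b, φ t * (K.1 t - iterInt w t b) =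
      (∫ t in s..b, (φ * K.1) t) - iterInt (φ :: w) s b := by
  simp only [mul_sub]
  exact integral_sub
    (intervalIntegrable_of_continuousOn_Ioo (hφ.mul (decay_mem_growth K).1) hs hb)
    (intervalIntegrable_of_continuousOn_Ioo (hφ.mul (continuousOn_iterInt hw hb)) hs hb)

lemma op_sub_iterInt_cons {φ : ℝ → ℂ} (hφ : φ ∈ growth (-1) (-1)) {w : List (ℝ → ℂ)}
    (hw : ∀ ψ ∈ w, ContinuousOn ψ (Ioo 0 1)) (K : Decay) {s b : ℝ} (hs : s ∈ Ioo (0 : ℝ) 1)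
    (hb : b ∈ Ioo (0 : ℝ) 1) :
    (op φ K).1 s - iterInt (φ :: w) s b =
      (∫ t in b..1, (φ * K.1) t) + ∫ t in s..b, φ t * (K.1 t - iterInt w t b) := by
  have hφK := mul_decay_mem_growth hφ K
  rw [integral_mul_sub_iterInt hφ.1 hw K hs hb, op_apply hφ, tail_apply hφK hs,
    ← integral_add_adjacent_intervals (intervalIntegrable_of_continuousOn_Ioo hφK.1 hs hb)
      (intervalIntegrable_one_of_mem_growth hφK hb)]
  ring

lemma exists_norm_sub_iterInt_le {p : List (ℝ → ℂ)} {f : ℝ → ℂ}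
    (hp : ∀ φ ∈ p, φ ∈ growth (-1) (-1)) (hf : f ∈ growth (-1) 0) :
    ∃ (C : ℝ) (J : ℕ), 0 ≤ C ∧ ∀ z, 0 < z → ∀ s ∈ Icc z (1 - z),
      ‖((p.map op).prod (tail f)).1 s - iterInt (p ++ [f]) s (1 - z)‖ ≤ C * weight 1 0 J z := by
  induction p with
  | nil =>
    obtain ⟨C, J, hC, h⟩ := exists_norm_le_weight (integral_one_mem_growth hf)
    refine ⟨C, J, hC, fun z hz s hs => ?_⟩
    have hs1 := mem_Ioo_of_mem_Icc_one_sub hz hs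
    have hb1 := one_sub_mem_Ioo (mem_Ioo_of_mem_Icc_one_sub hz ⟨le_rfl, hs.1.trans hs.2⟩)
    simp only [List.map_nil, List.prod_nil, Module.End.one_apply, List.nil_append, iterInt,
      mul_one]
    rw [tail_apply hf hs1, integral_interval_sub_left (intervalIntegrable_one_of_mem_growth hf hs1)
      (intervalIntegrable_of_continuousOn_Ioo hf.1 hs1 hb1), ← weight_one_sub]
    exact h _ hb1
  | cons φ p ih =>
    obtain ⟨hφ, hp⟩ := List.forall_mem_cons.1 hp
    obtain ⟨C, J, hC, hCJ⟩ := ih hp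
    obtain ⟨D, J', hD, hDJ⟩ := exists_norm_integral_mul_le hφ
    set K := (p.map op).prod (tail f) with hK
    obtain ⟨E, J'', hE, hEJ⟩ :=
      exists_norm_le_weight (integral_one_mem_growth (mul_decay_mem_growth hφ K))
    refine ⟨E + D * C, J'' + (J' + J), by positivity, fun z hz s hs => ?_⟩
    have hs1 := mem_Ioo_of_mem_Icc_one_sub hz hs
    have hz1 := mem_Ioo_of_mem_Icc_one_sub hz ⟨le_rfl, hs.1.trans hs.2⟩
    have hb1 := one_sub_mem_Ioo hz1
    have hfar := hEJ _ hb1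
    have hnear := hDJ z s _ hz hs (mul_nonneg hC (weight_pos hz1 1 0 J).le) _
      fun t ht => hCJ z hz t ⟨hs.1.trans ht.1, ht.2⟩
    rw [weight_one_sub] at hfar
    rw [List.map_cons, List.prod_cons, Module.End.mul_apply, ← hK, List.cons_append,
      op_sub_iterInt_cons hφ (continuousOn_of_mem_append_singleton hp hf) K hs1 hb1]
    calc _ ≤ E * weight 1 0 J'' z + D * lam z ^ J' * (C * weight 1 0 J z) :=
          (norm_add_le _ _).trans (add_le_add hfar hnear)
      _ = E * weight 1 0 J'' z + D * C * weight 1 0 (J' + J) z := by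
          simp only [weight, pow_add]; ring
      _ ≤ (E + D * C) * weight 1 0 (J'' + (J' + J)) z := by
          rw [add_mul]
          gcongr <;> exact weight_le_weight hz1 le_rfl le_rfl (by omega)

lemma isRegValue_iterInt {φ f : ℝ → ℂ} {p : List (ℝ → ℂ)} (hφ : φ ∈ growth 0 0)
    (hp : ∀ ψ ∈ p, ψ ∈ growth (-1) (-1)) (hf : f ∈ growth (-1) 0) :
    IsRegValue (fun z => iterInt (φ :: (p ++ [f])) z (1 - z))
      (total φ ((p.map op).prod (tail f))) := by
  obtain ⟨C, J, hC, hCJ⟩ := exists_norm_sub_iterInt_le hp hf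
  obtain ⟨D, J', -, hDJ⟩ :=
    exists_norm_integral_mul_le (growth_anti (i' := -1) (j' := -1) (by simp) (by simp) hφ)
  set K := (p.map op).prod (tail f)
  have herr : IsRegValue (fun z => ∫ t in z..(1 - z), φ t *
      (K.1 t - iterInt (p ++ [f]) t (1 - z))) 0 := by
    refine isRegValue_zero_of_isBigO (J := J' + J) (IsBigO.of_bound (D * C) ?_)
    filter_upwards [eventually_mem_Icc_one_sub] with z ⟨hz, hzb⟩
    have hz1 := mem_Ioo_of_mem_Icc_one_sub hz hzb
    refine (hDJ z z _ hz hzb (mul_nonneg hC (weight_pos hz1 1 0 J).le) _ fun t ht =>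
      hCJ z hz t ht).trans_eq ?_
    rw [Real.norm_of_nonneg (weight_pos hz1 _ _ _).le]
    simp only [weight, pow_add]; ring
  have h := (isRegValue_integral (mul_decay_mem_growth_zero hφ K)).sub herr
  rw [sub_zero] at h
  rw [total_apply hφ]
  refine h.congr ?_
  filter_upwards [eventually_mem_Icc_one_sub] with z ⟨hz, hzb⟩
  have hz1 := mem_Ioo_of_mem_Icc_one_sub hz hzb
  rw [integral_mul_sub_iterInt hφ.1 (continuousOn_of_mem_append_singleton hp hf) K hz1
    (one_sub_mem_Ioo hz1), sub_sub_cancel]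

lemma isRegValue_iterInt_singleton {f : ℝ → ℂ} (hf : f ∈ growth 0 0) :
    IsRegValue (fun z => iterInt [f] z (1 - z)) (∫ t in (0 : ℝ)..1, f t) := by
  simpa [iterInt] using isRegValue_integral hf

/-! ### Holomorphic functions on a slit half-plane -/

lemma isExactOn_of_starConvex {s : Set ℂ} (hs : IsOpen s) {x : ℂ} (hx : StarConvex ℝ x s)
    {f : ℂ → ℂ} (hf : DifferentiableOn ℂ f s) : Complex.IsExactOn f s := by
  let ω : ℂ → ℂ →L[ℂ] ℂ := fun z => ContinuousLinearMap.smulRightL ℂ ℂ ℂ 1 (f z)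
  refine ⟨fun b => ∫ᶜ z in .segment x b, ω z, fun b hb => ?_⟩
  obtain ⟨r, hr, hrs⟩ := Metric.isOpen_iff.1 hs b hb
  -- The cone over a small ball is convex, so that the Poincaré lemma applies to it.
  have hne : (Metric.ball b r).Nonempty := ⟨b, Metric.mem_ball_self hr⟩
  have hcone : convexHull ℝ (insert x (Metric.ball b r)) ⊆ s := by
    rw [convexHull_insert hne, (convex_ball b r).convexHull_eq, convexJoin_singleton_left]
    exact iUnion₂_subset fun y hy => hx.segment_subset (hrs hy)
  have hsub := subset_convexHull ℝ (insert x (Metric.ball b r))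
  have hball : Metric.ball b r ⊆ convexHull ℝ (insert x (Metric.ball b r)) :=
    (subset_insert _ _).trans hsub
  have h := (convex_convexHull ℝ (insert x (Metric.ball b r)))
    |>.hasFDerivWithinAt_curveIntegral_segment_of_hasFDerivWithinAt_symmetric (ω := ω)
    (fun z hz => ((ContinuousLinearMap.smulRightL ℂ ℂ ℂ 1).hasFDerivAt.comp_hasDerivWithinAt z
      ((hf.mono hcone) z hz).hasDerivWithinAt).restrictScalars ℝ)
    (fun z _ v _ w _ => by simp; ring) (hsub (mem_insert _ _))
    (hball (Metric.mem_ball_self hr))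
  simpa [ω] using (h.hasFDerivAt (mem_of_superset (Metric.ball_mem_nhds b hr) hball)).hasDerivAt

/-- The half-plane `c < Re x`, slit along `[1, ∞)`. -/
def slitHalfPlane (c : ℝ) : Set ℂ := {x | c < x.re ∧ 1 - x ∈ Complex.slitPlane}

/-- The points outside the slit half-plane at which forms on it may have poles. -/
def IsPole (c : ℝ) (a : ℂ) : Prop := a.re < c ∨ a = 1

lemma isPole_zero {c : ℝ} (hc : 0 < c) : IsPole c 0 := Or.inl (by simpa using hc)

lemma isOpen_slitHalfPlane (c : ℝ) : IsOpen (slitHalfPlane c) :=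
  (isOpen_lt continuous_const Complex.continuous_re).inter
    (Complex.isOpen_slitPlane.preimage (continuous_const.sub continuous_id))

lemma mem_slitHalfPlane_of_im_ne_zero {c : ℝ} {x : ℂ} (hx : c < x.re) (hx0 : x.im ≠ 0) :
    x ∈ slitHalfPlane c := ⟨hx, Or.inr (by simpa using hx0)⟩

lemma mem_slitHalfPlane_of_re_lt_one {c : ℝ} {x : ℂ} (hx : c < x.re) (hx1 : x.re < 1) :
    x ∈ slitHalfPlane c := ⟨hx, Or.inl (by simpa using hx1)⟩

lemma sub_ne_zero_of_isPole {c : ℝ} {a x : ℂ} (ha : IsPole c a) (hx : x ∈ slitHalfPlane c) :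
    x - a ≠ 0 := by
  rintro h
  obtain rfl := sub_eq_zero.1 h
  rcases ha with ha | rfl
  · exact lt_asymm ha hx.1
  · simpa using hx.2

lemma starConvex_slitHalfPlane {c : ℝ} (hc : c < 1) :
    StarConvex ℝ (((c + 1) / 2 : ℝ) : ℂ) (slitHalfPlane c) := by
  have hmid : c < (((c + 1) / 2 : ℝ) : ℂ).re := by rw [Complex.ofReal_re]; linarith
  have hslit := Complex.starConvex_ofReal_slitPlane (x := 1 - (c + 1) / 2) (by linarith)
  intro y hy a b ha hb hab
  refine ⟨(convex_halfSpace_re_gt c).starConvex hmid hy.1 ha hb hab, ?_⟩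
  have hmem := hslit hy.2 ha hb hab
  have habc : (a : ℂ) + b = 1 := by exact_mod_cast hab
  convert hmem using 1
  simp only [Complex.real_smul, Complex.ofReal_sub, Complex.ofReal_one]
  linear_combination -habc

lemma exists_primitive_slitHalfPlane {c : ℝ} (hc : c < 1) {f : ℂ → ℂ}
    (hf : DifferentiableOn ℂ f (slitHalfPlane c)) (x y : ℂ) :
    ∃ F, F x = y ∧ ∀ z ∈ slitHalfPlane c, HasDerivAt F (f z) z :=
  (isExactOn_of_starConvex (isOpen_slitHalfPlane c) (starConvex_slitHalfPlane hc) hf).with_val_at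
    x y

lemma segment_subset_slitHalfPlane {c : ℝ} {u v : ℂ} (hu : c < u.re) (hv : c < v.re)
    (huv : 0 < u.im * v.im) : segment ℝ u v ⊆ slitHalfPlane c := by
  intro y hy
  have hre : c < y.re := (convex_halfSpace_re_gt c).segment_subset hu hv hy
  refine mem_slitHalfPlane_of_im_ne_zero hre ?_
  rcases pos_and_pos_or_neg_and_neg_of_mul_pos huv with ⟨hu, hv⟩ | ⟨hu, hv⟩
  · exact ((convex_halfSpace_im_gt 0).segment_subset hu hv hy).ne'
  · exact ((convex_halfSpace_im_lt 0).segment_subset hu hv hy).ne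

lemma min_norm_le_of_mem_segment {E : Type*} [NormedAddCommGroup E] [InnerProductSpace ℝ E]
    {u v y : E} (huv : 0 ≤ inner ℝ u v) (hy : y ∈ segment ℝ u v) : min ‖u‖ ‖v‖ ≤ 2 * ‖y‖ := by
  obtain ⟨a, b, ha, hb, hab, rfl⟩ := hy
  set m := min ‖u‖ ‖v‖
  have hm : 0 ≤ m := le_min (norm_nonneg u) (norm_nonneg v)
  refine le_of_sq_le_sq ?_ (by positivity)
  have hu : m ^ 2 ≤ ‖u‖ ^ 2 := pow_le_pow_left₀ hm (min_le_left _ _) 2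
  have hv : m ^ 2 ≤ ‖v‖ ^ 2 := pow_le_pow_left₀ hm (min_le_right _ _) 2
  have hinner := mul_nonneg (mul_nonneg ha hb) huv
  have hsq : ‖a • u + b • v‖ ^ 2 =
      a ^ 2 * ‖u‖ ^ 2 + 2 * (a * b * inner ℝ u v) + b ^ 2 * ‖v‖ ^ 2 := by
    rw [norm_add_sq_real, norm_smul, norm_smul, real_inner_smul_left, real_inner_smul_right,
      Real.norm_of_nonneg ha, Real.norm_of_nonneg hb]
    ring
  have hab2 : (a ^ 2 + b ^ 2) * m ^ 2 = (1 + (a - b) ^ 2) / 2 * m ^ 2 := by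
    rw [← one_pow (M := ℝ) 2, ← hab]; ring
  nlinarith [mul_le_mul_of_nonneg_left hu (sq_nonneg a), mul_le_mul_of_nonneg_left hv (sq_nonneg b),
    mul_nonneg (sq_nonneg (a - b)) (sq_nonneg m)]

lemma norm_inv_le_of_mem_segment {u v y : ℂ} (hu : 0 < u.re) (hv : 0 < v.re)
    (huv : 0 < u.im * v.im) (hy : y ∈ segment ℝ u v) : ‖y⁻¹‖ ≤ 2 * (‖u⁻¹‖ + ‖v⁻¹‖) := by
  have hm := min_norm_le_of_mem_segment (by
    rw [Complex.inner]; simp; nlinarith [mul_pos hu hv]) hy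
  have hu0 : 0 < ‖u‖ := norm_pos_iff.2 fun h => by simp [h] at hu
  have hv0 : 0 < ‖v‖ := norm_pos_iff.2 fun h => by simp [h] at hv
  have hy0 : 0 < ‖y‖ := by linarith [lt_min hu0 hv0]
  have hle {w : ℂ} (hw : 0 < ‖w‖) (h : ‖w‖ ≤ 2 * ‖y‖) : ‖y⁻¹‖ ≤ 2 * ‖w⁻¹‖ := by
    rw [norm_inv, norm_inv, ← div_eq_mul_inv, le_div_iff₀ hw, inv_mul_le_iff₀ hy0]
    linarith
  rcases min_le_iff.1 hm with h | h
  · linarith [hle hu0 h, norm_nonneg v⁻¹]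
  · linarith [hle hv0 h, norm_nonneg u⁻¹]

lemma norm_le_mul_norm_sub {w a : ℂ} {d : ℝ} (hd : 0 < d) (h : d ≤ ‖w - a‖) :
    ‖w‖ ≤ (1 + ‖a‖ / d) * ‖w - a‖ := by
  have h1 : ‖w‖ ≤ ‖w - a‖ + ‖a‖ := by simpa using norm_add_le (w - a) a
  have h2 : ‖a‖ ≤ ‖a‖ / d * ‖w - a‖ := by
    rw [div_mul_eq_mul_div, le_div_iff₀ hd]
    exact mul_le_mul_of_nonneg_left h (norm_nonneg a)
  linarith

lemma norm_log_le {w : ℂ} {m M : ℝ} (hm : 0 < m) (h1 : m ≤ ‖w‖) (h2 : ‖w‖ ≤ M) :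
    ‖Complex.log w‖ ≤ |Real.log m| + |Real.log M| + 4 := by
  have h3 : ‖Complex.log w‖ ≤ |Real.log ‖w‖| + |Complex.arg w| := by
    simpa [Complex.log_re, Complex.log_im] using Complex.norm_le_abs_re_add_abs_im (Complex.log w)
  have h4 := (Complex.abs_arg_le_pi w).trans Real.pi_le_four
  have h5 := abs_le_max_abs_abs (Real.log_le_log hm h1) (Real.log_le_log (hm.trans_le h1) h2)
  have h6 := max_le_add_of_nonneg (abs_nonneg (Real.log m)) (abs_nonneg (Real.log M))
  linarith

lemma abs_log_weight_le {C : ℝ} (hC : 0 < C) (J : ℕ) {t : ℝ} (ht : t ∈ Ioo (0 : ℝ) 1) :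
    |Real.log (C * weight (-1) (-1) J t)| ≤ (|Real.log C| + 1 + J) * lam t := by
  have hl := one_le_lam ht
  have hlog : Real.log (weight (-1) (-1) J t) = lam t - 1 + J * Real.log (lam t) := by
    have h0 := (zpow_pos ht.1 (-1)).ne'
    have h1 := (zpow_pos (sub_pos.2 ht.2) (-1)).ne'
    rw [weight, Real.log_mul (mul_ne_zero h0 h1) (pow_pos (lam_pos ht) J).ne',
      Real.log_mul h0 h1, Real.log_zpow, Real.log_zpow, Real.log_pow, lam]
    push_cast
    ring
  rw [Real.log_mul hC.ne' (weight_pos ht _ _ _).ne', hlog]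
  have h1 := Real.log_nonneg hl
  have h2 := (Real.log_le_sub_one_of_pos (lam_pos ht)).trans (sub_le_self (lam t) zero_le_one)
  have h3 := abs_nonneg (Real.log C)
  have h4 := abs_le.1 (le_refl |Real.log C|)
  have hJ : (0 : ℝ) ≤ J := J.cast_nonneg
  rw [abs_le]
  constructor <;> nlinarith [mul_le_mul_of_nonneg_left h2 hJ, mul_nonneg hJ h1]

lemma norm_log_le_mul_lam {c C : ℝ} (hc : 0 < c) (hC : 0 < C) {J : ℕ} {t : ℝ}
    (ht : t ∈ Ioo (0 : ℝ) 1) {w : ℂ} (h1 : c ≤ ‖w‖) (h2 : ‖w‖ ≤ C * weight (-1) (-1) J t) :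
    ‖Complex.log w‖ ≤ (|Real.log c| + |Real.log C| + J + 5) * lam t := by
  have h3 := norm_log_le hc h1 h2
  have h4 := abs_log_weight_le hC J ht
  nlinarith [one_le_lam ht, abs_nonneg (Real.log c)]

/-! ### Forms along paths to infinity -/

/-- The coefficient of the form `(e_b - e_0) (log x)ⁿ / n!`. -/
def lastCoeff (b : ℂ) (n : ℕ) (x : ℂ) : ℂ :=
  ((x - b)⁻¹ - x⁻¹) * (Complex.log x ^ n / n.factorial)

/-- The points `x` run off to infinity like `1 / (τ (1 - τ))`, up to powers of the logarithm, and
stay away from the poles. -/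
structure Escapes {X : Type*} (c : ℝ) (l : Filter X) (τ : X → ℝ) (x : X → ℂ) : Prop where
  mem_Ioo : ∀ᶠ p in l, τ p ∈ Ioo (0 : ℝ) 1
  lt_re : ∀ᶠ p in l, c < (x p).re
  far : ∃ d > 0, ∀ᶠ p in l, d ≤ ‖x p - 1‖
  hasGrowth : HasGrowth l τ (-1) (-1) x
  hasGrowth_inv : HasGrowth l τ 1 1 x⁻¹

namespace Escapes

variable {X : Type*} {c : ℝ} {l : Filter X} {τ : X → ℝ} {x : X → ℂ} {a : ℂ}

lemma exists_le_norm_sub (h : Escapes c l τ x) (ha : IsPole c a) :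
    ∃ d > 0, ∀ᶠ p in l, d ≤ ‖x p - a‖ := by
  rcases ha with ha | rfl
  · refine ⟨c - a.re, sub_pos.2 ha, h.lt_re.mono fun p hp => ?_⟩
    refine le_trans ?_ (Complex.re_le_norm _)
    rw [Complex.sub_re]
    linarith
  · exact h.far

lemma inv_sub (hc : 0 < c) (h : Escapes c l τ x) (ha : IsPole c a) :
    HasGrowth l τ 1 1 fun p => (x p - a)⁻¹ := by
  obtain ⟨d, hd, hfar⟩ := h.exists_le_norm_sub ha
  refine h.hasGrowth_inv.trans (.of_bound (1 + ‖a‖ / d) ?_)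
  filter_upwards [hfar, h.lt_re] with p hp hre
  have hx : 0 < ‖x p‖ := norm_pos_iff.2 fun h0 => by rw [h0, Complex.zero_re] at hre; linarith
  rw [Pi.inv_apply, norm_inv, norm_inv, ← div_eq_mul_inv, le_div_iff₀ hx,
    inv_mul_le_iff₀ (hd.trans_le hp), mul_comm]
  exact norm_le_mul_norm_sub hd hp

lemma inv_sub_sub_inv (hc : 0 < c) (h : Escapes c l τ x) (ha : IsPole c a) :
    HasGrowth l τ 2 2 fun p => (x p - a)⁻¹ - (x p)⁻¹ := by
  obtain ⟨d, hd, hfar⟩ := h.exists_le_norm_sub ha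
  refine (((h.inv_sub hc ha).mul h.mem_Ioo h.hasGrowth_inv).const_smul a).congr ?_
  filter_upwards [hfar, h.lt_re] with p hp hre
  have hx : x p ≠ 0 := fun h0 => by rw [h0, Complex.zero_re] at hre; linarith
  have hxa : x p - a ≠ 0 := norm_pos_iff.1 (hd.trans_le hp)
  simp only [Pi.smul_apply, Pi.mul_apply, Pi.inv_apply, smul_eq_mul]
  field_simp
  ring

lemma log (hc : 0 < c) (h : Escapes c l τ x) : HasGrowth l τ 0 0 fun p => Complex.log (x p) := by
  obtain ⟨C, J, hC, hx⟩ := h.hasGrowth.exists_eventually_le h.mem_Ioo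
  refine .of_eventually_le (C := |Real.log c| + |Real.log C| + J + 5) (J := 1) ?_
  filter_upwards [h.mem_Ioo, h.lt_re, hx] with p hp hre hx
  simpa [weight] using norm_log_le_mul_lam hc hC hp (hre.le.trans (Complex.re_le_norm _)) hx

lemma lastCoeff_comp (hc : 0 < c) (h : Escapes c l τ x) (ha : IsPole c a) (n : ℕ) :
    HasGrowth l τ 2 2 fun p => lastCoeff a n (x p) := by
  refine (((h.inv_sub_sub_inv hc ha).mul h.mem_Ioo ((h.log hc).pow h.mem_Ioo n)).const_smul
    (n.factorial : ℂ)⁻¹).congr (.of_eq (funext fun p => ?_))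
  simp only [lastCoeff, Pi.smul_apply, Pi.mul_apply, Pi.pow_apply, smul_eq_mul]
  ring

end Escapes

/-- A path in the slit half-plane that stays away from `1` and goes to infinity with speed
`1 / (t (1 - t))` up to powers of the logarithm, above the slit for `t → 0` and below it for
`t → 1`. -/
structure GoodPath (c : ℝ) (γ : ℝ → ℂ) : Prop where
  mem : ∀ t ∈ Ioo (0 : ℝ) 1, γ t ∈ slitHalfPlane c
  differentiableAt : ∀ t ∈ Ioo (0 : ℝ) 1, DifferentiableAt ℝ γ t
  far : ∃ d > 0, ∀ t ∈ Ioo (0 : ℝ) 1, d ≤ ‖γ t - 1‖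
  mem_growth : γ ∈ growth (-1) (-1)
  inv_mem_growth : γ⁻¹ ∈ growth 1 1
  deriv_mem_growth : deriv γ ∈ growth (-2) (-2)
  im_pos : ∀ᶠ t in 𝓝[>] (0 : ℝ), 0 < (γ t).im
  im_neg : ∀ᶠ t in 𝓝[<] (1 : ℝ), (γ t).im < 0

/-- The form `(e_b - e_0) (log x)ⁿ / n!` along `γ`. -/
def pathLast (γ : ℝ → ℂ) (b : ℂ) (n : ℕ) : ℝ → ℂ := fun t => lastCoeff b n (γ t) * deriv γ t

lemma pathLast_eq (γ : ℝ → ℂ) (b : ℂ) (n : ℕ) (t : ℝ) : pathLast γ b n t =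
    (eForm γ b t - eForm γ 0 t) * (Complex.log (γ t) ^ n / n.factorial) := by
  rw [pathLast, lastCoeff, eForm, eForm, sub_zero]
  ring

namespace GoodPath

variable {c : ℝ} {γ : ℝ → ℂ} {a b : ℂ}

lemma escapes (h : GoodPath c γ) : Escapes c (𝓟 (Ioo 0 1)) id γ where
  mem_Ioo := mem_principal_self _
  lt_re := eventually_principal.2 fun t ht => (h.mem t ht).1
  far := h.far.imp fun _ hd => ⟨hd.1, eventually_principal.2 hd.2⟩
  hasGrowth := hasGrowth_of_mem_growth h.mem_growth
  hasGrowth_inv := hasGrowth_of_mem_growth h.inv_mem_growth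

lemma continuousOn (h : GoodPath c γ) : ContinuousOn γ (Ioo 0 1) :=
  continuousOn_of_mem_growth h.mem_growth

lemma sub_ne_zero (h : GoodPath c γ) (ha : IsPole c a) {t : ℝ} (ht : t ∈ Ioo (0 : ℝ) 1) :
    γ t - a ≠ 0 := sub_ne_zero_of_isPole ha (h.mem t ht)

lemma inv_sub_mem_growth (hc : 0 < c) (h : GoodPath c γ) (ha : IsPole c a) :
    (fun t => (γ t - a)⁻¹) ∈ growth 1 1 :=
  ⟨(h.continuousOn.sub continuousOn_const).inv₀ fun _ ht => h.sub_ne_zero ha ht,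
    h.escapes.inv_sub hc ha⟩

lemma eForm_mem_growth (hc : 0 < c) (h : GoodPath c γ) (ha : IsPole c a) :
    eForm γ a ∈ growth (-1) (-1) :=
  mem_growth_congr (fun _ _ => (div_eq_mul_inv _ _).symm)
    (mul_mem_growth h.deriv_mem_growth (h.inv_sub_mem_growth hc ha))

lemma log_mem_growth (hc : 0 < c) (h : GoodPath c γ) :
    (fun t => Complex.log (γ t)) ∈ growth 0 0 :=
  ⟨h.continuousOn.clog fun t ht => Or.inl (hc.trans (h.mem t ht).1), h.escapes.log hc⟩

lemma pathLast_mem_growth (hc : 0 < c) (h : GoodPath c γ) (hb : IsPole c b) (n : ℕ) :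
    pathLast γ b n ∈ growth 0 0 := by
  refine mul_mem_growth ⟨?_, h.escapes.lastCoeff_comp hc hb n⟩ h.deriv_mem_growth
  refine ((continuousOn_of_mem_growth (h.inv_sub_mem_growth hc hb)).sub
    (continuousOn_of_mem_growth h.inv_mem_growth)).mul
      (((continuousOn_of_mem_growth (h.log_mem_growth hc)).pow n).div_const _)

lemma eForm_sub_mem_growth (hc : 0 < c) (h : GoodPath c γ) (ha : IsPole c a) :
    eForm γ a - eForm γ 0 ∈ growth 0 0 :=
  mem_growth_congr (fun t _ => by simp [pathLast_eq]) (h.pathLast_mem_growth hc ha 0)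

end GoodPath

/-! ### Homotopy invariance -/

/-- The filter of pairs `(t, y)` with `y` on the segment from `γ t` to `γ' t`, as `t` tends to one
of the end points of the unit interval. -/
def between (γ γ' : ℝ → ℂ) : Filter (ℝ × ℂ) :=
  comap Prod.fst (𝓝[>] 0 ⊔ 𝓝[<] 1) ⊓ 𝓟 {p | p.2 ∈ segment ℝ (γ p.1) (γ' p.1)}

lemma ends_le_principal : 𝓝[>] (0 : ℝ) ⊔ 𝓝[<] 1 ≤ 𝓟 (Ioo 0 1) :=
  sup_le (le_principal_iff.2 (Ioo_mem_nhdsGT one_pos)) (le_principal_iff.2 (Ioo_mem_nhdsLT one_pos))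

lemma eventually_between {γ γ' : ℝ → ℂ} {P : ℝ × ℂ → Prop} : (∀ᶠ p in between γ γ', P p) ↔
    ∀ᶠ t in 𝓝[>] (0 : ℝ) ⊔ 𝓝[<] 1, ∀ y ∈ segment ℝ (γ t) (γ' t), P (t, y) := by
  rw [between, eventually_inf_principal, eventually_comap]
  refine eventually_congr (.of_forall fun t => ⟨fun h y => h (t, y) rfl, ?_⟩)
  rintro h ⟨_, y⟩ rfl
  exact h y

lemma tendsto_fst_between (γ γ' : ℝ → ℂ) :
    Tendsto Prod.fst (between γ γ') (𝓝[>] 0 ⊔ 𝓝[<] 1) :=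
  tendsto_comap.mono_left inf_le_left

lemma tendsto_right_between (γ γ' : ℝ → ℂ) :
    Tendsto (fun t => (t, γ' t)) (𝓝[>] 0 ⊔ 𝓝[<] 1) (between γ γ') := fun _ hP =>
  (eventually_between.1 hP).mono fun _ ht => ht _ (right_mem_segment ℝ _ _)

lemma HasGrowth.fst_between {γ γ' f : ℝ → ℂ} {i j : ℤ} (hf : f ∈ growth i j) :
    HasGrowth (between γ γ') Prod.fst i j fun p => f p.1 :=
  (hasGrowth_of_mem_growth hf).comp ((tendsto_fst_between γ γ').mono_right ends_le_principal)

lemma HasGrowth.tendsto_zero_one {X : Type*} {l : Filter X} {τ : X → ℝ} {f : X → ℂ}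
    (hf : HasGrowth l τ 0 1 f) (hτ : Tendsto τ l (𝓝[<] 1)) : Tendsto f l (𝓝 0) := by
  obtain ⟨J, hJ⟩ := hf
  exact hJ.trans_tendsto ((tendsto_weight_zero_one J).comp hτ)

lemma tendsto_weight_one_one (J : ℕ) : Tendsto (weight 1 1 J) (𝓝[>] 0 ⊔ 𝓝[<] 1) (𝓝 0) := by
  have hle (i j : ℤ) (hi : i ≤ 1) (hj : j ≤ 1) : weight 1 1 J =O[𝓝[>] 0 ⊔ 𝓝[<] 1] weight i j J :=
    isBigO_weight (τ := id) (le_principal_iff.1 ends_le_principal) hi hj le_rfl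
  refine tendsto_sup.2 ⟨?_, ?_⟩
  · exact ((hle 1 0 le_rfl zero_le_one).mono le_sup_left).trans_tendsto (tendsto_weight_one_zero J)
  · exact ((hle 0 1 zero_le_one le_rfl).mono le_sup_right).trans_tendsto (tendsto_weight_zero_one J)

lemma HasGrowth.tendsto_one_one {X : Type*} {l : Filter X} {τ : X → ℝ} {f : X → ℂ}
    (hf : HasGrowth l τ 1 1 f) (hτ : Tendsto τ l (𝓝[>] 0 ⊔ 𝓝[<] 1)) : Tendsto f l (𝓝 0) := by
  obtain ⟨J, hJ⟩ := hf
  exact hJ.trans_tendsto ((tendsto_weight_one_one J).comp hτ)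

section Between

variable {c : ℝ} {γ γ' : ℝ → ℂ}

lemma eventually_im_mul_im_pos (hγ : GoodPath c γ) (hγ' : GoodPath c γ') :
    ∀ᶠ t in 𝓝[>] 0 ⊔ 𝓝[<] 1, 0 < (γ t).im * (γ' t).im := by
  refine eventually_sup.2 ⟨?_, ?_⟩
  · filter_upwards [hγ.im_pos, hγ'.im_pos] with t h h' using mul_pos h h'
  · filter_upwards [hγ.im_neg, hγ'.im_neg] with t h h' using mul_pos_of_neg_of_neg h h'

lemma eventually_segment_subset (hγ : GoodPath c γ) (hγ' : GoodPath c γ') :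
    ∀ᶠ t in 𝓝[>] 0 ⊔ 𝓝[<] 1, segment ℝ (γ t) (γ' t) ⊆ slitHalfPlane c := by
  filter_upwards [le_principal_iff.1 ends_le_principal, eventually_im_mul_im_pos hγ hγ']
    with t ht him
  exact segment_subset_slitHalfPlane (hγ.mem t ht).1 (hγ'.mem t ht).1 him

lemma eventually_fst_mem_Ioo (γ γ' : ℝ → ℂ) :
    ∀ᶠ p in between γ γ', p.1 ∈ Ioo (0 : ℝ) 1 :=
  (tendsto_fst_between γ γ').eventually (le_principal_iff.1 ends_le_principal)

lemma eventually_snd_mem_segment (γ γ' : ℝ → ℂ) :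
    ∀ᶠ p in between γ γ', p.2 ∈ segment ℝ (γ p.1) (γ' p.1) :=
  eventually_between.2 (.of_forall fun _ _ hy => hy)

lemma HasGrowth.of_norm_le_between {f g : ℝ → ℂ} {i j : ℤ} (hf : f ∈ growth i j)
    (hg : g ∈ growth i j) {k : ℝ × ℂ → ℂ} {C : ℝ}
    (hk : ∀ᶠ p in between γ γ', ‖k p‖ ≤ C * (‖f p.1‖ + ‖g p.1‖)) :
    HasGrowth (between γ γ') Prod.fst i j k :=
  .of_norm_le_add (eventually_fst_mem_Ioo γ γ') (.fst_between hf) (.fst_between hg) hk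

lemma escapes_between (hc : 0 < c) (hγ : GoodPath c γ) (hγ' : GoodPath c γ') :
    Escapes c (between γ γ') Prod.fst Prod.snd := by
  have hIoo := eventually_fst_mem_Ioo γ γ'
  have hseg := eventually_snd_mem_segment γ γ'
  have hinv : HasGrowth (between γ γ') Prod.fst 1 1 Prod.snd⁻¹ := by
    refine .of_norm_le_between (C := 2) hγ.inv_mem_growth hγ'.inv_mem_growth ?_
    filter_upwards [hIoo, hseg,
      (tendsto_fst_between γ γ').eventually (eventually_im_mul_im_pos hγ hγ')] with p hp hy him
    exact norm_inv_le_of_mem_segment (hc.trans (hγ.mem _ hp).1) (hc.trans (hγ'.mem _ hp).1) him hy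
  have hre : ∀ᶠ p in between γ γ', c < p.2.re := by
    filter_upwards [hIoo, hseg] with p hp hy
    exact (convex_halfSpace_re_gt c).segment_subset (hγ.mem _ hp).1 (hγ'.mem _ hp).1 hy
  refine ⟨hIoo, hre, ⟨1, one_pos, ?_⟩, ?_, hinv⟩
  · have h0 := (hinv.tendsto_one_one (tendsto_fst_between γ γ')).norm.eventually_lt_const
      (norm_zero.trans_lt one_half_pos)
    filter_upwards [h0, hre] with p hp hre
    have hp0 : 0 < ‖p.2‖ := (hc.trans hre).trans_le (Complex.re_le_norm _)
    rw [Pi.inv_apply, norm_inv, inv_lt_comm₀ hp0 one_half_pos, one_div, inv_inv] at hp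
    linarith [norm_sub_norm_le p.2 1, norm_one (α := ℂ)]
  · refine .of_norm_le_between (C := 1) hγ.mem_growth hγ'.mem_growth ?_
    filter_upwards [hseg] with p hy
    have hmax := (convexOn_norm convex_univ).le_max_of_mem_segment (mem_univ _) (mem_univ _) hy
    rw [one_mul]
    exact hmax.trans (max_le_add_of_nonneg (norm_nonneg _) (norm_nonneg _))

lemma HasGrowth.sub_between {i j : ℤ} (hγ : GoodPath c γ) (hγ' : GoodPath c γ') {F f : ℂ → ℂ}
    (hF : ∀ x ∈ slitHalfPlane c, HasDerivAt F (f x) x)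
    (hf : HasGrowth (between γ γ') Prod.fst i j fun p => f p.2) :
    HasGrowth (between γ γ') Prod.fst (i - 1) (j - 1) fun p => F p.2 - F (γ p.1) := by
  obtain ⟨C, J, hC, hbound⟩ := hf.exists_eventually_le (eventually_fst_mem_Ioo γ γ')
  obtain ⟨C', J', -, hsub⟩ := exists_norm_le_weight (sub_mem hγ'.mem_growth hγ.mem_growth)
  refine .of_eventually_le (C := C * C') (J := J + J') (eventually_between.2 ?_)
  filter_upwards [eventually_between.1 hbound, eventually_segment_subset hγ hγ',
    le_principal_iff.1 ends_le_principal] with t hb hD ht y hy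
  have hmean := (convex_segment (γ t) (γ' t)).norm_image_sub_le_of_norm_hasDerivWithin_le
    (fun x hx => (hF x (hD hx)).hasDerivWithinAt) hb (left_mem_segment ℝ _ _) hy
  calc ‖F y - F (γ t)‖ ≤ C * weight i j J t * ‖y - γ t‖ := hmean
    _ ≤ C * weight i j J t * (C' * weight (-1) (-1) J' t) := by
        gcongr
        · exact mul_nonneg hC.le (weight_pos ht _ _ _).le
        · exact (norm_sub_le_of_mem_segment hy).trans (hsub t ht)
    _ = C * C' * weight (i - 1) (j - 1) (J + J') t := by
        rw [mul_mul_mul_comm, weight_mul_weight ht, sub_eq_add_neg, sub_eq_add_neg]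

/-- The function `K` on the slit half-plane restricts to `k` along `γ` and to `k'` along `γ'`, and
it has on the segments between the two paths the growth of an element of `Decay`. -/
structure Interpolates (c : ℝ) (γ γ' : ℝ → ℂ) (K : ℂ → ℂ) (k k' : Decay) : Prop where
  differentiableOn : DifferentiableOn ℂ K (slitHalfPlane c)
  left : EqOn (K ∘ γ) k.1 (Ioo 0 1)
  right : EqOn (K ∘ γ') k'.1 (Ioo 0 1)
  hasGrowth : HasGrowth (between γ γ') Prod.fst 0 1 fun p => K p.2

lemma GoodPath.hasDerivAt_comp (hγ : GoodPath c γ) {F f : ℂ → ℂ}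
    (hF : ∀ x ∈ slitHalfPlane c, HasDerivAt F (f x) x) {t : ℝ} (ht : t ∈ Ioo (0 : ℝ) 1) :
    HasDerivAt (F ∘ γ) (f (γ t) * deriv γ t) t :=
  (hF _ (hγ.mem t ht)).comp_of_eq t (hγ.differentiableAt t ht).hasDerivAt rfl

lemma GoodPath.exists_primitive_eq_tail (hc : c < 1) (hγ : GoodPath c γ) {f : ℂ → ℂ}
    (hf : DifferentiableOn ℂ f (slitHalfPlane c))
    (hg : (fun t => f (γ t) * deriv γ t) ∈ growth (-1) 0) :
    ∃ F, (∀ x ∈ slitHalfPlane c, HasDerivAt F (-f x) x) ∧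
      EqOn (F ∘ γ) (tail fun t => f (γ t) * deriv γ t).1 (Ioo 0 1) := by
  obtain ⟨F, hhalf, hF⟩ := exists_primitive_slitHalfPlane hc hf.neg (γ (1 / 2))
    ((tail fun t => f (γ t) * deriv γ t).1 (1 / 2))
  have hderiv (t : ℝ) (ht : t ∈ Ioo (0 : ℝ) 1) :
      HasDerivAt (F ∘ γ) (-(f (γ t) * deriv γ t)) t := by
    rw [← neg_mul]
    exact hγ.hasDerivAt_comp hF ht
  refine ⟨F, hF, isOpen_Ioo.eqOn_of_deriv_eq isPreconnected_Ioo
    (fun t ht => (hderiv t ht).differentiableAt.differentiableWithinAt)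
    (fun t ht => (hasDerivAt_tail hg ht).differentiableAt.differentiableWithinAt)
    (fun t ht => (hderiv t ht).deriv.trans (hasDerivAt_tail hg ht).deriv.symm)
    (x := 1 / 2) (by norm_num) hhalf⟩

lemma exists_interpolates_tail (hc : c < 1) (hγ : GoodPath c γ) (hγ' : GoodPath c γ') {f : ℂ → ℂ}
    (hf : DifferentiableOn ℂ f (slitHalfPlane c))
    (hfgrowth : HasGrowth (between γ γ') Prod.fst 1 2 fun p => f p.2)
    (hg : (fun t => f (γ t) * deriv γ t) ∈ growth (-1) 0)
    (hg' : (fun t => f (γ' t) * deriv γ' t) ∈ growth (-1) 0) :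
    ∃ K, Interpolates c γ γ' K (tail fun t => f (γ t) * deriv γ t)
      (tail fun t => f (γ' t) * deriv γ' t) := by
  obtain ⟨F, hF, hleft⟩ := hγ.exists_primitive_eq_tail hc hf hg
  have hgrowth : HasGrowth (between γ γ') Prod.fst 0 1 fun p => F p.2 := by
    refine ((HasGrowth.sub_between hγ hγ' hF (hfgrowth.trans (isBigO_refl _ _).neg_left)).add
      (eventually_fst_mem_Ioo γ γ') (.fst_between (decay_mem_growth
        (tail fun t => f (γ t) * deriv γ t)))).congr ?_
    filter_upwards [eventually_fst_mem_Ioo γ γ'] with p hp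
    rw [Pi.add_apply, ← hleft hp, Function.comp_apply, sub_add_cancel]
  have hlim : Tendsto (F ∘ γ') (𝓝[<] 1) (𝓝 0) :=
    (hgrowth.comp ((tendsto_right_between γ γ').mono_left le_sup_right)).tendsto_zero_one tendsto_id
  refine ⟨F, fun x hx => (hF x hx).differentiableAt.differentiableWithinAt, hleft,
    (tail_eq_of_hasDerivAt hg' (fun t ht => ?_) hlim).symm, hgrowth⟩
  rw [← neg_mul]
  exact hγ'.hasDerivAt_comp hF ht

/-- The regularised iterated integral of `e_{a₁} ⋯ e_{aₘ} (e_b - e_0) (log x)ⁿ / n!` over the part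
of `γ` after `γ s`, as a function of `s`. -/
def pathTail (γ : ℝ → ℂ) (as : List ℂ) (b : ℂ) (n : ℕ) : Decay :=
  (as.map fun a => op (eForm γ a)).prod (tail (pathLast γ b n))

lemma exists_interpolates_op (hc : 0 < c) (hc1 : c < 1) (hγ : GoodPath c γ) (hγ' : GoodPath c γ')
    {a : ℂ} (ha : IsPole c a) {K : ℂ → ℂ} {k k' : Decay} (hK : Interpolates c γ γ' K k k') :
    ∃ L, Interpolates c γ γ' L (op (eForm γ a) k) (op (eForm γ' a) k') := by
  have heq {δ : ℝ → ℂ} {l : Decay} (hδ : EqOn (K ∘ δ) l.1 (Ioo 0 1)) :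
      EqOn (eForm δ a * l.1) (fun t => (δ t - a)⁻¹ * K (δ t) * deriv δ t) (Ioo 0 1) :=
    fun t ht => by rw [Pi.mul_apply, ← hδ ht, eForm, Function.comp_apply]; ring
  have hγa := hγ.eForm_mem_growth hc ha
  have hγ'a := hγ'.eForm_mem_growth hc ha
  rw [op_apply hγa, op_apply hγ'a, tail_congr (heq hK.left), tail_congr (heq hK.right)]
  refine exists_interpolates_tail hc1 hγ hγ'
    (((differentiableOn_id.sub_const a).inv fun x hx => sub_ne_zero_of_isPole ha hx).mul
      hK.differentiableOn) ?_ (mem_growth_congr (heq hK.left) (mul_decay_mem_growth hγa k))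
    (mem_growth_congr (heq hK.right) (mul_decay_mem_growth hγ'a k'))
  exact ((escapes_between hc hγ hγ').inv_sub hc ha).mul (eventually_fst_mem_Ioo γ γ') hK.hasGrowth

lemma differentiableOn_inv_sub_sub_inv (hc : 0 < c) {a : ℂ} (ha : IsPole c a) :
    DifferentiableOn ℂ (fun x => (x - a)⁻¹ - x⁻¹) (slitHalfPlane c) :=
  ((differentiableOn_id.sub_const a).inv fun _ hx => sub_ne_zero_of_isPole ha hx).sub
    (differentiableOn_inv.mono fun x hx => by simpa using sub_ne_zero_of_isPole (isPole_zero hc) hx)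

lemma differentiableOn_lastCoeff (hc : 0 < c) {b : ℂ} (hb : IsPole c b) (n : ℕ) :
    DifferentiableOn ℂ (lastCoeff b n) (slitHalfPlane c) :=
  (differentiableOn_inv_sub_sub_inv hc hb).mul
    (((differentiableOn_id.clog fun _ hx => Or.inl (hc.trans hx.1)).pow n).div_const _)

lemma exists_interpolates_pathTail (hc : 0 < c) (hc1 : c < 1) (hγ : GoodPath c γ)
    (hγ' : GoodPath c γ') {as : List ℂ} (has : ∀ a ∈ as, IsPole c a) {b : ℂ} (hb : IsPole c b)
    (n : ℕ) : ∃ K, Interpolates c γ γ' K (pathTail γ as b n) (pathTail γ' as b n) := by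
  induction as with
  | nil =>
    exact exists_interpolates_tail hc1 hγ hγ' (differentiableOn_lastCoeff hc hb n)
      (((escapes_between hc hγ hγ').lastCoeff_comp hc hb n).mono (eventually_fst_mem_Ioo γ γ')
        one_le_two le_rfl)
      (growth_anti (by simp) le_rfl (hγ.pathLast_mem_growth hc hb n))
      (growth_anti (by simp) le_rfl (hγ'.pathLast_mem_growth hc hb n))
  | cons a as ih =>
    obtain ⟨K, hK⟩ := ih fun a' ha' => has a' (.tail a ha')
    exact exists_interpolates_op hc hc1 hγ hγ' (has a (.head as)) hK

lemma Interpolates.total_eq (hc : 0 < c) (hc1 : c < 1) (hγ : GoodPath c γ) (hγ' : GoodPath c γ')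
    {a : ℂ} (ha : IsPole c a) {K : ℂ → ℂ} {k k' : Decay} (hK : Interpolates c γ γ' K k k') :
    total (eForm γ a - eForm γ 0) k = total (eForm γ' a - eForm γ' 0) k' := by
  have hIoo := eventually_fst_mem_Ioo γ γ'
  obtain ⟨F, -, hF⟩ := exists_primitive_slitHalfPlane hc1
    ((differentiableOn_inv_sub_sub_inv hc ha).mul hK.differentiableOn) 0 0
  have hgrowth : HasGrowth (between γ γ') Prod.fst 1 1 fun p => F p.2 - F (γ p.1) :=
    (HasGrowth.sub_between hγ hγ' hF
      (((escapes_between hc hγ hγ').inv_sub_sub_inv hc ha).mul hIoo hK.hasGrowth)).mono hIoo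
        (by norm_num) (by norm_num)
  have hlim : Tendsto (fun t => (F ∘ γ') t - (F ∘ γ) t) (𝓝[>] 0 ⊔ 𝓝[<] 1) (𝓝 0) :=
    (hgrowth.tendsto_one_one (tendsto_fst_between γ γ')).comp (tendsto_right_between γ γ')
  have hderiv {δ : ℝ → ℂ} {l : Decay} (hδ : GoodPath c δ) (hl : EqOn (K ∘ δ) l.1 (Ioo 0 1)) (t : ℝ)
      (ht : t ∈ Ioo (0 : ℝ) 1) : HasDerivAt (F ∘ δ) (((eForm δ a - eForm δ 0) * l.1) t) t := by
    convert hδ.hasDerivAt_comp hF ht using 1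
    rw [Pi.mul_apply, ← hl ht, Pi.sub_apply, eForm, eForm, sub_zero, Function.comp_apply,
      Pi.mul_apply]
    ring
  have hInt {δ : ℝ → ℂ} (hδ : GoodPath c δ) (l : Decay) :
      IntervalIntegrable ((eForm δ a - eForm δ 0) * l.1) volume 0 1 :=
    intervalIntegrable_zero_one_of_mem_growth
      (mul_decay_mem_growth_zero (hδ.eForm_sub_mem_growth hc ha) l)
  rw [total_apply (hγ.eForm_sub_mem_growth hc ha), total_apply (hγ'.eForm_sub_mem_growth hc ha),
    eq_comm, ← sub_eq_zero, ← integral_sub (hInt hγ' k') (hInt hγ k),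
    integral_eq_sub_of_hasDerivAt_of_tendsto one_pos
      (fun t ht => (hderiv hγ' hK.right t ht).sub (hderiv hγ hK.left t ht))
      ((hInt hγ' k').sub (hInt hγ k)) (hlim.mono_left le_sup_left) (hlim.mono_left le_sup_right),
    sub_zero]

theorem total_pathTail_eq (hc : 0 < c) (hc1 : c < 1) (hγ : GoodPath c γ) (hγ' : GoodPath c γ')
    {a b : ℂ} {as : List ℂ} (ha : IsPole c a) (has : ∀ a ∈ as, IsPole c a) (hb : IsPole c b)
    (n : ℕ) : total (eForm γ a - eForm γ 0) (pathTail γ as b n) =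
      total (eForm γ' a - eForm γ' 0) (pathTail γ' as b n) := by
  obtain ⟨K, hK⟩ := exists_interpolates_pathTail hc hc1 hγ hγ' has hb n
  exact hK.total_eq hc hc1 hγ hγ' ha

end Between

/-! ### The paths `1 / β` and `η_u` -/

lemma mem_growth_zero_of_continuousOn_Icc {f : ℝ → ℂ} (hf : ContinuousOn f (Icc 0 1)) :
    f ∈ growth 0 0 := by
  obtain ⟨C, hC⟩ := isCompact_Icc.exists_bound_of_continuousOn hf
  exact mem_growth_zero_of_norm_le (hf.mono Ioo_subset_Icc_self)
    fun t ht => hC t (Ioo_subset_Icc_self ht)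

lemma mul_one_sub_zpow_mem_growth (n : ℤ) :
    (fun t : ℝ => ((t * (1 - t) : ℝ) : ℂ) ^ n) ∈ growth n n := by
  refine mem_growth_of_norm_le (C := 1) (J := 0) (fun t ht => ?_) fun t ht => le_of_eq ?_
  · have h := Complex.ofReal_ne_zero.2 (mul_one_sub_pos ht).ne'
    fun_prop (disch := exact Or.inl h)
  · rw [norm_zpow, Complex.norm_real, Real.norm_of_nonneg (mul_one_sub_pos ht).le, mul_zpow, weight,
      pow_zero, mul_one, one_mul]

/-- The angle of `1 - β`. -/
def betaAngle (t : ℝ) : ℝ := 2 * Real.pi * (3 * t ^ 2 - 2 * t ^ 3)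

lemma beta_eq (t : ℝ) :
    β t = 1 - ((1 - t + t ^ 2 : ℝ) : ℂ) * Complex.exp (betaAngle t * Complex.I) := by
  rw [β, betaAngle]
  push_cast
  ring_nf

lemma betaAngle_mem {t : ℝ} (ht : t ∈ Ioo (0 : ℝ) (1 / 2)) : betaAngle t ∈ Ioo 0 Real.pi := by
  have hpos : 0 < t ^ 2 * (3 - 2 * t) := mul_pos (pow_pos ht.1 2) (by linarith [ht.2])
  have hlt : 0 < (1 / 2 - t) * (1 + 2 * t * (1 - t)) :=
    mul_pos (by linarith [ht.2]) (by nlinarith [ht.1, ht.2])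
  have hpi := Real.pi_pos
  rw [betaAngle]
  constructor <;> nlinarith

lemma beta_one_sub (t : ℝ) : β (1 - t) = (starRingEnd ℂ) (β t) := by
  have hangle : (betaAngle (1 - t) : ℂ) * Complex.I =
      (starRingEnd ℂ) (betaAngle t * Complex.I) + 2 * Real.pi * Complex.I := by
    rw [map_mul, Complex.conj_I, Complex.conj_ofReal, betaAngle, betaAngle]
    push_cast
    ring
  rw [beta_eq, beta_eq, hangle, Complex.exp_add, Complex.exp_two_pi_mul_I, mul_one, map_sub,
    Complex.exp_conj, ← Complex.conj_ofReal, ← map_mul, map_one]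
  ring_nf

lemma norm_one_sub_beta (t : ℝ) : ‖1 - β t‖ = 1 - t * (1 - t) := by
  rw [beta_eq, sub_sub_cancel, norm_mul, Complex.norm_exp_ofReal_mul_I, mul_one, Complex.norm_real,
    Real.norm_of_nonneg (by nlinarith [sq_nonneg (t - 1 / 2)])]
  ring

lemma le_norm_beta (t : ℝ) : t * (1 - t) ≤ ‖β t‖ := by
  have h := norm_sub_norm_le (1 : ℂ) (1 - β t)
  rw [norm_one, norm_one_sub_beta, sub_sub_cancel, sub_sub_cancel] at h
  exact h

lemma beta_ne_zero {t : ℝ} (ht : t ∈ Ioo (0 : ℝ) 1) : β t ≠ 0 :=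
  norm_pos_iff.1 ((mul_one_sub_pos ht).trans_le (le_norm_beta t))

lemma norm_beta_sub_le {t : ℝ} (ht : t ∈ Ioo (0 : ℝ) 1) :
    ‖β t - t‖ ≤ (6 * Real.pi + 1) * t ^ 2 := by
  have hangle : ‖betaAngle t‖ ≤ 6 * Real.pi * t ^ 2 := by
    have hfactor : betaAngle t = 2 * Real.pi * t ^ 2 * (3 - 2 * t) := by rw [betaAngle]; ring
    have hpos : 0 ≤ 2 * Real.pi * t ^ 2 := by positivity
    rw [hfactor, Real.norm_of_nonneg (mul_nonneg hpos (by linarith [ht.2]))]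
    nlinarith [ht.1]
  have hexp := (Real.norm_exp_I_mul_ofReal_sub_one_le (x := betaAngle t)).trans hangle
  have heq : β t - t = (1 - t : ℝ) * -(Complex.exp (Complex.I * betaAngle t) - 1) -
      (t ^ 2 : ℝ) * Complex.exp (Complex.I * betaAngle t) := by
    rw [beta_eq, mul_comm Complex.I]
    push_cast
    ring
  rw [heq, add_mul, one_mul]
  refine (norm_sub_le _ _).trans (add_le_add ?_ ?_)
  · rw [norm_mul, norm_neg, Complex.norm_real, Real.norm_of_nonneg (by linarith [ht.2])]
    exact (mul_le_of_le_one_left (norm_nonneg _) (by linarith [ht.1])).trans hexp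
  · rw [norm_mul, Complex.norm_exp_I_mul_ofReal, mul_one, Complex.norm_real,
      Real.norm_of_nonneg (by positivity)]

lemma norm_beta_le {t : ℝ} (ht : t ∈ Ioo (0 : ℝ) 1) :
    ‖β t‖ ≤ (6 * Real.pi + 3) * (t * (1 - t)) := by
  wlog hhalf : t ≤ 1 / 2 generalizing t
  · have h := this (one_sub_mem_Ioo ht) (by linarith)
    rwa [beta_one_sub, RCLike.norm_conj, sub_sub_cancel, mul_comm (1 - t)] at h
  have hnorm : ‖β t‖ ≤ (6 * Real.pi + 1) * t ^ 2 + t := by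
    refine (norm_le_norm_sub_add (β t) t).trans (add_le_add (norm_beta_sub_le ht) ?_)
    rw [Complex.norm_real, Real.norm_of_nonneg ht.1.le]
  have hsq : t ^ 2 ≤ t * (1 - t) := by nlinarith [ht.1]
  nlinarith [Real.pi_pos]

lemma contDiff_beta : ContDiff ℝ 1 β := by
  have hofReal : ContDiff ℝ 1 fun t : ℝ => (t : ℂ) := Complex.ofRealCLM.contDiff
  unfold β
  fun_prop

/-- The path `1 / β`. -/
def invBeta (t : ℝ) : ℂ := (β t)⁻¹

lemma hasDerivAt_invBeta {t : ℝ} (ht : t ∈ Ioo (0 : ℝ) 1) :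
    HasDerivAt invBeta (-deriv β t / β t ^ 2) t :=
  ((contDiff_beta.differentiable one_ne_zero t).hasDerivAt).inv (beta_ne_zero ht)

lemma half_lt_re_invBeta {t : ℝ} (ht : t ∈ Ioo (0 : ℝ) 1) : 1 / 2 < (invBeta t).re := by
  have hnorm : Complex.normSq (1 - β t) < 1 := by
    rw [Complex.normSq_eq_norm_sq, sq_lt_one_iff₀ (norm_nonneg _), norm_one_sub_beta]
    linarith [mul_one_sub_pos ht]
  rw [invBeta, Complex.inv_re, lt_div_iff₀ (Complex.normSq_pos.2 (beta_ne_zero ht))]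
  simp only [Complex.normSq_apply, Complex.sub_re, Complex.sub_im, Complex.one_re,
    Complex.one_im] at hnorm ⊢
  linarith

lemma invBeta_one_sub (t : ℝ) : invBeta (1 - t) = (starRingEnd ℂ) (invBeta t) := by
  rw [invBeta, invBeta, beta_one_sub, map_inv₀]

lemma im_invBeta_pos {t : ℝ} (ht : t ∈ Ioo (0 : ℝ) (1 / 2)) : 0 < (invBeta t).im := by
  have hsin := Real.sin_pos_of_mem_Ioo (betaAngle_mem ht)
  rw [invBeta, Complex.inv_im, beta_eq, Complex.sub_im, Complex.im_ofReal_mul,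
    Complex.exp_ofReal_mul_I_im, Complex.one_im, zero_sub, neg_neg, ← beta_eq]
  exact div_pos (mul_pos (by nlinarith [ht.1, ht.2]) hsin)
    (Complex.normSq_pos.2 (beta_ne_zero ⟨ht.1, by linarith [ht.2]⟩))

lemma im_invBeta_neg {t : ℝ} (ht : t ∈ Ioo (1 / 2 : ℝ) 1) : (invBeta t).im < 0 := by
  have h := im_invBeta_pos (t := 1 - t) ⟨by linarith [ht.2], by linarith [ht.1]⟩
  rwa [invBeta_one_sub, Complex.conj_im, neg_pos] at h

lemma invBeta_half : invBeta (1 / 2) = 4 / 7 := by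
  have hangle : betaAngle (1 / 2) = Real.pi := by rw [betaAngle]; ring
  rw [invBeta, beta_eq, hangle, Complex.exp_pi_mul_I]
  push_cast
  norm_num

lemma invBeta_mem_slitHalfPlane {c t : ℝ} (hc : c ≤ 1 / 2) (ht : t ∈ Ioo (0 : ℝ) 1) :
    invBeta t ∈ slitHalfPlane c := by
  have hre := hc.trans_lt (half_lt_re_invBeta ht)
  rcases lt_trichotomy t (1 / 2) with hlt | rfl | hgt
  · exact mem_slitHalfPlane_of_im_ne_zero hre (im_invBeta_pos ⟨ht.1, hlt⟩).ne'
  · exact mem_slitHalfPlane_of_re_lt_one hre (by rw [invBeta_half]; norm_num)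
  · exact mem_slitHalfPlane_of_im_ne_zero hre (im_invBeta_neg ⟨hgt, ht.2⟩).ne

lemma le_norm_invBeta_sub_one {t : ℝ} (ht : t ∈ Ioo (0 : ℝ) 1) : 3 / 8 ≤ ‖invBeta t - 1‖ := by
  have heq : invBeta t - 1 = (1 - β t) / β t := by
    rw [invBeta, sub_div, div_self (beta_ne_zero ht), one_div]
  have hle : t * (1 - t) ≤ 1 / 4 := by nlinarith [sq_nonneg (t - 1 / 2)]
  have hnorm : ‖β t‖ ≤ 2 := by
    have h := norm_sub_le (1 : ℂ) (1 - β t)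
    rw [sub_sub_cancel, norm_one, norm_one_sub_beta] at h
    linarith [mul_one_sub_pos ht]
  rw [heq, norm_div, norm_one_sub_beta, le_div_iff₀ (norm_pos_iff.2 (beta_ne_zero ht))]
  linarith

lemma invBeta_mem_growth : invBeta ∈ growth (-1) (-1) := by
  refine mem_growth_of_norm_le (C := 1) (J := 0)
    (contDiff_beta.continuous.continuousOn.inv₀ fun t ht => beta_ne_zero ht) fun t ht => ?_
  rw [invBeta, norm_inv, weight, pow_zero, mul_one, one_mul, zpow_neg_one, zpow_neg_one, ← mul_inv]
  exact inv_anti₀ (mul_one_sub_pos ht) (le_norm_beta t)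

lemma goodPath_invBeta {c : ℝ} (hc : c ≤ 1 / 2) : GoodPath c invBeta where
  mem _ := invBeta_mem_slitHalfPlane hc
  differentiableAt _ ht := (hasDerivAt_invBeta ht).differentiableAt
  far := ⟨3 / 8, by norm_num, fun _ => le_norm_invBeta_sub_one⟩
  mem_growth := invBeta_mem_growth
  inv_mem_growth := by
    refine mem_growth_of_norm_le (C := 6 * Real.pi + 3) (J := 0)
      (continuousOn_of_mem_growth invBeta_mem_growth |>.inv₀ fun t ht =>
        inv_ne_zero (beta_ne_zero ht)) fun t ht => ?_
    simpa [invBeta, weight] using norm_beta_le ht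
  deriv_mem_growth := by
    have hderiv := neg_mem (mem_growth_zero_of_continuousOn_Icc
      (contDiff_beta.continuous_deriv le_rfl).continuousOn)
    refine mem_growth_congr (fun t ht => ?_)
      (mul_mem_growth hderiv (mul_mem_growth invBeta_mem_growth invBeta_mem_growth))
    rw [(hasDerivAt_invBeta ht).deriv, div_eq_mul_inv, sq, mul_inv]
    rfl
  im_pos := by
    filter_upwards [Ioo_mem_nhdsGT one_half_pos] with t using im_invBeta_pos
  im_neg := by
    filter_upwards [Ioo_mem_nhdsLT one_half_lt_one] with t using im_invBeta_neg

lemma eta_eq (u : ℂ) (t : ℝ) : eta u t = u / 2 + ((t⁻¹ - (1 - t)⁻¹ : ℝ) : ℂ) * Complex.I := by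
  rw [eta, mul_comm]
  push_cast
  rfl

lemma eta_re (u : ℂ) (t : ℝ) : (eta u t).re = u.re / 2 := by
  rw [eta_eq, Complex.add_re, Complex.re_ofReal_mul, Complex.I_re, mul_zero, add_zero,
    Complex.div_ofNat_re]

lemma eta_im (u : ℂ) (t : ℝ) : (eta u t).im = u.im / 2 + (t⁻¹ - (1 - t)⁻¹) := by
  rw [eta_eq, Complex.add_im, Complex.im_ofReal_mul, Complex.I_im, mul_one, Complex.div_ofNat_im]

lemma hasDerivAt_eta (u : ℂ) {t : ℝ} (ht : t ∈ Ioo (0 : ℝ) 1) :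
    HasDerivAt (eta u)
      (-((t : ℂ) ^ 2 + (1 - t) ^ 2) * Complex.I * ((t * (1 - t) : ℝ) : ℂ) ^ (-2 : ℤ)) t := by
  have h0 := ht.1.ne'
  have h1 := (sub_pos.2 ht.2).ne'
  have h := ((((hasDerivAt_id t).inv h0).sub
    (((hasDerivAt_id t).const_sub 1).inv h1)).ofReal_comp.mul_const Complex.I).const_add (u / 2)
  refine (h.congr_of_eventuallyEq (.of_eq (funext (eta_eq u)))).congr_deriv ?_
  have h0' : (t : ℂ) ≠ 0 := Complex.ofReal_ne_zero.2 h0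
  have h1' : (1 - t : ℂ) ≠ 0 := by exact_mod_cast h1
  push_cast
  simp only [id]
  field_simp
  ring

/-- The product of `η_u` and `t (1 - t)`. -/
def etaNumerator (u : ℂ) (t : ℝ) : ℂ :=
  (t * (1 - t) : ℝ) * (u / 2) + (1 - 2 * t : ℝ) * Complex.I

lemma eta_eq_etaNumerator (u : ℂ) {t : ℝ} (ht : t ∈ Ioo (0 : ℝ) 1) :
    eta u t = etaNumerator u t * ((t * (1 - t) : ℝ) : ℂ) ^ (-1 : ℤ) := by
  have h0 : (t : ℂ) ≠ 0 := Complex.ofReal_ne_zero.2 ht.1.ne'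
  have h1 : (1 - t : ℂ) ≠ 0 := by exact_mod_cast (sub_pos.2 ht.2).ne'
  rw [eta_eq, etaNumerator, zpow_neg_one]
  push_cast
  field_simp
  ring

lemma continuous_etaNumerator (u : ℂ) : Continuous (etaNumerator u) := by
  unfold etaNumerator
  fun_prop

lemma etaNumerator_ne_zero {u : ℂ} (hu : 0 < u.re) (t : ℝ) : etaNumerator u t ≠ 0 := fun h => by
  have hre := congrArg Complex.re h
  have him := congrArg Complex.im h
  simp only [etaNumerator, Complex.add_re, Complex.add_im, Complex.re_ofReal_mul,
    Complex.im_ofReal_mul, Complex.I_re, Complex.I_im, Complex.div_ofNat_re, Complex.zero_re,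
    Complex.zero_im, mul_zero, add_zero, mul_one] at hre him
  have ht : t * (1 - t) = 0 := (mul_eq_zero.1 hre).resolve_right (by positivity)
  rw [ht] at him
  nlinarith

lemma eta_mem_growth (u : ℂ) : eta u ∈ growth (-1) (-1) :=
  mem_growth_congr (fun _ ht => (eta_eq_etaNumerator u ht).symm) (mul_mem_growth
    (mem_growth_zero_of_continuousOn_Icc (continuous_etaNumerator u).continuousOn)
    (mul_one_sub_zpow_mem_growth (-1)))

lemma inv_eta_mem_growth {u : ℂ} (hu : 0 < u.re) : (eta u)⁻¹ ∈ growth 1 1 :=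
  mem_growth_congr (fun t ht => by simp [eta_eq_etaNumerator u ht, mul_comm]) (mul_mem_growth
    (mem_growth_zero_of_continuousOn_Icc ((continuous_etaNumerator u).continuousOn.inv₀
      fun t _ => etaNumerator_ne_zero hu t)) (mul_one_sub_zpow_mem_growth 1))

lemma deriv_eta_mem_growth (u : ℂ) : deriv (eta u) ∈ growth (-2) (-2) := by
  refine mem_growth_congr (fun t ht => (hasDerivAt_eta u ht).deriv.symm) (mul_mem_growth
    (mem_growth_zero_of_continuousOn_Icc ?_) (mul_one_sub_zpow_mem_growth (-2)))
  fun_prop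

lemma tendsto_im_eta_zero (u : ℂ) : Tendsto (fun t => (eta u t).im) (𝓝[>] 0) atTop := by
  simp only [eta_im, sub_eq_add_neg, ← add_assoc]
  refine (tendsto_atTop_add_const_left _ _ tendsto_inv_nhdsGT_zero).atTop_add (C := -(1 - 0)⁻¹) ?_
  refine ContinuousAt.tendsto (f := fun t : ℝ => -(1 - t)⁻¹) ?_ |>.mono_left nhdsWithin_le_nhds
  fun_prop (disch := norm_num)

lemma tendsto_im_eta_one (u : ℂ) : Tendsto (fun t => (eta u t).im) (𝓝[<] 1) atBot := by
  have h : (fun t => (eta u t).im) = (fun t => -(eta (-u) t).im) ∘ fun t => 1 - t := by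
    funext t
    rw [Function.comp_apply, eta_im, eta_im, sub_sub_cancel, Complex.neg_im]
    ring
  rw [h]
  exact (tendsto_neg_atTop_atBot.comp (tendsto_im_eta_zero (-u))).comp tendsto_one_sub_nhdsLT_one

lemma goodPath_eta {c : ℝ} {u : ℂ} (hc0 : 0 < c) (hc : c < u.re / 2) (hu : u.re / 2 < 1) :
    GoodPath c (eta u) where
  mem t _ := mem_slitHalfPlane_of_re_lt_one (by rwa [eta_re]) (by rwa [eta_re])
  differentiableAt _ ht := (hasDerivAt_eta u ht).differentiableAt
  far := by
    refine ⟨1 - u.re / 2, sub_pos.2 hu, fun t _ => ?_⟩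
    rw [norm_sub_rev, ← eta_re u t, ← Complex.one_re, ← Complex.sub_re]
    exact Complex.re_le_norm _
  mem_growth := eta_mem_growth u
  inv_mem_growth := inv_eta_mem_growth (by linarith)
  deriv_mem_growth := deriv_eta_mem_growth u
  im_pos := (tendsto_im_eta_zero u).eventually_gt_atTop 0
  im_neg := (tendsto_im_eta_one u).eventually_lt_atBot 0

/-! ### Words ending in powers of a closed form -/

lemma iterInt_append_eq_sum {ι : Type*} (S : Finset ι) (c : ι → ℂ) {w : List (ℝ → ℂ)}
    {w' : ι → List (ℝ → ℂ)} {b : ℝ} (hb : b ∈ Ioo (0 : ℝ) 1)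
    (hw' : ∀ j ∈ S, ∀ φ ∈ w' j, ContinuousOn φ (Ioo 0 1))
    (h : ∀ s ∈ Ioo (0 : ℝ) 1, iterInt w s b = ∑ j ∈ S, c j * iterInt (w' j) s b)
    {q : List (ℝ → ℂ)} (hq : ∀ φ ∈ q, ContinuousOn φ (Ioo 0 1)) :
    ∀ s ∈ Ioo (0 : ℝ) 1, iterInt (q ++ w) s b = ∑ j ∈ S, c j * iterInt (q ++ w' j) s b := by
  induction q with
  | nil => exact h
  | cons φ q ih =>
    obtain ⟨hφ, hq⟩ := List.forall_mem_cons.1 hq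
    intro s hs
    have hInt : ∀ j ∈ S, IntervalIntegrable
        (fun t => c j * (φ t * iterInt (q ++ w' j) t b)) volume s b := fun j hj => by
      refine (intervalIntegrable_of_continuousOn_Ioo
        (hφ.mul (continuousOn_iterInt (fun ψ hψ => ?_) hb)) hs hb).const_mul _
      exact (List.mem_append.1 hψ).elim (hq ψ) (hw' j hj ψ)
    calc iterInt (φ :: (q ++ w)) s b
        = ∫ t in s..b, ∑ j ∈ S, c j * (φ t * iterInt (q ++ w' j) t b) :=
          integral_congr fun t ht => by
            rw [ih hq t (ordConnected_Ioo.uIcc_subset hs hb ht), Finset.mul_sum]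
            exact Finset.sum_congr rfl fun j _ => mul_left_comm _ _ _
      _ = ∑ j ∈ S, c j * iterInt (φ :: q ++ w' j) s b := by
          rw [intervalIntegral.integral_finsetSum hInt]
          simp only [intervalIntegral.integral_const_mul, List.cons_append, iterInt]

lemma add_pow_div_factorial (x y : ℂ) (n : ℕ) :
    (x + y) ^ n / n.factorial =
      ∑ j ∈ Finset.range (n + 1), y ^ (n - j) / (n - j).factorial * (x ^ j / j.factorial) := by
  rw [add_pow, Finset.sum_div]
  refine Finset.sum_congr rfl fun j hj => ?_
  rw [Nat.cast_choose ℂ (Nat.lt_succ_iff.1 (Finset.mem_range.1 hj))]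
  have := n.factorial_ne_zero
  field_simp

section

variable {ℓ e φ : ℝ → ℂ}

lemma iterInt_replicate (he : ContinuousOn e (Ioo 0 1))
    (hℓ : ∀ t ∈ Ioo (0 : ℝ) 1, HasDerivAt ℓ (-e t) t) {b : ℝ} (hb : b ∈ Ioo (0 : ℝ) 1) (n : ℕ) :
    ∀ s ∈ Ioo (0 : ℝ) 1, iterInt (List.replicate n e) s b = (ℓ s - ℓ b) ^ n / n.factorial := by
  induction n with
  | zero => simp [iterInt]
  | succ n ih =>
    intro s hs
    have hsub := ordConnected_Ioo.uIcc_subset hs hb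
    have hd : ∀ t ∈ uIcc s b, HasDerivAt
        (fun t => -((ℓ t - ℓ b) ^ (n + 1) / (n + 1).factorial))
        (e t * iterInt (List.replicate n e) t b) t := fun t ht => by
      refine (((((hℓ t (hsub ht)).sub_const (ℓ b)).pow (n + 1)).div_const _).neg).congr_deriv ?_
      rw [ih t (hsub ht), Nat.factorial_succ]
      have := n.factorial_ne_zero
      push_cast
      field_simp
    rw [List.replicate_succ, iterInt, integral_eq_sub_of_hasDerivAt hd
      (intervalIntegrable_of_continuousOn_Ioo (he.mul (continuousOn_iterInt
        (fun ψ hψ => List.eq_of_mem_replicate hψ ▸ he) hb)) hs hb)]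
    simp

lemma iterInt_cons_replicate (he : ContinuousOn e (Ioo 0 1))
    (hℓ : ∀ t ∈ Ioo (0 : ℝ) 1, HasDerivAt ℓ (-e t) t) (hφ : ContinuousOn φ (Ioo 0 1)) {s b : ℝ}
    (hs : s ∈ Ioo (0 : ℝ) 1) (hb : b ∈ Ioo (0 : ℝ) 1) (n : ℕ) :
    iterInt (φ :: List.replicate n e) s b = ∑ j ∈ Finset.range (n + 1),
      (-ℓ b) ^ (n - j) / (n - j).factorial *
        iterInt [fun t => φ t * (ℓ t ^ j / j.factorial)] s b := by
  have hℓc : ContinuousOn ℓ (Ioo 0 1) := fun t ht => (hℓ t ht).continuousAt.continuousWithinAt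
  have hInt : ∀ j ∈ Finset.range (n + 1), IntervalIntegrable (fun t =>
      (-ℓ b) ^ (n - j) / (n - j).factorial * (φ t * (ℓ t ^ j / j.factorial))) volume s b :=
    fun j _ => (intervalIntegrable_of_continuousOn_Ioo
      (hφ.mul ((hℓc.pow j).div_const _)) hs hb).const_mul _
  calc iterInt (φ :: List.replicate n e) s b
      = ∫ t in s..b, ∑ j ∈ Finset.range (n + 1),
          (-ℓ b) ^ (n - j) / (n - j).factorial * (φ t * (ℓ t ^ j / j.factorial)) :=
        integral_congr fun t ht => by
          simp only [iterInt_replicate he hℓ hb n t (ordConnected_Ioo.uIcc_subset hs hb ht),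
            sub_eq_add_neg (ℓ t), add_pow_div_factorial, Finset.mul_sum, mul_left_comm (φ t)]
    _ = _ := by
        rw [intervalIntegral.integral_finsetSum hInt]
        simp only [intervalIntegral.integral_const_mul, iterInt, mul_one]

/-- Since `-ℓ (1 - z)` has regularized value `0`, only the top power of `ℓ` survives. -/
lemma isRegValue_append_replicate (he : ContinuousOn e (Ioo 0 1))
    (hℓ : ∀ t ∈ Ioo (0 : ℝ) 1, HasDerivAt ℓ (-e t) t) (hφ : ContinuousOn φ (Ioo 0 1))
    (hend : IsRegValue (fun z => -ℓ (1 - z)) 0) {q : List (ℝ → ℂ)}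
    (hq : ∀ φ ∈ q, ContinuousOn φ (Ioo 0 1)) {v : ℕ → ℂ}
    (hv : ∀ n, IsRegValue
      (fun z => iterInt (q ++ [fun t => φ t * (ℓ t ^ n / n.factorial)]) z (1 - z)) (v n)) (n : ℕ) :
    IsRegValue (fun z => iterInt (q ++ φ :: List.replicate n e) z (1 - z)) (v n) := by
  have hℓc : ContinuousOn ℓ (Ioo 0 1) := fun t ht => (hℓ t ht).continuousAt.continuousWithinAt
  have hsum : IsRegValue (fun z => ∑ j ∈ Finset.range (n + 1),
      (-ℓ (1 - z)) ^ (n - j) / (n - j).factorial *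
        iterInt (q ++ [fun t => φ t * (ℓ t ^ j / j.factorial)]) z (1 - z))
      (∑ j ∈ Finset.range (n + 1), 0 ^ (n - j) / ((n - j).factorial : ℂ) * v j) := by
    simp only [div_eq_inv_mul]
    exact IsRegValue.sum _ fun j _ =>
      ((hend.pow (n - j)).const_mul _).mul (by simpa only [div_eq_inv_mul] using hv j)
  have htop : ∑ j ∈ Finset.range (n + 1), 0 ^ (n - j) / ((n - j).factorial : ℂ) * v j = v n := by
    rw [Finset.sum_range_succ, Finset.sum_eq_zero fun j hj => ?_]
    · simp
    · rw [zero_pow (Nat.sub_ne_zero_of_lt (Finset.mem_range.1 hj)), zero_div, zero_mul]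
  rw [htop] at hsum
  refine hsum.congr ?_
  filter_upwards [eventually_mem_Icc_one_sub] with z ⟨hz, hzb⟩
  have hz1 := mem_Ioo_of_mem_Icc_one_sub hz hzb
  have hb1 := one_sub_mem_Ioo hz1
  refine (iterInt_append_eq_sum _ _ hb1 (fun j _ ψ hψ => ?_)
    (fun s hs => iterInt_cons_replicate he hℓ hφ hs hb1 n) hq z hz1).symm
  exact List.mem_singleton.1 hψ ▸ hφ.mul ((hℓc.pow j).div_const _)

end

/-! ### Forms along `β` -/

lemma eForm_invBeta (a : ℂ) {t : ℝ} (ht : t ∈ Ioo (0 : ℝ) 1) :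
    eForm invBeta a t = -deriv β t / β t ^ 2 / ((β t)⁻¹ - a) := by
  rw [eForm, (hasDerivAt_invBeta ht).deriv, invBeta]

lemma eForm_beta_zero : EqOn (-eForm invBeta 0) (eForm β 0) (Ioo 0 1) := fun t ht => by
  have h := beta_ne_zero ht
  rw [Pi.neg_apply, eForm_invBeta 0 ht, eForm]
  field_simp
  simp

/-- The logarithm of `1 / β`. -/
def logInvBeta (t : ℝ) : ℂ := Complex.log (invBeta t)

lemma hasDerivAt_logInvBeta {t : ℝ} (ht : t ∈ Ioo (0 : ℝ) 1) :
    HasDerivAt logInvBeta (-eForm β 0 t) t := by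
  refine ((hasDerivAt_invBeta ht).clog_real
    (Or.inl (one_half_pos.trans (half_lt_re_invBeta ht)))).congr_deriv ?_
  rw [← eForm_beta_zero ht, Pi.neg_apply, neg_neg, eForm_invBeta 0 ht, sub_zero, invBeta]

lemma isBigO_mul_invBeta_one_sub :
    (fun z : ℝ => z * invBeta (1 - z) - 1) =O[𝓝[>] (0 : ℝ)] fun z : ℝ => z := by
  refine IsBigO.of_bound ((6 * Real.pi + 1) * 2) ?_
  filter_upwards [Ioo_mem_nhdsGT one_half_pos] with z hz
  have hz1 : z ∈ Ioo (0 : ℝ) 1 := ⟨hz.1, by linarith [hz.2]⟩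
  have hβ := beta_ne_zero hz1
  have hconj : z * invBeta (1 - z) - 1 = (starRingEnd ℂ) ((z - β z) / β z) := by
    rw [sub_div, div_self hβ, div_eq_mul_inv, map_sub, map_mul, map_one, Complex.conj_ofReal,
      invBeta_one_sub, invBeta]
  rw [hconj, RCLike.norm_conj, norm_div, norm_sub_rev, div_le_iff₀ (norm_pos_iff.2 hβ),
    Real.norm_of_nonneg hz.1.le]
  calc ‖β z - z‖ ≤ (6 * Real.pi + 1) * z ^ 2 := norm_beta_sub_le hz1
    _ ≤ (6 * Real.pi + 1) * 2 * z * (z * (1 - z)) := by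
        have : z ^ 2 ≤ 2 * z * (z * (1 - z)) := by nlinarith [hz.1, hz.2, sq_nonneg z]
        nlinarith [Real.pi_pos]
    _ ≤ _ := mul_le_mul_of_nonneg_left (le_norm_beta z)
        (mul_nonneg (by positivity) hz.1.le)

/-- The tangent vector of `β` at its end point has length one, so `log (1 / β)` regularizes
to `0` there. -/
lemma isRegValue_logInvBeta : IsRegValue (fun z => -logInvBeta (1 - z)) 0 := by
  refine ⟨Polynomial.X, 0, ?_, by simp⟩
  simp only [pow_zero, mul_one, Polynomial.eval_X]
  have hlim : Tendsto (fun z : ℝ => (z : ℂ) * invBeta (1 - z)) (𝓝[>] 0) (𝓝 1) := by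
    simpa using (isBigO_mul_invBeta_one_sub.trans_tendsto
      (tendsto_id'.2 nhdsWithin_le_nhds)).add_const 1
  have hlog : (fun w : ℂ => Complex.log w - Complex.log 1) =O[𝓝 1] fun w => w - 1 :=
    (Complex.hasDerivAt_log (by simp)).hasFDerivAt.isBigO_sub
  refine ((hlog.comp_tendsto hlim).trans isBigO_mul_invBeta_one_sub).neg_left.congr' ?_
    EventuallyEq.rfl
  filter_upwards [Ioo_mem_nhdsGT one_pos] with z hz
  have hne : invBeta (1 - z) ≠ 0 := inv_ne_zero (beta_ne_zero (one_sub_mem_Ioo hz))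
  simp only [Function.comp, Complex.log_one, sub_zero, logInvBeta,
    Complex.log_ofReal_mul hz.1 hne]
  ring

section

variable {c : ℝ} {u z : ℂ}

lemma eQuot_beta (hc : c ≤ 1 / 2) (hu : u ≠ 0) (hz : IsPole c (z / u)) :
    EqOn (eForm invBeta (z / u) - eForm invBeta 0) (eQuot β u z) (Ioo 0 1) := fun t ht => by
  rcases eq_or_ne z 0 with rfl | hz0
  · rw [zero_div, sub_self, eQuot, if_pos rfl]
  have hβ := beta_ne_zero ht
  have hne := (goodPath_invBeta hc).sub_ne_zero hz ht
  have hinv : (β t)⁻¹ - z / u = (u - z * β t) / (β t * u) := by field_simp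
  have hβu : u - z * β t ≠ 0 := fun h => hne (by rw [invBeta, hinv, h, zero_div])
  have hβu' : u - β t * z ≠ 0 := by rwa [mul_comm]
  have hsub : β t - u / z = -(u - z * β t) / z := by field_simp; ring
  rw [Pi.sub_apply, eForm_invBeta _ ht, eForm_invBeta _ ht, eQuot, if_neg hz0, eForm, hinv, hsub]
  field_simp
  ring

lemma eQuot_one (u : ℂ) : eQuot β u 1 = eForm β u := by rw [eQuot, if_neg one_ne_zero, div_one]

lemma eForm_beta_zero_mem_growth (hc0 : 0 < c) (hc : c ≤ 1 / 2) :
    eForm β 0 ∈ growth (-1) (-1) :=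
  mem_growth_congr eForm_beta_zero
    (neg_mem ((goodPath_invBeta hc).eForm_mem_growth hc0 (isPole_zero hc0)))

lemma eQuot_beta_mem_growth (hc0 : 0 < c) (hc : c ≤ 1 / 2) (hu : u ≠ 0) (hz : IsPole c (z / u)) :
    eQuot β u z ∈ growth 0 0 :=
  mem_growth_congr (eQuot_beta hc hu hz) ((goodPath_invBeta hc).eForm_sub_mem_growth hc0 hz)

lemma op_eForm_beta_zero (hc0 : 0 < c) (hc : c ≤ 1 / 2) :
    op (eForm β 0) = -op (eForm invBeta 0) :=
  (op_congr eForm_beta_zero).symm.trans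
    (op_neg ((goodPath_invBeta hc).eForm_mem_growth hc0 (isPole_zero hc0)))

lemma op_eQuot_beta (hc0 : 0 < c) (hc : c ≤ 1 / 2) (hu : u ≠ 0) (hz : IsPole c (z / u)) :
    op (eQuot β u z) = op (eForm invBeta (z / u)) - op (eForm invBeta 0) :=
  (op_congr (eQuot_beta hc hu hz)).symm.trans
    (op_sub ((goodPath_invBeta hc).eForm_mem_growth hc0 hz)
      ((goodPath_invBeta hc).eForm_mem_growth hc0 (isPole_zero hc0)))

lemma eForm_beta_mul_logInvBeta (hc : c ≤ 1 / 2) (hu : u ≠ 0) (h1 : IsPole c (1 / u)) (n : ℕ) :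
    EqOn (pathLast invBeta (1 / u) n)
      (fun t => eForm β u t * (logInvBeta t ^ n / n.factorial)) (Ioo 0 1) := fun t ht => by
  beta_reduce
  rw [pathLast_eq, ← eQuot_one, ← eQuot_beta hc hu h1 ht, Pi.sub_apply, logInvBeta]

end

/-! ### Words of arrays -/

/-- The word `a(z₁) e^{k₁-1} ⋯ a(z_r) e^{k_r-1}` of the array `(z₁, …, z_r; k₁, …, k_r)`. The
letters can be forms, poles or operators. -/
def arrayWord {A : Type*} (e : A) (a : ℂ → A) (w : List (ℂ × ℕ)) : List A :=
  w.flatMap fun p => a p.1 :: List.replicate (p.2 - 1) e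

section

variable {A B : Type*} {e : A} {a a' : ℂ → A} {w : List (ℂ × ℕ)}

lemma map_arrayWord (F : A → B) :
    (arrayWord e a w).map F = arrayWord (F e) (fun z => F (a z)) w := by
  simp only [arrayWord, List.map_flatMap, List.map_cons, List.map_replicate]

lemma forall_mem_arrayWord {P : A → Prop} (he : P e) (ha : ∀ p ∈ w, P (a p.1)) :
    ∀ x ∈ arrayWord e a w, P x := fun x hx => by
  obtain ⟨p, hp, hx⟩ := List.mem_flatMap.1 hx
  rcases List.mem_cons.1 hx with rfl | hx
  · exact ha p hp
  · exact List.eq_of_mem_replicate hx ▸ he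

lemma arrayWord_congr (h : ∀ p ∈ w, a p.1 = a' p.1) : arrayWord e a w = arrayWord e a' w :=
  List.flatMap_congr fun p hp => by rw [h p hp]

lemma tail_arrayWord_append_replicate (hw : w ≠ []) (n : ℕ) (z : ℂ) :
    (arrayWord e a (w ++ List.replicate n (z, 1))).tail =
      (arrayWord e a w).tail ++ List.replicate n (a z) := by
  obtain ⟨p, v, rfl⟩ := List.exists_cons_of_ne_nil hw
  have hz : arrayWord e a (List.replicate n (z, 1)) = List.replicate n (a z) := by
    induction n with
    | zero => rfl
    | succ n ih => exact congrArg (a z :: ·) ih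
  rw [← hz, arrayWord, List.flatMap_append, List.tail_append_of_ne_nil (by simp)]
  rfl

lemma length_arrayWord (hw : ∀ p ∈ w, 1 ≤ p.2) :
    (arrayWord e a w).length = (w.map Prod.snd).sum := by
  rw [arrayWord, List.length_flatMap]
  exact congrArg List.sum (List.map_congr_left fun p hp => by
    rw [List.length_cons, List.length_replicate, Nat.sub_add_cancel (hw p hp)])

end

/-! ### Regularized integrals along `β` -/

lemma IsAdmissible.re_le_one {Q : Finset ℂ} (hQ : IsAdmissible Q) {u : ℂ} (hu : u ∈ Q)
    (hu0 : u ≠ 0) : u.re ≤ 1 := by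
  rcases eq_or_ne u 1 with rfl | h
  · rw [Complex.one_re]
  · have hlt := hQ.re_div_lt u hu 1 hQ.one_mem one_ne_zero h
    rw [div_one, Complex.one_re] at hlt
    linarith [hQ.re_pos u hu hu0]

lemma IsAdmissible.exists_isPole {Q : Finset ℂ} (hQ : IsAdmissible Q) {u : ℂ} (hu : u ∈ Q)
    (hu0 : u ≠ 0) : ∃ c : ℝ, 0 < c ∧ c < u.re / 2 ∧ ∀ z ∈ Q, IsPole c (z / u) := by
  have hpole : ∀ᶠ c in 𝓝[<] (u.re / 2), ∀ z ∈ Q, IsPole c (z / u) := by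
    refine (Filter.eventually_all_finset Q).2 fun z hz => ?_
    rcases eq_or_ne z u with rfl | h
    · exact Eventually.of_forall fun c => Or.inr (div_self hu0)
    · have hlt : (z / u).re < u.re / 2 := by linarith [hQ.re_div_lt z hz u hu hu0 h]
      filter_upwards [Ioo_mem_nhdsLT hlt] with c hc using Or.inl hc.1
  obtain ⟨c, hc, hc0, hcu⟩ :=
    (hpole.and (Ioo_mem_nhdsLT (half_pos (hQ.re_pos u hu hu0)))).exists
  exact ⟨c, hc0, hcu, hc⟩

section

variable {c : ℝ} {u : ℂ}

lemma forall_mem_arrayWord_beta (hc0 : 0 < c) (hc : c ≤ 1 / 2) (hu : u ≠ 0)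
    {w : List (ℂ × ℕ)} (hw : ∀ p ∈ w, IsPole c (p.1 / u)) :
    ∀ ψ ∈ arrayWord (eForm β 0) (eQuot β u) w, ψ ∈ growth (-1) (-1) :=
  forall_mem_arrayWord (eForm_beta_zero_mem_growth hc0 hc) fun p hp =>
    growth_anti (by norm_num) (by norm_num) (eQuot_beta_mem_growth hc0 hc hu (hw p hp))

lemma map_op_arrayWord_beta (hc0 : 0 < c) (hc : c ≤ 1 / 2) (hu : u ≠ 0)
    {w : List (ℂ × ℕ)} (hw : ∀ p ∈ w, IsPole c (p.1 / u)) :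
    (arrayWord (eForm β 0) (eQuot β u) w).map op =
      arrayWord (-op (eForm invBeta 0))
        (fun z => op (eForm invBeta (z / u)) - op (eForm invBeta 0)) w := by
  rw [map_arrayWord, op_eForm_beta_zero hc0 hc]
  exact arrayWord_congr fun p hp => op_eQuot_beta hc0 hc hu (hw p hp)

lemma eForm_beta_mem_growth (hc0 : 0 < c) (hc : c ≤ 1 / 2) (hu : u ≠ 0)
    (h1 : IsPole c (1 / u)) : eForm β u ∈ growth 0 0 :=
  eQuot_one u ▸ eQuot_beta_mem_growth hc0 hc hu h1

lemma isRegValue_rsWord (hc0 : 0 < c) (hc : c ≤ 1 / 2) (hu : u ≠ 0) (h1 : IsPole c (1 / u))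
    {p : ℂ × ℕ} {v : List (ℂ × ℕ)} (hw : ∀ q ∈ p :: v, IsPole c (q.1 / u)) (n : ℕ) :
    IsRegValue (fun z => iterInt (rsWord u (p :: v) n) z (1 - z))
      (total (eForm invBeta (p.1 / u) - eForm invBeta 0)
        ((arrayWord (-op (eForm invBeta 0))
          (fun z => op (eForm invBeta (z / u)) - op (eForm invBeta 0)) (p :: v)).tail.prod
            (tail (pathLast invBeta (1 / u) n)))) := by
  have hγ := goodPath_invBeta hc
  have hp := hw p List.mem_cons_self
  have hψ := forall_mem_arrayWord_beta hc0 hc hu hw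
  refine isRegValue_append_replicate (q := arrayWord (eForm β 0) (eQuot β u) (p :: v))
    (v := fun n => total _ (List.prod (α := Module.End ℂ Decay) _
      (tail (pathLast invBeta (1 / u) n))))
    (continuousOn_of_mem_growth (eForm_beta_zero_mem_growth hc0 hc))
    (fun t ht => hasDerivAt_logInvBeta ht)
    (continuousOn_of_mem_growth (eForm_beta_mem_growth hc0 hc hu h1)) isRegValue_logInvBeta
    (fun ψ h => continuousOn_of_mem_growth (hψ ψ h)) (fun n => ?_) n
  have hlast := eForm_beta_mul_logInvBeta hc hu h1 n
  rw [← map_op_arrayWord_beta hc0 hc hu hw, ← List.map_tail, total_congr (eQuot_beta hc hu hp),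
    tail_congr hlast]
  exact isRegValue_iterInt (eQuot_beta_mem_growth hc0 hc hu hp)
    (fun ψ h => hψ ψ (List.mem_of_mem_tail h))
    (growth_anti (by norm_num) le_rfl (mem_growth_congr hlast (hγ.pathLast_mem_growth hc0 h1 n)))

lemma regExists_rsWord_nil (hc0 : 0 < c) (hc : c ≤ 1 / 2) (hu : u ≠ 0) (h1 : IsPole c (1 / u))
    (n : ℕ) : RegExists (rsWord u [] n) := by
  have hval := fun n => isRegValue_iterInt_singleton
    (mem_growth_congr (eForm_beta_mul_logInvBeta hc hu h1 n)
      ((goodPath_invBeta hc).pathLast_mem_growth hc0 h1 n))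
  exact (isRegValue_append_replicate (q := [])
    (continuousOn_of_mem_growth (eForm_beta_zero_mem_growth hc0 hc))
    (fun t ht => hasDerivAt_logInvBeta ht)
    (continuousOn_of_mem_growth (eForm_beta_mem_growth hc0 hc hu h1)) isRegValue_logInvBeta
    (fun ψ h => absurd h List.not_mem_nil) hval n).regExists

lemma regExists_rsWord (hc0 : 0 < c) (hc : c ≤ 1 / 2) (hu : u ≠ 0) (h1 : IsPole c (1 / u))
    {w : List (ℂ × ℕ)} (hw : ∀ q ∈ w, IsPole c (q.1 / u)) (n : ℕ) : RegExists (rsWord u w n) := by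
  cases w with
  | nil => exact regExists_rsWord_nil hc0 hc hu h1 n
  | cons p v => exact (isRegValue_rsWord hc0 hc hu h1 hw n).regExists

end

/-! ### Regularized integrals along `η_u` -/

/-- A branch of `log (x - b)` along `γ` that is asymptotic to `log x` at the end of `γ`. -/
structure IsLogAlong (γ : ℝ → ℂ) (b : ℂ) (L : ℝ → ℂ) : Prop where
  continuousOn : ContinuousOn L (Ioo 0 1)
  exp_eq : ∀ t ∈ Ioo (0 : ℝ) 1, Complex.exp (L t) = γ t - b
  tendsto : Tendsto (fun t => L t - Complex.log (γ t)) (𝓝[<] (1 : ℝ)) (𝓝 0)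

/-- The difference of the forms `(x - b)⁻¹ (log (x - b))^n / n!` and `x⁻¹ (log x)^n / n!` along
`γ`, where `L` is the branch of `log (x - b)`. -/
def logDiff (γ : ℝ → ℂ) (b : ℂ) (L : ℝ → ℂ) (n : ℕ) : ℝ → ℂ :=
  fForm γ b L n - fForm γ 0 (fun t => Complex.log (γ t)) n

/-- The primitive of `logDiff` that vanishes at the end of the path. -/
def logDiffPrimitive (γ : ℝ → ℂ) (L : ℝ → ℂ) (n : ℕ) (t : ℝ) : ℂ :=
  (L t ^ (n + 1) - Complex.log (γ t) ^ (n + 1)) / (n + 1).factorial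

section

variable {c : ℝ} {γ : ℝ → ℂ} {b : ℂ} {L : ℝ → ℂ}

lemma IsLogAlong.eventually_eq_log (hL : IsLogAlong γ b L) {t : ℝ} (ht : t ∈ Ioo (0 : ℝ) 1) :
    ∀ᶠ s in 𝓝 t, L s = L t + Complex.log ((γ s - b) / (γ t - b)) := by
  have him : ContinuousAt (fun s => (L s - L t).im) t :=
    Complex.continuous_im.continuousAt.comp
      ((hL.continuousOn.continuousAt (Ioo_mem_nhds ht.1 ht.2)).sub continuousAt_const)
  have hpi : ∀ᶠ s in 𝓝 t, |(L s - L t).im| < Real.pi :=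
    him.abs.eventually (gt_mem_nhds (by simpa using Real.pi_pos))
  filter_upwards [hpi, Ioo_mem_nhds ht.1 ht.2] with s hs hs'
  rw [← hL.exp_eq s hs', ← hL.exp_eq t ht, ← Complex.exp_sub,
    Complex.log_exp (neg_lt_of_abs_lt hs) (lt_of_abs_lt hs).le, add_sub_cancel]

lemma IsLogAlong.hasDerivAt (hL : IsLogAlong γ b L) (hγ : GoodPath c γ) (hb : IsPole c b) {t : ℝ}
    (ht : t ∈ Ioo (0 : ℝ) 1) : HasDerivAt L (eForm γ b t) t := by
  have hne := hγ.sub_ne_zero hb ht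
  have hquot : HasDerivAt (fun s => (γ s - b) / (γ t - b)) (deriv γ t / (γ t - b)) t :=
    ((hγ.differentiableAt t ht).hasDerivAt.sub_const b).div_const _
  have hlog := (hquot.clog_real (by rw [div_self hne]; exact Complex.one_mem_slitPlane)).const_add
    (L t)
  rw [div_self hne, div_one] at hlog
  exact hlog.congr_of_eventuallyEq (hL.eventually_eq_log ht)

lemma GoodPath.hasDerivAt_log (hc : 0 < c) (hγ : GoodPath c γ) {t : ℝ} (ht : t ∈ Ioo (0 : ℝ) 1) :
    HasDerivAt (fun t => Complex.log (γ t)) (eForm γ 0 t) t :=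
  ((hγ.differentiableAt t ht).hasDerivAt.clog_real (Or.inl (hc.trans (hγ.mem t ht).1))).congr_deriv
    (by rw [eForm, sub_zero])

lemma IsLogAlong.hasDerivAt_logDiffPrimitive (hL : IsLogAlong γ b L) (hc : 0 < c)
    (hγ : GoodPath c γ) (hb : IsPole c b) (n : ℕ) {t : ℝ} (ht : t ∈ Ioo (0 : ℝ) 1) :
    HasDerivAt (logDiffPrimitive γ L n) (logDiff γ b L n t) t := by
  refine ((((hL.hasDerivAt hγ hb ht).pow (n + 1)).sub
    ((hγ.hasDerivAt_log hc ht).pow (n + 1))).div_const ((n + 1).factorial : ℂ)).congr_deriv ?_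
  have hn := n.factorial_ne_zero
  simp only [logDiff, fForm, Pi.sub_apply, eForm, Nat.factorial_succ, add_tsub_cancel_right]
  push_cast
  field_simp

lemma logDiff_zero (γ : ℝ → ℂ) (b : ℂ) (L : ℝ → ℂ) : logDiff γ b L 0 = pathLast γ b 0 := by
  ext t
  simp [logDiff, pathLast_eq, fForm, eForm]

lemma logDiff_succ (γ : ℝ → ℂ) (b : ℂ) (L : ℝ → ℂ) (n : ℕ) :
    logDiff γ b L (n + 1) = eForm γ b * logDiffPrimitive γ L n + pathLast γ b (n + 1) := by
  ext t
  simp only [logDiff, logDiffPrimitive, pathLast_eq, fForm, eForm, Pi.sub_apply, Pi.add_apply,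
    Pi.mul_apply]
  ring

lemma IsLogAlong.sub_log_mem_growth (hL : IsLogAlong γ b L) (hc : 0 < c) (hγ : GoodPath c γ)
    (hb : IsPole c b) : (L - fun t => Complex.log (γ t)) ∈ growth 0 1 := by
  have hgrowth : logDiff γ b L 0 ∈ growth (-1) 0 :=
    logDiff_zero γ b L ▸ growth_anti (by norm_num) le_rfl (hγ.pathLast_mem_growth hc hb 0)
  have htail := tail_eq_of_hasDerivAt hgrowth
    (F := fun t => -(L t - Complex.log (γ t)))
    (fun t ht => (hL.hasDerivAt_logDiffPrimitive hc hγ hb 0 ht).neg.congr_of_eventuallyEq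
      (Eventually.of_forall fun s => by simp [logDiffPrimitive]))
    (by simpa using hL.tendsto.neg)
  exact mem_growth_congr (fun t ht => by simp [htail ht])
    (neg_mem (decay_mem_growth (tail (logDiff γ b L 0))))

lemma IsLogAlong.mem_growth (hL : IsLogAlong γ b L) (hc : 0 < c) (hγ : GoodPath c γ)
    (hb : IsPole c b) : L ∈ growth 0 0 := by
  simpa using add_mem (growth_anti le_rfl zero_le_one (hL.sub_log_mem_growth hc hγ hb))
    (hγ.log_mem_growth hc)

lemma IsLogAlong.logDiffPrimitive_mem_growth (hL : IsLogAlong γ b L) (hc : 0 < c)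
    (hγ : GoodPath c γ) (hb : IsPole c b) (n : ℕ) : logDiffPrimitive γ L n ∈ growth 0 1 := by
  set ℓ : ℝ → ℂ := fun t => Complex.log (γ t) with hℓ
  have hsum : ∑ i ∈ Finset.range (n + 1), L ^ i * ℓ ^ (n - i) ∈ growth 0 0 :=
    sum_mem fun i _ => by
      simpa using mul_mem_growth (pow_mem_growth_zero (hL.mem_growth hc hγ hb) i)
        (pow_mem_growth_zero (hγ.log_mem_growth hc) (n - i))
  have hfactor : logDiffPrimitive γ L n = ((n + 1).factorial : ℂ)⁻¹ •
      ((∑ i ∈ Finset.range (n + 1), L ^ i * ℓ ^ (n - i)) * (L - ℓ)) := by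
    have hgeom := geom_sum₂_mul L ℓ (n + 1)
    simp only [Nat.add_sub_cancel] at hgeom
    rw [hgeom]
    ext t
    simp [logDiffPrimitive, hℓ, div_eq_inv_mul]
  rw [hfactor]
  exact Submodule.smul_mem _ _ (by
    simpa using mul_mem_growth hsum (hL.sub_log_mem_growth hc hγ hb))

lemma IsLogAlong.logDiff_mem_growth (hL : IsLogAlong γ b L) (hc : 0 < c) (hγ : GoodPath c γ)
    (hb : IsPole c b) (n : ℕ) : logDiff γ b L n ∈ growth (-1) 0 := by
  have hlast (m : ℕ) : pathLast γ b m ∈ growth (-1) 0 :=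
    growth_anti (by norm_num) le_rfl (hγ.pathLast_mem_growth hc hb m)
  cases n with
  | zero => exact logDiff_zero γ b L ▸ hlast 0
  | succ n =>
    rw [logDiff_succ]
    refine add_mem ?_ (hlast _)
    simpa using mul_mem_growth (hγ.eForm_mem_growth hc hb)
      (hL.logDiffPrimitive_mem_growth hc hγ hb n)

lemma IsLogAlong.tail_logDiff_eq (hL : IsLogAlong γ b L) (hc : 0 < c) (hγ : GoodPath c γ)
    (hb : IsPole c b) (n : ℕ) :
    EqOn (tail (logDiff γ b L n)).1 (-logDiffPrimitive γ L n) (Ioo 0 1) := by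
  refine tail_eq_of_hasDerivAt (hL.logDiff_mem_growth hc hγ hb n)
    (fun t ht => (hL.hasDerivAt_logDiffPrimitive hc hγ hb n ht).neg) ?_
  have hgrowth := hasGrowth_of_mem_growth (neg_mem (hL.logDiffPrimitive_mem_growth hc hγ hb n))
  exact (hgrowth.comp (tendsto_principal.2 (Ioo_mem_nhdsLT one_pos))).tendsto_zero_one tendsto_id

lemma IsLogAlong.tail_logDiff_succ (hL : IsLogAlong γ b L) (hc : 0 < c) (hγ : GoodPath c γ)
    (hb : IsPole c b) (n : ℕ) : tail (logDiff γ b L (n + 1)) =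
      -op (eForm γ b) (tail (logDiff γ b L n)) + tail (pathLast γ b (n + 1)) := by
  have he := hγ.eForm_mem_growth hc hb
  rw [← map_neg, op_apply he, ← tail_add (mul_decay_mem_growth he _)
    (growth_anti (by norm_num) le_rfl (hγ.pathLast_mem_growth hc hb (n + 1))), logDiff_succ]
  exact tail_congr fun t ht => by simp [hL.tail_logDiff_eq hc hγ hb n ht]

lemma pathTail_append (γ : ℝ → ℂ) (as bs : List ℂ) (b : ℂ) (n : ℕ) :
    pathTail γ (as ++ bs) b n = (as.map fun a => op (eForm γ a)).prod (pathTail γ bs b n) := by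
  rw [pathTail, List.map_append, List.prod_append, Module.End.mul_apply, pathTail]

lemma pathTail_cons (γ : ℝ → ℂ) (a : ℂ) (as : List ℂ) (b : ℂ) (n : ℕ) :
    pathTail γ (a :: as) b n = op (eForm γ a) (pathTail γ as b n) := rfl

lemma IsLogAlong.tail_logDiff_eq_sum (hL : IsLogAlong γ b L) (hc : 0 < c) (hγ : GoodPath c γ)
    (hb : IsPole c b) (m : ℕ) : tail (logDiff γ b L m) = ∑ n ∈ Finset.range (m + 1),
      (-1 : ℂ) ^ n • pathTail γ (List.replicate n b) b (m - n) := by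
  induction m with
  | zero => simp [logDiff_zero, pathTail]
  | succ m ih =>
    rw [hL.tail_logDiff_succ hc hγ hb, ih, Finset.sum_range_succ' _ (m + 1), pow_zero, one_smul,
      map_sum, ← Finset.sum_neg_distrib]
    refine congrArg₂ _ (Finset.sum_congr rfl fun n _ => ?_) rfl
    rw [map_smul, List.replicate_succ, pathTail_cons, Nat.add_sub_add_right, pow_succ, mul_neg_one]
    exact (neg_smul _ _).symm

end

lemma etaWord_cons (u : ℂ) (L : ℝ → ℂ) (p : ℂ × ℕ) (v : List (ℂ × ℕ)) (m : ℕ) :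
    etaWord u L (p :: v) m = (eForm (eta u) (p.1 / u) - eForm (eta u) 0) ::
      ((arrayWord 0 (· / u) (p :: v)).tail.map (eForm (eta u)) ++
        [logDiff (eta u) (1 / u) L m]) := by
  rw [List.map_tail, map_arrayWord, one_div]
  rfl

lemma isRegValue_etaWord {c : ℝ} (hc : 0 < c) {u : ℂ} (hγ : GoodPath c (eta u)) {L : ℝ → ℂ}
    (hL : IsLogBranch u L) (h1 : IsPole c (1 / u)) {p : ℂ × ℕ} {v : List (ℂ × ℕ)}
    (hw : ∀ q ∈ p :: v, IsPole c (q.1 / u)) (m : ℕ) :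
    IsRegValue (fun z => iterInt (etaWord u L (p :: v) m) z (1 - z))
      (∑ n ∈ Finset.range (m + 1), (-1) ^ n *
        total (eForm (eta u) (p.1 / u) - eForm (eta u) 0)
          (pathTail (eta u) ((arrayWord 0 (· / u) (p :: v)).tail ++ List.replicate n (1 / u))
            (1 / u) (m - n))) := by
  have hL' : IsLogAlong (eta u) (1 / u) L :=
    ⟨hL.continuousOn, fun t ht => one_div u ▸ hL.exp_eq t ht, hL.tendsto⟩
  have hval := isRegValue_iterInt (hγ.eForm_sub_mem_growth hc (hw p List.mem_cons_self))
    (p := (arrayWord 0 (· / u) (p :: v)).tail.map (eForm (eta u)))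
    (List.forall_mem_map.2 fun a ha => hγ.eForm_mem_growth hc
      (forall_mem_arrayWord (isPole_zero hc) hw a (List.mem_of_mem_tail ha)))
    (hL'.logDiff_mem_growth hc hγ h1 m)
  rw [hL'.tail_logDiff_eq_sum hc hγ h1, map_sum, map_sum] at hval
  simp only [map_smul, smul_eq_mul, List.map_map] at hval
  simp only [etaWord_cons, pathTail_append]
  exact hval

/-! ### Sums over compositions -/

lemma exists_blocks_eq_succ_cons {n : ℕ} (c : Composition (n + 1)) :
    ∃ b bs, c.blocks = (b + 1) :: bs := by
  obtain ⟨b, bs, hb⟩ := List.exists_cons_of_ne_nil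
    (mt c.blocks_eq_nil.1 n.succ_ne_zero)
  obtain ⟨i, rfl⟩ := Nat.exists_eq_add_of_lt (c.blocks_pos (hb ▸ List.mem_cons_self : b ∈ c.blocks))
  exact ⟨_, bs, by rw [hb, Nat.zero_add]⟩

/-- The composition of `n + 2` obtained from one of `n + 1` by prepending a block of size one
(left summand) or by enlarging the first block by one (right summand). -/
def compositionExtend {n : ℕ} : Composition (n + 1) ⊕ Composition (n + 1) → Composition (n + 2)
  | .inl c => ⟨1 :: c.blocks, fun h => by
      rcases List.mem_cons.1 h with rfl | h
      · exact one_pos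
      · exact c.blocks_pos h, by rw [List.sum_cons, c.blocks_sum]; ring⟩
  | .inr c => ⟨(c.blocks.headD 0 + 1) :: c.blocks.tail, fun h => by
      rcases List.mem_cons.1 h with rfl | h
      · exact Nat.succ_pos _
      · exact c.blocks_pos (List.mem_of_mem_tail h), by
      have h := c.blocks_sum
      obtain ⟨b, bs, hb⟩ := exists_blocks_eq_succ_cons c
      rw [hb, List.sum_cons] at h
      rw [hb, List.headD_cons, List.tail_cons, List.sum_cons]
      omega⟩

lemma compositionExtend_injective (n : ℕ) : Function.Injective (compositionExtend (n := n)) := by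
  rintro (c | c) (d | d) h <;>
  obtain ⟨b, bs, hb⟩ := exists_blocks_eq_succ_cons c <;>
  obtain ⟨b', bs', hb'⟩ := exists_blocks_eq_succ_cons d <;>
  have h' := congrArg Composition.blocks h <;>
  simp only [compositionExtend, hb, hb', List.headD_cons, List.tail_cons, List.cons.injEq,
    add_left_inj, Nat.right_eq_add, Nat.add_eq_right, Nat.succ_ne_zero, false_and, true_and] at h'
  · exact congrArg Sum.inl (Composition.ext (by rw [hb, hb', h'.1, h'.2]))
  · exact congrArg Sum.inr (Composition.ext (by rw [hb, hb', h'.1, h'.2]))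

lemma compositionExtend_surjective (n : ℕ) : Function.Surjective (compositionExtend (n := n)) := by
  intro c
  obtain ⟨b, bs, hb⟩ := exists_blocks_eq_succ_cons c
  have hs := c.blocks_sum
  rw [hb, List.sum_cons] at hs
  have hpos : ∀ i ∈ bs, 0 < i := fun i hi => c.blocks_pos (hb ▸ List.mem_cons_of_mem _ hi)
  rcases b with - | b
  · exact ⟨.inl ⟨bs, fun h => hpos _ h, by omega⟩, Composition.ext hb.symm⟩
  · exact ⟨.inr ⟨(b + 1) :: bs, fun h => (List.mem_cons.1 h).elim
      (fun h => h ▸ Nat.succ_pos _) (hpos _), by rw [List.sum_cons]; omega⟩,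
      Composition.ext hb.symm⟩

lemma sum_splitWrtComposition_cons_cons {α M : Type*} [AddCommMonoid M] (F : List (List α) → M)
    (p q : α) (w : List α) :
    ∑ c : Composition (p :: q :: w).length, F ((p :: q :: w).splitWrtComposition c) =
      ∑ c : Composition (q :: w).length, (F ([p] :: (q :: w).splitWrtComposition c) +
        F ((p :: ((q :: w).splitWrtComposition c).headD []) ::
          ((q :: w).splitWrtComposition c).tail)) := by
  refine (Function.Bijective.sum_comp ⟨compositionExtend_injective w.length,
    compositionExtend_surjective w.length⟩
      fun c => F ((p :: q :: w).splitWrtComposition c)).symm.trans ?_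
  rw [Fintype.sum_sum_type, ← Finset.sum_add_distrib]
  refine Finset.sum_congr rfl fun c _ => ?_
  obtain ⟨b, bs, hb⟩ := exists_blocks_eq_succ_cons c
  simp only [compositionExtend, List.splitWrtComposition, hb,
    List.headD_cons, List.tail_cons, List.splitWrtCompositionAux_cons, List.take_succ_cons,
    List.drop_succ_cons, List.take_zero, List.drop_zero]

lemma splitWrtComposition_cons {α : Type*} (a : α) (l : List α) (c : Composition (l.length + 1)) :
    ∃ b L, (a :: l).splitWrtComposition c = (a :: b) :: L := by
  obtain ⟨b, bs, hb⟩ := exists_blocks_eq_succ_cons c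
  exact ⟨l.take b, (l.drop b).splitWrtCompositionAux bs, by
    rw [List.splitWrtComposition, hb, List.splitWrtCompositionAux_cons, List.take_succ_cons,
      List.drop_succ_cons]⟩

lemma exists_mem_merge_fst_eq {w : List (ℂ × ℕ)} {c : Composition w.length} {q : ℂ × ℕ}
    (hq : q ∈ (w.splitWrtComposition c).map merge) : ∃ r ∈ w, q.1 = r.1 := by
  obtain ⟨B, hB, rfl⟩ := List.mem_map.1 hq
  obtain ⟨r, B', rfl⟩ :=
    List.exists_cons_of_length_pos (List.length_pos_of_mem_splitWrtComposition hB)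
  refine ⟨r, ?_, rfl⟩
  rw [← List.flatten_splitWrtComposition w c]
  exact List.mem_flatten.2 ⟨_, hB, List.mem_cons_self⟩

section

variable {R : Type*} [Ring R] (f : R) (g : ℂ → R)

lemma prod_arrayWord_cons (p : ℂ × ℕ) (w : List (ℂ × ℕ)) :
    (arrayWord f g (p :: w)).prod = g p.1 * (arrayWord f g (p :: w)).tail.prod :=
  List.prod_cons

lemma prod_tail_arrayWord_cons (p : ℂ × ℕ) (w : List (ℂ × ℕ)) :
    (arrayWord f g (p :: w)).tail.prod = f ^ (p.2 - 1) * (arrayWord f g w).prod := by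
  rw [arrayWord, List.flatMap_cons, List.cons_append, List.tail_cons, List.prod_append,
    List.prod_replicate, ← arrayWord]

lemma prod_tail_arrayWord_merge_add (p q : ℂ × ℕ) (b : List (ℂ × ℕ)) (L : List (List (ℂ × ℕ)))
    (hp : 1 ≤ p.2) (hq : 1 ≤ q.2) :
    (-1) ^ ([p] :: (q :: b) :: L).length *
        (arrayWord f g (([p] :: (q :: b) :: L).map merge)).tail.prod +
      (-1) ^ ((p :: q :: b) :: L).length *
        (arrayWord f g (((p :: q :: b) :: L).map merge)).tail.prod =
      f ^ (p.2 - 1) * (f - g q.1) * ((-1) ^ ((q :: b) :: L).length *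
        (arrayWord f g (((q :: b) :: L).map merge)).tail.prod) := by
  have hk : (merge (p :: q :: b)).2 - 1 = (p.2 - 1) + 1 + ((merge (q :: b)).2 - 1) := by
    simp only [merge, List.map_cons, List.sum_cons]
    omega
  have hz : (merge (q :: b)).1 = q.1 := rfl
  have h1 : merge [p] = p := rfl
  simp only [List.map_cons, prod_arrayWord_cons, prod_tail_arrayWord_cons, hk, hz, h1,
    List.length_cons, pow_add f, pow_one]
  rcases neg_one_pow_eq_or R L.length with h | h <;>
  · rw [pow_succ, pow_succ, h]
    noncomm_ring

/-- Merging two neighbouring columns replaces the letter `g z` of the second one by `f` and changes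
the sign, so that the sum over all mergers turns each of these letters into `f - g z`. -/
lemma sum_prod_tail_arrayWord_merge (p : ℂ × ℕ) (w : List (ℂ × ℕ)) (hw : ∀ q ∈ p :: w, 1 ≤ q.2) :
    ∑ c : Composition (p :: w).length,
      (-1) ^ ((p :: w).splitWrtComposition c).length *
        (arrayWord f g (((p :: w).splitWrtComposition c).map merge)).tail.prod =
      -(arrayWord f (fun z => f - g z) (p :: w)).tail.prod := by
  induction w generalizing p with
  | nil =>
    have : Subsingleton (Composition [p].length) :=
      Fintype.card_le_one_iff_subsingleton.1 (composition_card 1).le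
    rw [Fintype.sum_subsingleton _ (Composition.ones [p].length)]
    simp [List.splitWrtComposition, List.splitWrtCompositionAux, merge, arrayWord]
  | cons q w ih =>
    rw [prod_tail_arrayWord_cons, prod_arrayWord_cons, ← mul_assoc, ← mul_neg,
      ← ih q fun r hr => hw r (List.mem_cons_of_mem _ hr), Finset.mul_sum]
    refine (sum_splitWrtComposition_cons_cons (fun L => (-1) ^ L.length *
      (arrayWord f g (L.map merge)).tail.prod) p q w).trans (Finset.sum_congr rfl fun c _ => ?_)
    obtain ⟨b, L, hL⟩ := splitWrtComposition_cons q w c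
    rw [hL]
    exact prod_tail_arrayWord_merge_add f g p q b L (hw p (by simp)) (hw q (by simp))

end

/-! ### Comparison of the two sides -/

lemma neg_one_pow_mul_apply {R M : Type*} [CommRing R] [AddCommGroup M] [Module R M] (n : ℕ)
    (T : Module.End R M) (k : M) : ((-1) ^ n * T) k = (-1 : R) ^ n • T k := by
  rcases n.even_or_odd with h | h <;> simp [h.neg_one_pow]

lemma prod_tail_arrayWord_neg {R : Type*} [Ring R] (e : ℂ → R) (u : ℂ) (w : List (ℂ × ℕ)) :
    (arrayWord (-e 0) (fun z => -e (z / u)) w).tail.prod =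
      (-1) ^ (arrayWord 0 (· / u) w).tail.length * ((arrayWord 0 (· / u) w).tail.map e).prod := by
  rw [← map_arrayWord (F := fun a => -e a), ← List.map_tail]
  have h := ((arrayWord 0 (· / u) w).tail.map e).prod_map_neg
  rwa [List.map_map, List.length_map] at h

lemma sum_prod_tail_arrayWord_merge_poles {R : Type*} [Ring R] (e : ℂ → R) (u : ℂ) {p : ℂ × ℕ}
    {v : List (ℂ × ℕ)} (hv : ∀ q ∈ p :: v, 1 ≤ q.2) :
    ∑ d : Composition (p :: v).length, (-1) ^ ((p :: v).splitWrtComposition d).length *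
        (arrayWord (-e 0) (fun z => e (z / u) - e 0)
          (((p :: v).splitWrtComposition d).map merge)).tail.prod =
      (-1) ^ ((p :: v).map Prod.snd).sum *
        ((arrayWord 0 (· / u) (p :: v)).tail.map e).prod := by
  have hlen : (arrayWord 0 (· / u) (p :: v)).tail.length + 1 = ((p :: v).map Prod.snd).sum :=
    length_arrayWord (e := (0 : ℂ)) (a := (· / u)) hv
  have hsub : (fun z => -e 0 - (e (z / u) - e 0)) = fun z => -e (z / u) := funext fun z => by abel
  rw [sum_prod_tail_arrayWord_merge _ _ p v hv, hsub, prod_tail_arrayWord_neg, ← hlen, pow_succ,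
    mul_neg_one, neg_mul]

section

variable {c : ℝ} {u : ℂ} {p : ℂ × ℕ} {v : List (ℂ × ℕ)}

lemma regInt_rsWord_splitWrtComposition (hc0 : 0 < c) (hc : c ≤ 1 / 2) (hu : u ≠ 0)
    (h1 : IsPole c (1 / u)) (hw : ∀ q ∈ p :: v, IsPole c (q.1 / u)) (m : ℕ)
    (d : Composition (p :: v).length) :
    regInt (rsWord u (((p :: v).splitWrtComposition d).map merge) m) =
      total (eForm invBeta (p.1 / u) - eForm invBeta 0)
        ((arrayWord (-op (eForm invBeta 0))
          (fun z => op (eForm invBeta (z / u)) - op (eForm invBeta 0))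
            (((p :: v).splitWrtComposition d).map merge)).tail.prod
              (tail (pathLast invBeta (1 / u) m))) := by
  have hpole : ∀ q ∈ ((p :: v).splitWrtComposition d).map merge, IsPole c (q.1 / u) :=
    fun q hq => by
      obtain ⟨r, hr, hqr⟩ := exists_mem_merge_fst_eq hq
      exact hqr ▸ hw r hr
  obtain ⟨b, L, hL⟩ := splitWrtComposition_cons p v d
  rw [hL, List.map_cons] at hpole ⊢
  exact (isRegValue_rsWord hc0 hc hu h1 hpole m).regInt_eq

lemma sum_regInt_rsWord (hc0 : 0 < c) (hc : c ≤ 1 / 2) (hu : u ≠ 0) (h1 : IsPole c (1 / u))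
    (hw : ∀ q ∈ p :: v, IsPole c (q.1 / u) ∧ 1 ≤ q.2) (m : ℕ) :
    ∑ d : Composition (p :: v).length, (-1) ^ ((p :: v).splitWrtComposition d).length *
        regInt (rsWord u (((p :: v).splitWrtComposition d).map merge) m) =
      (-1) ^ ((p :: v).map Prod.snd).sum *
        total (eForm invBeta (p.1 / u) - eForm invBeta 0)
          (pathTail invBeta (arrayWord 0 (· / u) (p :: v)).tail (1 / u) m) := by
  set e : ℂ → Module.End ℂ Decay := fun a => op (eForm invBeta a)
  set T := total (eForm invBeta (p.1 / u) - eForm invBeta 0)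
  set k := tail (pathLast invBeta (1 / u) m)
  calc
    _ = ∑ d : Composition (p :: v).length,
        T (((-1) ^ ((p :: v).splitWrtComposition d).length *
          (arrayWord (-e 0) (fun z => e (z / u) - e 0)
            (((p :: v).splitWrtComposition d).map merge)).tail.prod) k) :=
      Finset.sum_congr rfl fun d _ => by
        rw [regInt_rsWord_splitWrtComposition hc0 hc hu h1 (fun q hq => (hw q hq).1),
          neg_one_pow_mul_apply, map_smul, smul_eq_mul]
    _ = T (((-1) ^ ((p :: v).map Prod.snd).sum *
          ((arrayWord 0 (· / u) (p :: v)).tail.map e).prod) k) := by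
      rw [← map_sum, ← LinearMap.sum_apply,
        sum_prod_tail_arrayWord_merge_poles e u fun q hq => (hw q hq).2]
    _ = _ := by
      rw [neg_one_pow_mul_apply, map_smul, smul_eq_mul, pathTail]

lemma neg_one_pow_mul_regInt_etaWord (hc0 : 0 < c) (hcu : c < u.re / 2) (hu1 : u.re ≤ 1)
    (hu : u ≠ 0) (h1 : IsPole c (1 / u)) {L : ℝ → ℂ} (hL : IsLogBranch u L)
    (hw : ∀ q ∈ p :: v, IsPole c (q.1 / u) ∧ 1 ≤ q.2) (m : ℕ) :
    (-1) ^ ((p :: v).map Prod.snd).sum * regInt (etaWord u L (p :: v) m) =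
      ∑ n ∈ Finset.range (m + 1),
        ∑ d : Composition (p :: v ++ List.replicate n (1, 1)).length,
          (-1) ^ ((p :: v ++ List.replicate n (1, 1)).splitWrtComposition d).length *
            regInt (rsWord u
              (((p :: v ++ List.replicate n (1, 1)).splitWrtComposition d).map merge) (m - n)) := by
  have hc : c ≤ 1 / 2 := by linarith
  have hη : GoodPath c (eta u) := goodPath_eta hc0 hcu (by linarith)
  have hwn (n : ℕ) : ∀ q ∈ p :: (v ++ List.replicate n (1, 1)), IsPole c (q.1 / u) ∧ 1 ≤ q.2 :=
    fun q hq => (List.mem_append.1 (List.cons_append ▸ hq)).elim (hw q)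
      fun h => List.eq_of_mem_replicate h ▸ ⟨h1, le_rfl⟩
  have hpoles (n : ℕ) : ∀ a ∈ (arrayWord 0 (· / u) (p :: (v ++ List.replicate n (1, 1)))).tail,
      IsPole c a := fun a ha =>
    forall_mem_arrayWord (isPole_zero hc0) (fun q hq => (hwn n q hq).1) a
      (List.mem_of_mem_tail ha)
  rw [(isRegValue_etaWord hc0 hη hL h1 (fun q hq => (hw q hq).1) m).regInt_eq, Finset.mul_sum]
  refine Finset.sum_congr rfl fun n _ => ?_
  rw [← tail_arrayWord_append_replicate (List.cons_ne_nil p v), List.cons_append,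
    sum_regInt_rsWord hc0 hc hu h1 (hwn n),
    total_pathTail_eq hc0 (by linarith) (goodPath_invBeta hc) hη (hw p List.mem_cons_self).1
      (hpoles n) h1, ← List.cons_append, List.map_append, List.sum_append, List.map_replicate,
    List.sum_replicate, smul_eq_mul, mul_one, pow_add, mul_assoc]

end

lemma coeff_rsStar (Q : Finset ℂ) (α : ℤ) (w : List (ℂ × ℕ)) (n : ℕ) :
    PowerSeries.coeff n (rsStar Q α w) = 1 / (2 * Real.pi * Complex.I) * ∑ u ∈ Q.erase 0, u ^ α *
      ∑ d : Composition w.length, (-1) ^ (w.splitWrtComposition d).length *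
        regInt (rsWord u ((w.splitWrtComposition d).map merge) n) := by
  simp only [rsStar, map_sum, rs, PowerSeries.coeff_mk, List.length_map, Finset.mul_sum]
  rw [Finset.sum_comm]
  exact Finset.sum_congr rfl fun u _ => Finset.sum_congr rfl fun d _ => by ring

lemma coeff_sum_etaInt {Q : Finset ℂ} (hQ : IsAdmissible Q) (α : ℤ) {w : List (ℂ × ℕ)}
    (hw : w ≠ []) (hwQ : ∀ p ∈ w, p.1 ∈ Q ∧ 1 ≤ p.2) {L : ℂ → ℝ → ℂ}
    (hL : ∀ u ∈ Q, u ≠ 0 → IsLogBranch u (L u)) (m : ℕ) :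
    PowerSeries.coeff m (((-1) ^ (w.map Prod.snd).sum / (2 * Real.pi * Complex.I) : ℂ) •
        ∑ u ∈ Q.erase 0, u ^ α • etaInt u (L u) w) =
      ∑ n ∈ Finset.range (m + 1),
        PowerSeries.coeff (m - n) (rsStar Q α (w ++ List.replicate n (1, 1))) := by
  obtain ⟨p, v, rfl⟩ := List.exists_cons_of_ne_nil hw
  simp only [coeff_rsStar, PowerSeries.coeff_smul, map_sum, smul_eq_mul, etaInt,
    PowerSeries.coeff_mk]
  rw [← Finset.mul_sum, Finset.sum_comm, div_eq_mul_one_div, mul_comm ((-1 : ℂ) ^ _), mul_assoc,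
    Finset.mul_sum]
  refine congrArg _ (Finset.sum_congr rfl fun u hu => ?_)
  obtain ⟨hu0, huQ⟩ := Finset.mem_erase.1 hu
  obtain ⟨c, hc0, hcu, hpole⟩ := hQ.exists_isPole huQ hu0
  rw [← Finset.mul_sum, ← neg_one_pow_mul_regInt_etaWord hc0 hcu (hQ.re_le_one huQ hu0) hu0
    (hpole 1 hQ.one_mem) (hL u huQ hu0) (fun q hq => ⟨hpole _ (hwQ q hq).1, (hwQ q hq).2⟩) m,
    mul_left_comm]

lemma hasSum_mul_X_pow {R : Type*} [Semiring R] [TopologicalSpace R] {f : ℕ → PowerSeries R}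
    {g : PowerSeries R}
    (h : ∀ m, PowerSeries.coeff m g = ∑ n ∈ Finset.range (m + 1), PowerSeries.coeff (m - n) (f n)) :
    HasSum (fun n => f n * PowerSeries.X ^ n) g := by
  refine (PowerSeries.WithPiTopology.hasSum_iff_hasSum_coeff R).2 fun m => ?_
  have hsum : PowerSeries.coeff m g =
      ∑ n ∈ Finset.range (m + 1), PowerSeries.coeff m (f n * PowerSeries.X ^ n) :=
    (h m).trans <| Finset.sum_congr rfl fun n hn => by
      rw [PowerSeries.coeff_mul_X_pow', if_pos (Finset.mem_range_succ_iff.1 hn)]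
  rw [hsum]
  refine hasSum_sum_of_ne_finset_zero fun n hn => ?_
  rw [PowerSeries.coeff_mul_X_pow', if_neg (mt Finset.mem_range_succ_iff.2 hn)]

end SymMPL

end

theorem corollary3p4 (Q : Finset ℂ) (hQ : SymMPL.IsAdmissible Q) (α : ℤ)
    (w : List (ℂ × ℕ)) (hw : w ≠ []) (hwQ : ∀ p ∈ w, p.1 ∈ Q ∧ 1 ≤ p.2)
    (L : ℂ → ℝ → ℂ) (hL : ∀ u ∈ Q, u ≠ 0 → SymMPL.IsLogBranch u (L u)) :
    -- the regularized integrals on both sides exist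
    (∀ u ∈ Q, u ≠ 0 → ∀ v : List (ℂ × ℕ), (∀ p ∈ v, p.1 ∈ Q ∧ 1 ≤ p.2) →
      ∀ n : ℕ, SymMPL.RegExists (SymMPL.rsWord u v n)) ∧
    (∀ u ∈ Q, u ≠ 0 → ∀ m : ℕ, SymMPL.RegExists (SymMPL.etaWord u (L u) w m)) ∧
    -- the identity of formal power series in `t = PowerSeries.X`
    HasSum
      (fun n : ℕ => SymMPL.rsStar Q α (w ++ List.replicate n (1, 1)) * PowerSeries.X ^ n)
      (((-1) ^ (w.map Prod.snd).sum / (2 * Real.pi * Complex.I) : ℂ) •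
        ∑ u ∈ Q.erase 0, u ^ α • SymMPL.etaInt u (L u) w) := by
  refine ⟨fun u hu hu0 v hv n => ?_, fun u hu hu0 m => ?_,
    SymMPL.hasSum_mul_X_pow (SymMPL.coeff_sum_etaInt hQ α hw hwQ hL)⟩
  · obtain ⟨c, hc0, hcu, hpole⟩ := hQ.exists_isPole hu hu0
    have hc : c ≤ 1 / 2 := by linarith [hQ.re_le_one hu hu0]
    exact SymMPL.regExists_rsWord hc0 hc hu0 (hpole 1 hQ.one_mem)
      (fun q hq => hpole _ (hv q hq).1) n
  · obtain ⟨p, v, rfl⟩ := List.exists_cons_of_ne_nil hw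
    obtain ⟨c, hc0, hcu, hpole⟩ := hQ.exists_isPole hu hu0
    have hη := SymMPL.goodPath_eta hc0 hcu (by linarith [hQ.re_le_one hu hu0])
    exact (SymMPL.isRegValue_etaWord hc0 hη (hL u hu hu0) (hpole 1 hQ.one_mem)
      (fun q hq => hpole _ (hwQ q hq).1) m).regExists
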